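/- **Setting.** Let $\mathcal S$ be a model of the axioms of abstract Stone duality (ASD). That is, $\mathcal S$ is a category with finite products and an object $\Sigma$ such that: * all exponentials $\Sigma^X$ exist, and $\Sigma$ is an internal distributive lattice, so each $\mathcal S(\Gamma,\Sigma)$ is a bounded distributive lattice, naturally in $\Gamma$; its order is the order of propositions (open predicates) in context $\Gamma$; * every object $X$ is sober: every $P:\Sigma^{\Sigma^X}$ that is prime, i.e. satisfies $\mathcal F P=P(\lambda x.\mathcal F(\lambda\phi.\phi x))$ for all $\mathcal F:\Sigma^{\Sigma^{\Sigma^X}}$, is $\lambda\phi.\phi a$ for a unique $a:X$ (in every context); * every nucleus on $Y$, i.e. $E:\Sigma^Y\to\Sigma^Y$ with $E(\lambda y.\mathcal F(\lambda\phi.\phi y))=E(\lambda y.\mathcal F(\lambda\phi.E\phi y))$ for all $\mathcal F:\Sigma^{\Sigma^{\Sigma^Y}}$, has a subspace $\{Y\mid E\}$, namely an object $X$ with $i:X\to Y$ and $I:\Sigma^X\to\Sigma^Y$ such that $\Sigma^i\cdot I=\mathrm{id}$, $I\cdot\Sigma^i=E$, and each $a:Y$ with $\phi a=E\phi a$ for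 all $\phi:\Sigma^Y$ (in every context) is $ib$ for a unique $b:X$; * the Phoa principle $F\sigma=F\bot\lor(\sigma\land F\top)$ holds for $F:\Sigma^\Sigma$ and $\sigma:\Sigma$; * there is a natural numbers object, and it is overt; * every overt discrete object $N$ has an object $\mathrm{Fin}(N)$ of lists, and the Scott principle holds: for $\Phi:\Sigma^{\Sigma^N}$ and $\xi:\Sigma^N$, $\ \Phi\xi=\exists\ell:\mathrm{Fin}(N).\ \Phi(\lambda n.n\in\ell)\land\forall n\in\ell.\xi n$. Here $N$ is *overt* if $\Sigma^!:\Sigma\to\Sigma^N$ has a left adjoint $\exists_N$, and *discrete* if equality on $N$ is given by a predicate $N\times N\to\Sigma$. Assume that every object of $\mathcal S$ is definable, i.e. obtained from overt discrete objects by repeated use of products, of exponentials $\Sigma^{(-)}$, and of subspaces $\{Y\mid E\}$ for nuclei $E$. **Abstract lattice bases.** Given an object $N$ with elements $0,1$ and binary operations $+,\star:N\times N\to N$, the *imposed order* $\preccurlyeq$ is the least open relation on $N$ (least also among open relations with parameters) such that $$0\preccurlyeq n\preccurlyeq n\preccurlyeq 1,\qquad k\star(n+m)\preccurlyeq(k\star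 n)+(k\star m),\qquad (n\preccurlyeq k)\land(k\preccurlyeq m)\Rightarrow (n\preccurlyeq m),$$ $$(k\preccurlyeq m)\land(k\preccurlyeq n)\Leftrightarrow (k\preccurlyeq m\star n),\qquad (n\preccurlyeq k)\land(m\preccurlyeq k)\Leftrightarrow (n+m\preccurlyeq k).$$ An *abstract (lattice) basis* $(N,0,1,+,\star,\ll)$ is an overt discrete object $N$ of $\mathcal S$ with elements $0,1$, binary operations $+,\star$ that possess an imposed order $\preccurlyeq$, and an open relation $\ll\ :N\times N\to\Sigma$ such that $$0\ll0,\qquad (n\ll p)\land(m\ll p)\Leftrightarrow(n+m\ll p),\qquad (m'\preccurlyeq m)\land (m\ll n)\land (n\preccurlyeq n')\Rightarrow (m'\ll n'),$$ $$(n\ll m)\Leftrightarrow\exists k.(n\ll k)\land(k\ll m),\qquad (n\ll m)\land (m\ll p)\land (m\ll q)\Rightarrow (n\ll p\star q),$$ $$(n\ll p+q)\Leftrightarrow\exists p'q'.(n\ll p'+q')\land(p'\ll p)\land(q'\ll q).$$ **Abstract matrices.** An *abstract matrix* from a basis $B$ to a basis $C$ is an open relation $H^m_n$, with $n\in B$ and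 $m\in C$, such that $$H^m_0,\qquad H^m_n\land H^m_p\Leftrightarrow H^m_{n+p},\qquad (n'\preccurlyeq n)\land H^m_n\land(m\preccurlyeq m')\Rightarrow H^{m'}_{n'},$$ $$H^{m'}_{n'}\Leftrightarrow\exists n\,m.(n'\ll n)\land H^m_n\land(m\ll m'),\qquad (n\ll0)\Leftrightarrow H^0_n,\qquad (n\ll1)\Leftrightarrow H^1_n,$$ $$H^{s\star t}_n\Leftrightarrow\exists m\,p.H^s_m\land H^t_p\land(n\ll m\star p),\qquad H^{s+t}_n\Leftrightarrow\exists m\,p.H^s_m\land H^t_p\land(n\ll m+p).$$ **Theorem.** 1. $\mathcal S$ is equivalent to the category whose objects are abstract lattice bases $(N,0,1,+,\star,\ll)$ in $\mathcal S$, whose morphisms are abstract matrices, whose identities are the relations $\ll$, and whose composition is relational: $(K\cdot H)^k_n\Leftrightarrow\exists m.\,H^m_n\land K^k_m$. 2. Let $\mathsf H\mathcal S$ be the category of second-class maps: its objects are those of $\mathcal S$, a morphism from $X$ to $Y$ is a morphism $H:\Sigma^Y\to\Sigma^X$ of $\mathcal S$, and composition is that of $\mathcal S$ in reverse order. Then $\mathsf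 H\mathcal S$ is equivalent to the category whose objects are abstract bases $(N,0,1,+,\star,\ll)$, whose morphisms are the open relations $\rho(n,m)$ such that $$\rho(0,k),\qquad \rho(n,k)\land\rho(m,k)\Leftrightarrow\rho(n+m,k),$$ $$\rho(n,m)\Leftrightarrow\exists n'.(n\ll n')\land\rho(n',m),\qquad \rho(n,m)\Leftrightarrow\exists m'.\rho(n,m')\land(m'\ll m),$$ whose identities are the relations $\ll$, and whose composition is relational. -/

import Mathlib

open CategoryTheory MonoidalCategory CartesianMonoidalCategory

universe v u

namespace ASD

/-- A category with finite products and an object `Sig` (the Sierpinski object) of which all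
exponentials `pow X` exist, and which is an internal distributive lattice. By the Yoneda lemma an
internal distributive lattice is a distributive lattice structure on each hom-set `Γ ⟶ Sig`,
preserved by precomposition. The exponential is given by evaluation and abstraction satisfying
the beta and eta rules. -/
class SierpinskiCategory (S : Type u) [Category.{v} S] [CartesianMonoidalCategory S] where
  Sig : S
  lattice : ∀ Γ : S, DistribLattice (Γ ⟶ Sig)
  bounded : ∀ Γ : S, BoundedOrder (Γ ⟶ Sig)
  comp_inf : ∀ {Γ Δ : S} (f : Δ ⟶ Γ) (σ τ : Γ ⟶ Sig), f ≫ (σ ⊓ τ) = (f ≫ σ) ⊓ (f ≫ τ)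
  comp_sup : ∀ {Γ Δ : S} (f : Δ ⟶ Γ) (σ τ : Γ ⟶ Sig), f ≫ (σ ⊔ τ) = (f ≫ σ) ⊔ (f ≫ τ)
  comp_top : ∀ {Γ Δ : S} (f : Δ ⟶ Γ), f ≫ (⊤ : Γ ⟶ Sig) = ⊤
  comp_bot : ∀ {Γ Δ : S} (f : Δ ⟶ Γ), f ≫ (⊥ : Γ ⟶ Sig) = ⊥
  pow : S → S
  ev : ∀ X : S, pow X ⊗ X ⟶ Sig
  lam : ∀ {Γ X : S}, (Γ ⊗ X ⟶ Sig) → (Γ ⟶ pow X)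
  beta : ∀ {Γ X : S} (θ : Γ ⊗ X ⟶ Sig), lift (fst Γ X ≫ lam θ) (snd Γ X) ≫ ev X = θ
  eta : ∀ {Γ X : S} (φ : Γ ⟶ pow X), lam (lift (fst Γ X ≫ φ) (snd Γ X) ≫ ev X) = φ

attribute [reducible, instance] SierpinskiCategory.lattice SierpinskiCategory.bounded

open SierpinskiCategory

section Calculus

variable {S : Type u} [Category.{v} S] [CartesianMonoidalCategory S] [SierpinskiCategory S]

/-- Application `φ a` of a term `φ : Σ^X` to a term `a : X`, in a context `Γ`. -/
def app {Γ X : S} (φ : Γ ⟶ pow X) (a : Γ ⟶ X) : Γ ⟶ (Sig : S) := lift φ a ≫ ev X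

/-- The relation `r`, applied to terms `a` and `b`, in a context `Γ`. -/
def rel {Γ N M : S} (r : N ⊗ M ⟶ (Sig : S)) (a : Γ ⟶ N) (b : Γ ⟶ M) : Γ ⟶ (Sig : S) :=
  lift a b ≫ r

/-- The map `Σ^f : Σ^Y ⟶ Σ^X`, namely `ψ ↦ λ x. ψ (f x)`. -/
def powMap {X Y : S} (f : X ⟶ Y) : pow Y ⟶ pow X :=
  lam (app (fst (pow Y) X) (snd (pow Y) X ≫ f))

/-- The map `X ⟶ Σ^(Σ^X)`, namely `x ↦ λ φ. φ x`. -/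
def point (X : S) : X ⟶ pow (pow X) := lam (app (snd X (pow X)) (fst X (pow X)))

/-- A term `P : Σ^(Σ^X)` in context `Γ` is prime if `F P = P (λ x. F (λ φ. φ x))` for `F : Σ³X`. -/
def IsPrime {Γ X : S} (P : Γ ⟶ pow (pow X)) : Prop :=
  ∀ (Δ : S) (f : Δ ⟶ Γ) (F : Δ ⟶ pow (pow (pow X))),
    app F (f ≫ P) = app (f ≫ P) (lam (app (fst Δ X ≫ F) (snd Δ X ≫ point X)))

/-- An endomorphism `E` of `Σ^X` is a nucleus if
`E (λ x. F (λ φ. φ x)) = E (λ x. F (λ φ. (E φ) x))` for `F : Σ³X`. -/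
def IsNucleus {X : S} (E : pow X ⟶ pow X) : Prop :=
  ∀ (Γ : S) (F : Γ ⟶ pow (pow (pow X))),
    lam (app (fst Γ X ≫ F) (snd Γ X ≫ point X)) ≫ E =
      lam (app (fst Γ X ≫ F) (snd Γ X ≫ point X ≫ powMap E)) ≫ E

/-- A term `a : Y` is admissible for `E` if `φ a = (E φ) a` for `φ : Σ^Y`. -/
def IsAdmissible {Y Γ : S} (E : pow Y ⟶ pow Y) (a : Γ ⟶ Y) : Prop :=
  a ≫ point Y = a ≫ point Y ≫ powMap E

/-- `i : X ⟶ Y` and `I : Σ^X ⟶ Σ^Y` exhibit `X` as the `Σ`-split subspace `{Y | E}`, whose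
elements are the admissible terms. -/
structure IsSubspace {X Y : S} (E : pow Y ⟶ pow Y) (i : X ⟶ Y) (I : pow X ⟶ pow Y) : Prop where
  split : I ≫ powMap i = 𝟙 (pow X)
  nucleus : powMap i ≫ I = E
  lift_admissible : ∀ {Γ : S} (a : Γ ⟶ Y), IsAdmissible E a → ∃! b : Γ ⟶ X, b ≫ i = a

/-- `σ` is the value of `∃ m : M. θ m`: it is below `τ` just when `θ m` is so for generic `m`. -/
def IsExists {Γ M : S} (θ : Γ ⊗ M ⟶ (Sig : S)) (σ : Γ ⟶ (Sig : S)) : Prop :=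
  ∀ τ : Γ ⟶ (Sig : S), σ ≤ τ ↔ θ ≤ fst Γ M ≫ τ

/-- `N` is overt: `Σ^! : Σ ⟶ Σ^N` has a left adjoint. -/
structure Overt (N : S) where
  ex : pow N ⟶ (Sig : S)
  adj : ∀ {Γ : S} (θ : Γ ⊗ N ⟶ (Sig : S)), IsExists θ (lam θ ≫ ex)

/-- The term `∃ n : N. θ n`. -/
def Overt.some {N : S} (o : Overt N) {Γ : S} (θ : Γ ⊗ N ⟶ (Sig : S)) : Γ ⟶ (Sig : S) :=
  lam θ ≫ o.ex

/-- `N` is discrete: its diagonal is open, classified by the equality predicate. -/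
structure Discrete (N : S) where
  eqv : N ⊗ N ⟶ (Sig : S)
  eqv_iff : ∀ {Γ : S} (a b : Γ ⟶ N), a = b ↔ rel eqv a b = ⊤

/-- A natural numbers object, with primitive recursion in all contexts and at all types. -/
structure NaturalNumbers (S : Type u) [Category.{v} S] [CartesianMonoidalCategory S] where
  Nat : S
  zero : 𝟙_ S ⟶ Nat
  succ : Nat ⟶ Nat
  recursion : ∀ {Γ X : S} (z : Γ ⟶ X) (s : (Γ ⊗ Nat) ⊗ X ⟶ X),
    ∃! r : Γ ⊗ Nat ⟶ X,
      lift (𝟙 Γ) (toUnit Γ ≫ zero) ≫ r = z ∧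
      lift (fst Γ Nat) (snd Γ Nat ≫ succ) ≫ r = lift (𝟙 (Γ ⊗ Nat)) r ≫ s

/-- An object of lists of elements of `N`, with list recursion in all contexts and at all types.
The step `s` takes `((γ, n, l), x)`, where `x` is the value at `(γ, l)`. -/
structure ListObject {S : Type u} [Category.{v} S] [CartesianMonoidalCategory S] (N : S) where
  List : S
  nil : 𝟙_ S ⟶ List
  cons : N ⊗ List ⟶ List
  recur : ∀ {Γ X : S}, (Γ ⟶ X) → ((Γ ⊗ (N ⊗ List)) ⊗ X ⟶ X) → (Γ ⊗ List ⟶ X)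
  recur_nil : ∀ {Γ X : S} (z : Γ ⟶ X) (s : (Γ ⊗ (N ⊗ List)) ⊗ X ⟶ X),
    lift (𝟙 Γ) (toUnit Γ ≫ nil) ≫ recur z s = z
  recur_cons : ∀ {Γ X : S} (z : Γ ⟶ X) (s : (Γ ⊗ (N ⊗ List)) ⊗ X ⟶ X),
    lift (fst Γ (N ⊗ List)) (snd Γ (N ⊗ List) ≫ cons) ≫ recur z s =
      lift (𝟙 (Γ ⊗ (N ⊗ List)))
        (lift (fst Γ (N ⊗ List)) (snd Γ (N ⊗ List) ≫ snd N List) ≫ recur z s) ≫ s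
  recur_unique : ∀ {Γ X : S} (z : Γ ⟶ X) (s : (Γ ⊗ (N ⊗ List)) ⊗ X ⟶ X) (r : Γ ⊗ List ⟶ X),
    lift (𝟙 Γ) (toUnit Γ ≫ nil) ≫ r = z →
    lift (fst Γ (N ⊗ List)) (snd Γ (N ⊗ List) ≫ cons) ≫ r =
      lift (𝟙 (Γ ⊗ (N ⊗ List)))
        (lift (fst Γ (N ⊗ List)) (snd Γ (N ⊗ List) ≫ snd N List) ≫ r) ≫ s →
    r = recur z s

/-- The term `m ∈ l`, in the context `m : N, l : List N`:
`m ∈ [] = ⊥` and `m ∈ (n :: l) = (m = n) ∨ m ∈ l`. -/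
def ListObject.mem {N : S} (L : ListObject N) (d : Discrete N) : N ⊗ L.List ⟶ (Sig : S) :=
  L.recur ⊥
    (rel d.eqv (fst _ _ ≫ fst _ _) (fst _ _ ≫ snd _ _ ≫ fst _ _) ⊔ snd _ _)

/-- The term `∀ n ∈ l. ξ n`, in the context `ξ : Σ^N, l : List N`:
it is `⊤` for `[]`, and `ξ n ∧ ∀ n' ∈ l. ξ n'` for `n :: l`. -/
def ListObject.all {N : S} (L : ListObject N) : pow N ⊗ L.List ⟶ (Sig : S) :=
  L.recur ⊤
    (app (fst _ _ ≫ fst _ _) (fst _ _ ≫ snd _ _ ≫ fst _ _) ⊓ snd _ _)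

end Calculus

/-- A model of the axioms of abstract Stone duality. The monadicity of the adjunction
`Σ^(-) ⊣ Σ^(-)` is expressed in its symbolic form, as sobriety (every prime is `λ φ. φ a` for a
unique `a`) together with the existence of the subspace `{Y | E}` for every nucleus `E`. -/
class Model (S : Type u) [Category.{v} S] [CartesianMonoidalCategory S] extends
    SierpinskiCategory S where
  /-- Every object is sober. -/
  sober : ∀ {Γ X : S} (P : Γ ⟶ pow (pow X)), IsPrime P → ∃! a : Γ ⟶ X, a ≫ point X = P
  /-- Nuclei have subspaces. -/
  subspace : ∀ {Y : S} (E : pow Y ⟶ pow Y), IsNucleus E →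
    ∃ (X : S) (i : X ⟶ Y) (I : pow X ⟶ pow Y), IsSubspace E i I
  /-- The Phoa principle `F σ = F ⊥ ∨ (σ ∧ F ⊤)`. -/
  phoa : ∀ {Γ : S} (F : Γ ⟶ pow Sig) (σ : Γ ⟶ Sig), app F σ = app F ⊥ ⊔ (σ ⊓ app F ⊤)
  /-- There is a natural numbers object, and it is overt. -/
  naturals : NaturalNumbers S
  naturals_overt : Overt naturals.Nat
  /-- The objects `Fin N` of lists over which the Scott principle quantifies. -/
  lists : ∀ {N : S}, Overt N → Discrete N → ListObject N
  /-- The Scott principle `Φ ξ = ∃ l. Φ (λ n. n ∈ l) ∧ ∀ n ∈ l. ξ n`. -/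
  scott : ∀ {N : S} (o : Overt N) (d : Discrete N) {Γ : S}
    (Φ : Γ ⟶ pow (pow N)) (ξ : Γ ⟶ pow N),
    IsExists (M := (lists o d).List)
      (app (fst _ _ ≫ Φ)
          (lam (rel ((lists o d).mem d) (snd _ _) (fst _ _ ≫ snd Γ (lists o d).List))) ⊓
        rel (lists o d).all (fst _ _ ≫ ξ) (snd _ _))
      (app Φ ξ)

section Objects

variable {S : Type u} [Category.{v} S] [CartesianMonoidalCategory S] [SierpinskiCategory S]

/-- The objects that are definable from overt discrete objects by means of the type-forming
operations: products, exponentials of `Σ`, and subspaces given by nuclei. -/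
inductive Definable : S → Prop
  | overtDiscrete {N : S} (o : Overt N) (d : Discrete N) : Definable N
  | prod {X Y : S} : Definable X → Definable Y → Definable (X ⊗ Y)
  | pow {X : S} : Definable X → Definable (SierpinskiCategory.pow X)
  | subspace {X Y : S} (E : SierpinskiCategory.pow Y ⟶ SierpinskiCategory.pow Y) (i : X ⟶ Y)
      (I : SierpinskiCategory.pow X ⟶ SierpinskiCategory.pow Y) :
      Definable Y → IsNucleus E → IsSubspace E i I → Definable X

/-- The rules for the imposed order, for a relation `R` on `N` with parameters in `Γ`.
A condition with a double line in a system of rules is stated as an equation. -/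
structure OrderRules {N : S} (zero one : 𝟙_ S ⟶ N) (add mul : N ⊗ N ⟶ N) {Γ : S}
    (R : Γ ⊗ (N ⊗ N) ⟶ (Sig : S)) : Prop where
  zero_le : ∀ {Δ : S} (f : Δ ⟶ Γ) (n : Δ ⟶ N), rel R f (lift (toUnit Δ ≫ zero) n) = ⊤
  refl : ∀ {Δ : S} (f : Δ ⟶ Γ) (n : Δ ⟶ N), rel R f (lift n n) = ⊤
  le_one : ∀ {Δ : S} (f : Δ ⟶ Γ) (n : Δ ⟶ N), rel R f (lift n (toUnit Δ ≫ one)) = ⊤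
  distrib : ∀ {Δ : S} (f : Δ ⟶ Γ) (k n m : Δ ⟶ N),
    rel R f (lift (lift k (lift n m ≫ add) ≫ mul)
      (lift (lift k n ≫ mul) (lift k m ≫ mul) ≫ add)) = ⊤
  trans : ∀ {Δ : S} (f : Δ ⟶ Γ) (n k m : Δ ⟶ N),
    rel R f (lift n k) ⊓ rel R f (lift k m) ≤ rel R f (lift n m)
  le_mul : ∀ {Δ : S} (f : Δ ⟶ Γ) (k m n : Δ ⟶ N),
    rel R f (lift k m) ⊓ rel R f (lift k n) = rel R f (lift k (lift m n ≫ mul))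
  add_le : ∀ {Δ : S} (f : Δ ⟶ Γ) (n m k : Δ ⟶ N),
    rel R f (lift n k) ⊓ rel R f (lift m k) = rel R f (lift (lift n m ≫ add) k)

/-- The relation `le` is the imposed order defined from `(0, 1, +, ⋆)`: the least open relation
on `N` that satisfies the rules. -/
structure IsImposedOrder {N : S} (zero one : 𝟙_ S ⟶ N) (add mul : N ⊗ N ⟶ N)
    (le : N ⊗ N ⟶ (Sig : S)) : Prop where
  rules : OrderRules zero one add mul (snd (𝟙_ S) (N ⊗ N) ≫ le)
  least : ∀ {Γ : S} (R : Γ ⊗ (N ⊗ N) ⟶ (Sig : S)), OrderRules zero one add mul R →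
    snd Γ (N ⊗ N) ≫ le ≤ R

/-- The carrier and operations `(N, 0, 1, +, ⋆, ≪)` of an abstract basis, without the rules for
`≪`. The imposed order `le` is determined by `(0, 1, +, ⋆)`. -/
structure BasisData (S : Type u) [Category.{v} S] [CartesianMonoidalCategory S]
    [SierpinskiCategory S] where
  N : S
  overt : Overt N
  discrete : Discrete N
  zero : 𝟙_ S ⟶ N
  one : 𝟙_ S ⟶ N
  add : N ⊗ N ⟶ N
  mul : N ⊗ N ⟶ N
  waybelow : N ⊗ N ⟶ (Sig : S)
  le : N ⊗ N ⟶ (Sig : S)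
  isImposedOrder : IsImposedOrder zero one add mul le

namespace BasisData

variable (B : BasisData S) {Γ : S}

/-- The term `0`. -/
def O (Γ : S) : Γ ⟶ B.N := toUnit Γ ≫ B.zero
/-- The term `1`. -/
def I (Γ : S) : Γ ⟶ B.N := toUnit Γ ≫ B.one

variable {B}

/-- The term `a + b`. -/
def oplus (a b : Γ ⟶ B.N) : Γ ⟶ B.N := lift a b ≫ B.add
/-- The term `a ⋆ b`. -/
def ostar (a b : Γ ⟶ B.N) : Γ ⟶ B.N := lift a b ≫ B.mul
/-- The proposition `a ≪ b`. -/
abbrev wb (a b : Γ ⟶ B.N) : Γ ⟶ (Sig : S) := rel B.waybelow a b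
/-- The proposition `a ≼ b`, for the imposed order. -/
abbrev leq (a b : Γ ⟶ B.N) : Γ ⟶ (Sig : S) := rel B.le a b

end BasisData

open BasisData

/-- An abstract (lattice) basis. In a term with bound variables, `fst` weakens by the innermost
bound variable and `snd` is that variable. -/
structure AbstractBasis (S : Type u) [Category.{v} S] [CartesianMonoidalCategory S]
    [SierpinskiCategory S] extends BasisData S where
  /-- `0 ≪ 0` -/
  zero_wb : ∀ {Γ : S}, wb (toBasisData.O Γ) (toBasisData.O Γ) = ⊤
  /-- `n ≪ p` and `m ≪ p` iff `n + m ≪ p` -/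
  plus_wb : ∀ {Γ : S} (n m p : Γ ⟶ toBasisData.N), wb n p ⊓ wb m p = wb (oplus n m) p
  /-- if `m' ≼ m ≪ n ≼ n'` then `m' ≪ n'` -/
  mono : ∀ {Γ : S} (m' m n n' : Γ ⟶ toBasisData.N), leq m' m ⊓ wb m n ⊓ leq n n' ≤ wb m' n'
  /-- `n ≪ m` iff `∃ k. n ≪ k ≪ m` -/
  interpolate : ∀ {Γ : S} (n m : Γ ⟶ toBasisData.N),
    wb n m = overt.some (wb (fst _ _ ≫ n) (snd _ _) ⊓ wb (snd _ _) (fst _ _ ≫ m))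
  /-- if `n ≪ m`, `m ≪ p` and `m ≪ q` then `n ≪ p ⋆ q` -/
  wb_star : ∀ {Γ : S} (n m p q : Γ ⟶ toBasisData.N),
    wb n m ⊓ wb m p ⊓ wb m q ≤ wb n (ostar p q)
  /-- `n ≪ p + q` iff `∃ p' q'. n ≪ p' + q'`, `p' ≪ p` and `q' ≪ q` -/
  wb_plus : ∀ {Γ : S} (n p q : Γ ⟶ toBasisData.N),
    wb n (oplus p q) = overt.some (overt.some
      (wb (fst _ _ ≫ fst _ _ ≫ n) (oplus (fst _ _ ≫ snd _ _) (snd _ _)) ⊓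
        wb (fst _ _ ≫ snd _ _) (fst _ _ ≫ fst _ _ ≫ p) ⊓
        wb (snd _ _) (fst _ _ ≫ fst _ _ ≫ q)))

/-- Relational composition: `(relComp o H K) n k = ∃ m. H n m ∧ K m k`. -/
def relComp {N M K : S} (o : Overt M) (R : N ⊗ M ⟶ (Sig : S)) (T : M ⊗ K ⟶ (Sig : S)) :
    N ⊗ K ⟶ (Sig : S) :=
  o.some (rel R (fst _ _ ≫ fst N K) (snd _ _) ⊓ rel T (snd _ _) (fst _ _ ≫ snd N K))

/-- The conditions on the matrix `ρ` of a second class morphism. -/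
structure IsSecondClassMatrix (B C : AbstractBasis S) (ρ : B.N ⊗ C.N ⟶ (Sig : S)) : Prop where
  zero : ∀ {Γ : S} (k : Γ ⟶ C.N), rel ρ (B.O Γ) k = ⊤
  plus : ∀ {Γ : S} (n m : Γ ⟶ B.N) (k : Γ ⟶ C.N),
    rel ρ n k ⊓ rel ρ m k = rel ρ (oplus n m) k
  round_left : ∀ {Γ : S} (n : Γ ⟶ B.N) (m : Γ ⟶ C.N),
    rel ρ n m = B.overt.some (wb (fst _ _ ≫ n) (snd _ _) ⊓ rel ρ (snd _ _) (fst _ _ ≫ m))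
  round_right : ∀ {Γ : S} (n : Γ ⟶ B.N) (m : Γ ⟶ C.N),
    rel ρ n m = C.overt.some (rel ρ (fst _ _ ≫ n) (snd _ _) ⊓ wb (snd _ _) (fst _ _ ≫ m))

/-- `H` is an abstract matrix from `B` to `C`; here `rel H n m` is the entry with subscript `n`
(in `B`) and superscript `m` (in `C`). -/
structure IsAbstractMatrix (B C : AbstractBasis S) (H : B.N ⊗ C.N ⟶ (Sig : S)) : Prop where
  zero : ∀ {Γ : S} (m : Γ ⟶ C.N), rel H (B.O Γ) m = ⊤
  plus : ∀ {Γ : S} (n p : Γ ⟶ B.N) (m : Γ ⟶ C.N),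
    rel H n m ⊓ rel H p m = rel H (oplus n p) m
  mono : ∀ {Γ : S} (n' n : Γ ⟶ B.N) (m m' : Γ ⟶ C.N),
    leq n' n ⊓ rel H n m ⊓ leq m m' ≤ rel H n' m'
  /-- `H n' m'` iff `∃ n m. n' ≪ n ∧ H n m ∧ m ≪ m'` -/
  round : ∀ {Γ : S} (n' : Γ ⟶ B.N) (m' : Γ ⟶ C.N),
    rel H n' m' = B.overt.some (C.overt.some
      (wb (fst _ _ ≫ fst _ _ ≫ n') (fst _ _ ≫ snd _ _) ⊓
        rel H (fst _ _ ≫ snd _ _) (snd _ _) ⊓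
        wb (snd _ _) (fst _ _ ≫ fst _ _ ≫ m')))
  bot : ∀ {Γ : S} (n : Γ ⟶ B.N), wb n (B.O Γ) = rel H n (C.O Γ)
  top : ∀ {Γ : S} (n : Γ ⟶ B.N), wb n (B.I Γ) = rel H n (C.I Γ)
  /-- `H n (s ⋆ t)` iff `∃ m p. H m s ∧ H p t ∧ n ≪ m ⋆ p` -/
  meet : ∀ {Γ : S} (n : Γ ⟶ B.N) (s t : Γ ⟶ C.N),
    rel H n (ostar s t) = B.overt.some (B.overt.some
      (rel H (fst _ _ ≫ snd _ _) (fst _ _ ≫ fst _ _ ≫ s) ⊓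
        rel H (snd _ _) (fst _ _ ≫ fst _ _ ≫ t) ⊓
        wb (fst _ _ ≫ fst _ _ ≫ n) (ostar (fst _ _ ≫ snd _ _) (snd _ _))))
  /-- `H n (s + t)` iff `∃ m p. H m s ∧ H p t ∧ n ≪ m + p` -/
  join : ∀ {Γ : S} (n : Γ ⟶ B.N) (s t : Γ ⟶ C.N),
    rel H n (oplus s t) = B.overt.some (B.overt.some
      (rel H (fst _ _ ≫ snd _ _) (fst _ _ ≫ fst _ _ ≫ s) ⊓
        rel H (snd _ _) (fst _ _ ≫ fst _ _ ≫ t) ⊓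
        wb (fst _ _ ≫ fst _ _ ≫ n) (oplus (fst _ _ ≫ snd _ _) (snd _ _))))

end Objects

section Composition

set_option linter.unusedSimpArgs false

variable {S : Type u} [Category.{v} S] [CartesianMonoidalCategory S]

section

variable [SierpinskiCategory S] {Γ Δ N M K : S}

theorem comp_mono (f : Δ ⟶ Γ) {σ τ : Γ ⟶ (Sig : S)} (h : σ ≤ τ) : f ≫ σ ≤ f ≫ τ := by
  rw [← inf_eq_left] at h ⊢
  rw [← comp_inf, h]

@[simp]
theorem comp_rel (f : Δ ⟶ Γ) (r : N ⊗ M ⟶ (Sig : S)) (a : Γ ⟶ N) (b : Γ ⟶ M) :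
    f ≫ rel r a b = rel r (f ≫ a) (f ≫ b) := by
  simp [rel, ← Category.assoc]

theorem comp_lam (f : Δ ⟶ Γ) (θ : Γ ⊗ N ⟶ (Sig : S)) :
    f ≫ lam θ = lam (lift (fst Δ N ≫ f) (snd Δ N) ≫ θ) := by
  rw [← eta (f ≫ lam θ)]
  congr 1
  conv_rhs => rw [← beta θ]
  simp [← Category.assoc]

theorem comp_some (o : Overt N) (f : Δ ⟶ Γ) (θ : Γ ⊗ N ⟶ (Sig : S)) :
    f ≫ o.some θ = o.some (lift (fst Δ N ≫ f) (snd Δ N) ≫ θ) := by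
  rw [Overt.some, ← Category.assoc, comp_lam]; rfl

theorem some_le (o : Overt N) {θ : Γ ⊗ N ⟶ (Sig : S)} {τ : Γ ⟶ (Sig : S)} :
    o.some θ ≤ τ ↔ θ ≤ fst Γ N ≫ τ := o.adj θ τ

theorem some_intro (o : Overt N) {θ : Γ ⊗ N ⟶ (Sig : S)} {σ : Γ ⟶ (Sig : S)} (a : Γ ⟶ N)
    (h : σ ≤ lift (𝟙 Γ) a ≫ θ) : σ ≤ o.some θ := by
  refine h.trans ?_
  have := comp_mono (lift (𝟙 Γ) a) ((some_le o).1 (le_refl (o.some θ)))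
  simpa using this

theorem app_lam (θ : Γ ⊗ N ⟶ (Sig : S)) (a : Γ ⟶ N) : app (lam θ) a = lift (𝟙 Γ) a ≫ θ := by
  conv_rhs => rw [← beta θ]
  simp [app, ← Category.assoc]

end

variable [Model S] {Γ N M K : S}

theorem some_elim (o : Overt N) {θ : Γ ⊗ N ⟶ (Sig : S)} {σ τ : Γ ⟶ (Sig : S)}
    (h : σ ≤ o.some θ)
    (k : ∀ σ' : Γ ⊗ N ⟶ (Sig : S), σ' ≤ fst Γ N ≫ σ → σ' ≤ θ → σ' ≤ fst Γ N ≫ τ) : σ ≤ τ := by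
  let θ' : (Γ ⊗ Sig) ⊗ N ⟶ (Sig : S) :=
    (fst _ _ ≫ snd _ _) ⊓ (lift (fst _ _ ≫ fst _ _) (snd _ _) ≫ θ)
  have key : ∀ α : Γ ⟶ (Sig : S), app (lam (o.some θ')) α = o.some ((fst _ _ ≫ α) ⊓ θ) := by
    intro α
    rw [app_lam, comp_some]
    congr 1
    simp only [θ', comp_inf, ← Category.assoc]
    simp
  have phoa := Model.phoa (lam (o.some θ')) σ
  rw [key, key, key, comp_bot, comp_top, bot_inf_eq, top_inf_eq] at phoa
  have hb : o.some (⊥ : Γ ⊗ N ⟶ (Sig : S)) = ⊥ := by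
    rw [eq_bot_iff, some_le]; exact bot_le
  rw [hb, bot_sup_eq, inf_eq_left.2 h] at phoa
  rw [← phoa, some_le]
  exact k _ inf_le_left inf_le_right

theorem weaken_rel' {Δ : S} {f : Δ ⟶ Γ} {σ : Γ ⟶ (Sig : S)} {σ' : Δ ⟶ (Sig : S)}
    (w : σ' ≤ f ≫ σ) {r : N ⊗ M ⟶ (Sig : S)} {a : Γ ⟶ N} {b : Γ ⟶ M} (h : σ ≤ rel r a b) :
    σ' ≤ rel r (f ≫ a) (f ≫ b) := by
  have := w.trans (comp_mono _ h)
  simpa using this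

theorem weaken_rel {σ : Γ ⟶ (Sig : S)} {σ' : Γ ⊗ K ⟶ (Sig : S)} (w : σ' ≤ fst Γ K ≫ σ)
    {r : N ⊗ M ⟶ (Sig : S)} {a : Γ ⟶ N} {b : Γ ⟶ M} (h : σ ≤ rel r a b) :
    σ' ≤ rel r (fst Γ K ≫ a) (fst Γ K ≫ b) := by
  have := w.trans (comp_mono _ h)
  simpa using this

theorem rel_relComp (o : Overt M) (R : N ⊗ M ⟶ (Sig : S)) (T : M ⊗ K ⟶ (Sig : S))
    (a : Γ ⟶ N) (c : Γ ⟶ K) :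
    rel (relComp o R T) a c =
      o.some (rel R (fst _ _ ≫ a) (snd _ _) ⊓ rel T (snd _ _) (fst _ _ ≫ c)) := by
  rw [rel, relComp, comp_some]
  congr 1
  simp [comp_inf]

theorem relComp_intro (o : Overt M) {R : N ⊗ M ⟶ (Sig : S)} {T : M ⊗ K ⟶ (Sig : S)}
    {a : Γ ⟶ N} {c : Γ ⟶ K} {σ : Γ ⟶ (Sig : S)} (b : Γ ⟶ M)
    (h : σ ≤ rel R a b) (h' : σ ≤ rel T b c) : σ ≤ rel (relComp o R T) a c := by
  rw [rel_relComp]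
  refine some_intro o b ?_
  simpa [comp_inf] using ⟨h, h'⟩

theorem relComp_elim (o : Overt M) {R : N ⊗ M ⟶ (Sig : S)} {T : M ⊗ K ⟶ (Sig : S)}
    {a : Γ ⟶ N} {c : Γ ⟶ K} {σ τ : Γ ⟶ (Sig : S)} (h : σ ≤ rel (relComp o R T) a c)
    (k : ∀ σ' : Γ ⊗ M ⟶ (Sig : S), σ' ≤ fst Γ M ≫ σ → σ' ≤ rel R (fst Γ M ≫ a) (snd Γ M) →
      σ' ≤ rel T (snd Γ M) (fst Γ M ≫ c) → σ' ≤ fst Γ M ≫ τ) : σ ≤ τ := by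
  rw [rel_relComp] at h
  exact some_elim o h fun σ' w w' => k σ' w (w'.trans inf_le_left) (w'.trans inf_le_right)

theorem rel_ext {R T : N ⊗ M ⟶ (Sig : S)}
    (h : ∀ {Γ : S} (σ : Γ ⟶ (Sig : S)) (a : Γ ⟶ N) (b : Γ ⟶ M), σ ≤ rel R a b ↔ σ ≤ rel T a b) :
    R = T := by
  have h1 := h R (fst N M) (snd N M)
  have h2 := h T (fst N M) (snd N M)
  simp only [rel, lift_fst_snd, Category.id_comp] at h1 h2
  exact le_antisymm (h1.1 le_rfl) (h2.2 le_rfl)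

theorem eq_of_forces {x y : Γ ⟶ (Sig : S)} (h : ∀ σ : Γ ⟶ (Sig : S), σ ≤ x ↔ σ ≤ y) : x = y :=
  le_antisymm ((h x).1 le_rfl) ((h y).2 le_rfl)

theorem relComp_assoc {P : S} (o : Overt M) (o' : Overt K) (R : N ⊗ M ⟶ (Sig : S))
    (T : M ⊗ K ⟶ (Sig : S)) (U : K ⊗ P ⟶ (Sig : S)) :
    relComp o' (relComp o R T) U = relComp o R (relComp o' T U) := by
  refine rel_ext fun {Γ} σ a b => ⟨fun h => ?_, fun h => ?_⟩
  · refine relComp_elim o' h fun σ' _ h1 h2 => ?_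
    refine relComp_elim o h1 fun σ'' w h3 h4 => ?_
    simp only [comp_rel]
    exact relComp_intro o _ h3 (relComp_intro o' _ h4 (weaken_rel w h2))
  · refine relComp_elim o h fun σ' _ h1 h2 => ?_
    refine relComp_elim o' h2 fun σ'' w h3 h4 => ?_
    simp only [comp_rel]
    exact relComp_intro o' _ (relComp_intro o _ (weaken_rel w h1) h3) h4

section

open BasisData

variable {B C D : AbstractBasis S}

@[simp]
theorem comp_plus {Δ : S} (f : Δ ⟶ Γ) (a b : Γ ⟶ B.N) :
    f ≫ oplus a b = oplus (f ≫ a) (f ≫ b) := by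
  simp [oplus, ← Category.assoc]

@[simp]
theorem comp_star {Δ : S} (f : Δ ⟶ Γ) (a b : Γ ⟶ B.N) :
    f ≫ ostar a b = ostar (f ≫ a) (f ≫ b) := by
  simp [ostar, ← Category.assoc]

@[simp]
theorem comp_O {Δ : S} (f : Δ ⟶ Γ) : f ≫ B.O Γ = B.O Δ := by
  simp [O, ← Category.assoc]

@[simp]
theorem comp_I {Δ : S} (f : Δ ⟶ Γ) : f ≫ B.I Γ = B.I Δ := by
  simp [I, ← Category.assoc]

theorem rel_le (a b : Γ ⟶ B.N) :
    rel (snd (𝟙_ S) (B.N ⊗ B.N) ≫ B.le) (toUnit Γ) (lift a b) = leq a b := by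
  simp [rel, leq, ← Category.assoc]

theorem zero_leq (a : Γ ⟶ B.N) : leq (B.O Γ) a = ⊤ := by
  rw [← rel_le]; exact B.isImposedOrder.rules.zero_le _ a

theorem leq_refl (a : Γ ⟶ B.N) : leq a a = ⊤ := by
  rw [← rel_le]; exact B.isImposedOrder.rules.refl _ a

theorem star_leq (a b : Γ ⟶ B.N) : leq (ostar a b) a = ⊤ ∧ leq (ostar a b) b = ⊤ := by
  have h := B.isImposedOrder.rules.le_mul (toUnit Γ) (ostar a b) a b
  have e : rel (snd (𝟙_ S) (B.N ⊗ B.N) ≫ B.le) (toUnit Γ) (lift (ostar a b) (lift a b ≫ B.mul)) =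
    ⊤ := B.isImposedOrder.rules.refl _ (ostar a b)
  rw [e, rel_le, rel_le] at h
  exact inf_eq_top_iff.1 h

theorem leq_plus (a b : Γ ⟶ B.N) : leq a (oplus a b) = ⊤ ∧ leq b (oplus a b) = ⊤ := by
  have h := B.isImposedOrder.rules.add_le (toUnit Γ) a b (oplus a b)
  have e : rel (snd (𝟙_ S) (B.N ⊗ B.N) ≫ B.le) (toUnit Γ) (lift (lift a b ≫ B.add) (oplus a b)) =
    ⊤ := B.isImposedOrder.rules.refl _ (oplus a b)
  rw [e, rel_le, rel_le] at h
  exact inf_eq_top_iff.1 h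

theorem wb_mono_right {σ : Γ ⟶ (Sig : S)} {a b c : Γ ⟶ B.N} (h : σ ≤ wb a b)
    (h' : leq b c = ⊤) : σ ≤ wb a c := by
  have := B.mono a a b c
  rw [h', leq_refl, top_inf_eq, inf_top_eq] at this
  exact h.trans this

theorem wb_mono_left {σ : Γ ⟶ (Sig : S)} {a b c : Γ ⟶ B.N} (h : σ ≤ wb b c)
    (h' : leq a b = ⊤) : σ ≤ wb a c := by
  have := B.mono a b c c
  rw [h', leq_refl, top_inf_eq, inf_top_eq] at this
  exact h.trans this

theorem relComp_wb : relComp B.overt B.waybelow B.waybelow = B.waybelow := by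
  refine rel_ext fun σ a b => ?_
  rw [rel_relComp]
  exact Eq.to_iff (congrArg (σ ≤ ·) (B.interpolate a b).symm)

theorem wb_interpolate {σ τ : Γ ⟶ (Sig : S)} {a c : Γ ⟶ B.N} (h : σ ≤ wb a c)
    (k : ∀ σ' : Γ ⊗ B.N ⟶ (Sig : S), σ' ≤ fst Γ B.N ≫ σ → σ' ≤ wb (fst Γ B.N ≫ a) (snd Γ B.N) →
      σ' ≤ wb (snd Γ B.N) (fst Γ B.N ≫ c) → σ' ≤ fst Γ B.N ≫ τ) : σ ≤ τ := by
  rw [wb, ← relComp_wb] at h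
  exact relComp_elim _ h k

theorem wb_trans {σ : Γ ⟶ (Sig : S)} {a b c : Γ ⟶ B.N} (h : σ ≤ wb a b) (h' : σ ≤ wb b c) :
    σ ≤ wb a c := by
  rw [wb, ← relComp_wb]
  exact relComp_intro _ b h h'

theorem zero_wb' (a : Γ ⟶ B.N) : wb (B.O Γ) a = ⊤ :=
  top_le_iff.1 (wb_mono_right B.zero_wb.ge (zero_leq a))

/-- The identity second class matrix is `≪`. -/
theorem isSecondClassMatrix_id (B : AbstractBasis S) : IsSecondClassMatrix B B B.waybelow where
  zero k := zero_wb' k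
  plus n m k := B.plus_wb n m k
  round_left n m := B.interpolate n m
  round_right n m := B.interpolate n m

theorem IsSecondClassMatrix.comp_left {H : B.N ⊗ C.N ⟶ (Sig : S)}
    (h : IsSecondClassMatrix B C H) : relComp B.overt B.waybelow H = H := by
  refine rel_ext fun σ a b => ?_
  rw [rel_relComp]
  exact Eq.to_iff (congrArg (σ ≤ ·) (h.round_left a b).symm)

theorem IsSecondClassMatrix.comp_right {H : B.N ⊗ C.N ⟶ (Sig : S)}
    (h : IsSecondClassMatrix B C H) : relComp C.overt H C.waybelow = H := by
  refine rel_ext fun σ a b => ?_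
  rw [rel_relComp]
  exact Eq.to_iff (congrArg (σ ≤ ·) (h.round_right a b).symm)

theorem IsSecondClassMatrix.mono_right {H : B.N ⊗ C.N ⟶ (Sig : S)}
    (h : IsSecondClassMatrix B C H) {σ : Γ ⟶ (Sig : S)} {a : Γ ⟶ B.N} {b c : Γ ⟶ C.N}
    (w : σ ≤ rel H a b) (hl : leq b c = ⊤) : σ ≤ rel H a c := by
  rw [← h.comp_right] at w
  refine relComp_elim _ w fun σ' _ h1 h2 => ?_
  rw [← h.comp_right, comp_rel]
  have hl' : rel C.le b c = ⊤ := hl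
  refine relComp_intro _ _ h1 (wb_mono_right h2 ?_)
  rw [leq, ← comp_rel, hl', comp_top]

/-- The composite of two second class matrices is one. -/
theorem IsSecondClassMatrix.comp {H : B.N ⊗ C.N ⟶ (Sig : S)} {K : C.N ⊗ D.N ⟶ (Sig : S)}
    (h : IsSecondClassMatrix B C H) (k : IsSecondClassMatrix C D K) :
    IsSecondClassMatrix B D (relComp C.overt H K) where
  zero c := top_le_iff.1 (relComp_intro _ (C.O _) (h.zero _).ge (k.zero _).ge)
  plus n m c := by
    refine eq_of_forces fun σ => ⟨fun w => ?_, fun w => ?_⟩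
    · obtain ⟨w1, w2⟩ := le_inf_iff.1 w
      refine relComp_elim _ w1 fun σ1 e1 a1 b1 => ?_
      have w3 := weaken_rel e1 w2
      refine relComp_elim _ w3 fun σ2 e2 a2 b2 => ?_
      have a1' := weaken_rel e2 a1
      have b1' := weaken_rel e2 b1
      simp only [comp_rel, comp_plus]
      refine relComp_intro _ (oplus (fst _ _ ≫ snd _ _) (snd _ _)) ?_ ?_
      · rw [← h.plus]
        exact le_inf (h.mono_right a1' (leq_plus _ _).1) (h.mono_right a2 (leq_plus _ _).2)
      · rw [← k.plus]
        exact le_inf b1' b2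
    · refine relComp_elim _ w fun σ1 e1 a1 b1 => ?_
      rw [comp_plus, ← h.plus] at a1
      obtain ⟨a2, a3⟩ := le_inf_iff.1 a1
      rw [comp_inf, comp_rel, comp_rel]
      exact le_inf (relComp_intro _ _ a2 b1) (relComp_intro _ _ a3 b1)
  round_left n m := by
    rw [← rel_relComp, ← relComp_assoc, h.comp_left]
  round_right n m := by
    rw [← rel_relComp, relComp_assoc, k.comp_right]

theorem IsAbstractMatrix.round_elim {H : B.N ⊗ C.N ⟶ (Sig : S)} (h : IsAbstractMatrix B C H)
    {σ τ : Γ ⟶ (Sig : S)} {a : Γ ⟶ B.N} {b : Γ ⟶ C.N} (w : σ ≤ rel H a b)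
    (k : ∀ {Δ : S} (f : Δ ⟶ Γ) (σ' : Δ ⟶ (Sig : S)) (a' : Δ ⟶ B.N) (b' : Δ ⟶ C.N),
      σ' ≤ f ≫ σ → σ' ≤ wb (f ≫ a) a' → σ' ≤ rel H a' b' → σ' ≤ wb b' (f ≫ b) → σ' ≤ f ≫ τ) : σ ≤ τ := by
  rw [h.round] at w
  refine some_elim _ w fun σ1 e1 w1 => some_elim _ w1 fun σ2 e2 w2 => ?_
  obtain ⟨w3, w4⟩ := le_inf_iff.1 w2
  obtain ⟨w5, w6⟩ := le_inf_iff.1 w3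
  have := k (fst (Γ ⊗ B.N) C.N ≫ fst Γ B.N) σ2 _ _
    (by simpa using e2.trans (comp_mono _ e1)) (by simpa using w5) w6 (by simpa using w4)
  simpa using this

theorem IsAbstractMatrix.round_intro {H : B.N ⊗ C.N ⟶ (Sig : S)} (h : IsAbstractMatrix B C H)
    {σ : Γ ⟶ (Sig : S)} {a a' : Γ ⟶ B.N} {b b' : Γ ⟶ C.N} (h1 : σ ≤ wb a a')
    (h2 : σ ≤ rel H a' b') (h3 : σ ≤ wb b' b) : σ ≤ rel H a b := by
  rw [h.round]
  refine some_intro _ a' ?_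
  rw [comp_some]
  refine some_intro _ b' ?_
  simp only [comp_inf, comp_rel, wb]
  simp only [← Category.assoc]
  simpa using ⟨⟨h1, h2⟩, h3⟩

/-- Every abstract matrix satisfies the conditions for second class morphisms. -/
theorem IsAbstractMatrix.isSecondClassMatrix {H : B.N ⊗ C.N ⟶ (Sig : S)}
    (h : IsAbstractMatrix B C H) : IsSecondClassMatrix B C H where
  zero := h.zero
  plus := h.plus
  round_left n m := by
    rw [← rel_relComp]
    refine eq_of_forces fun σ => ⟨fun w => ?_, fun w => ?_⟩
    · refine h.round_elim w fun f σ1 a b _ h1 h2 h3 => ?_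
      refine wb_interpolate h1 fun σ2 e2 h4 h5 => ?_
      simp only [comp_rel]
      exact relComp_intro _ _ h4
        (h.round_intro h5 (weaken_rel e2 h2) (weaken_rel e2 h3))
    · refine relComp_elim _ w fun σ1 e1 h1 h2 => ?_
      refine h.round_elim h2 fun f σ2 a b e2 h3 h4 h5 => ?_
      have h6 := weaken_rel' e2 h1
      simp only [comp_rel]
      exact h.round_intro (wb_trans h6 h3) h4 h5
  round_right n m := by
    rw [← rel_relComp]
    refine eq_of_forces fun σ => ⟨fun w => ?_, fun w => ?_⟩
    · refine h.round_elim w fun f σ1 a b _ h1 h2 h3 => ?_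
      refine wb_interpolate h3 fun σ2 e2 h4 h5 => ?_
      simp only [comp_rel]
      exact relComp_intro _ _
        (h.round_intro (weaken_rel e2 h1) (weaken_rel e2 h2) h4) h5
    · refine relComp_elim _ w fun σ1 e1 h1 h2 => ?_
      refine h.round_elim h1 fun f σ2 a b e2 h3 h4 h5 => ?_
      have h6 := weaken_rel' e2 h2
      simp only [comp_rel]
      exact h.round_intro h3 h4 (wb_trans h5 h6)

theorem some_some_intro (o : Overt N) (o' : Overt M) {θ : (Γ ⊗ N) ⊗ M ⟶ (Sig : S)}
    {σ : Γ ⟶ (Sig : S)} (a : Γ ⟶ N) (b : Γ ⟶ M) (h : σ ≤ lift (lift (𝟙 Γ) a) b ≫ θ) :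
    σ ≤ o.some (o'.some θ) := by
  refine some_intro _ a ?_
  rw [comp_some]
  refine some_intro _ b ?_
  simpa [← Category.assoc] using h

theorem some_some_elim (o : Overt N) (o' : Overt M) {θ : (Γ ⊗ N) ⊗ M ⟶ (Sig : S)}
    {σ τ : Γ ⟶ (Sig : S)} (h : σ ≤ o.some (o'.some θ))
    (k : ∀ {Δ : S} (f : Δ ⟶ Γ) (σ' : Δ ⟶ (Sig : S)) (a : Δ ⟶ N) (b : Δ ⟶ M),
      σ' ≤ f ≫ σ → σ' ≤ lift (lift f a) b ≫ θ → σ' ≤ f ≫ τ) : σ ≤ τ := by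
  refine some_elim _ h fun σ1 e1 w1 => some_elim _ w1 fun σ2 e2 w2 => ?_
  have e : lift (lift (fst (Γ ⊗ N) M ≫ fst Γ N) (fst (Γ ⊗ N) M ≫ snd Γ N)) (snd (Γ ⊗ N) M) =
      𝟙 ((Γ ⊗ N) ⊗ M) := by
    ext <;> simp
  have := k (fst (Γ ⊗ N) M ≫ fst Γ N) σ2 (fst _ _ ≫ snd _ _) (snd _ _)
    (by simpa using e2.trans (comp_mono _ e1)) (by rw [e]; simpa using w2)
  simpa using this

theorem IsSecondClassMatrix.right_intro {H : B.N ⊗ C.N ⟶ (Sig : S)}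
    (h : IsSecondClassMatrix B C H) {σ : Γ ⟶ (Sig : S)} {a : Γ ⟶ B.N} {b c : Γ ⟶ C.N}
    (w : σ ≤ rel H a b) (w' : σ ≤ wb b c) : σ ≤ rel H a c := by
  rw [← h.comp_right]
  exact relComp_intro _ _ w w'

/-- The identity abstract matrix is `≪`. -/
theorem isAbstractMatrix_id (B : AbstractBasis S) : IsAbstractMatrix B B B.waybelow where
  zero k := zero_wb' k
  plus n m k := B.plus_wb n m k
  mono a b c d := B.mono a b c d
  round n m := by
    refine eq_of_forces fun σ => ⟨fun w => ?_, fun w => ?_⟩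
    · refine wb_interpolate w fun σ1 e1 h1 h2 => ?_
      refine wb_interpolate h2 fun σ2 e2 h3 h4 => ?_
      have h5 := weaken_rel e2 h1
      rw [← Category.assoc, comp_some, comp_some]
      refine some_some_intro _ _ (fst _ _ ≫ snd _ _) (snd _ _) ?_
      simp only [comp_inf, comp_rel, wb, lift_fst_assoc, lift_snd,
        Category.assoc, Category.id_comp] at *
      exact le_inf (le_inf h5 h3) h4
    · refine some_some_elim _ _ w fun f σ1 a b _ h => ?_
      simp only [comp_inf, comp_rel, wb, lift_fst_assoc, lift_snd,
        Category.assoc, Category.id_comp, le_inf_iff] at *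
      exact wb_trans h.1.1 (wb_trans h.1.2 h.2)
  bot _ := rfl
  top _ := rfl
  meet n s t := by
    refine eq_of_forces fun σ => ⟨fun w => ?_, fun w => ?_⟩
    · refine wb_interpolate w fun σ1 e1 h1 h2 => ?_
      refine wb_interpolate h1 fun σ2 e2 h3 h4 => ?_
      have h5 := weaken_rel e2 h2
      rw [← Category.assoc, comp_some, comp_some]
      refine some_some_intro _ _ (fst _ _ ≫ snd _ _) (fst _ _ ≫ snd _ _) ?_
      simp only [comp_inf, comp_rel, comp_star, wb, lift_fst_assoc, lift_snd, Category.assoc, Category.id_comp] at *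
      refine le_inf (le_inf (wb_mono_right h5 (star_leq _ _).1)
        (wb_mono_right h5 (star_leq _ _).2)) ?_
      exact (le_inf (le_inf h3 h4) h4).trans (B.wb_star _ _ _ _)
    · refine some_some_elim _ _ w fun f σ1 a b _ h => ?_
      simp only [comp_inf, comp_rel, comp_star, wb, lift_fst_assoc, lift_snd, Category.assoc, Category.id_comp, le_inf_iff] at *
      obtain ⟨⟨h1, h2⟩, h3⟩ := h
      refine wb_interpolate h3 fun σ2 e2 h4 h5 => ?_
      have h6 := wb_mono_right h5 (by rw [comp_star]; exact (star_leq _ _).1)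
      have h7 := wb_mono_right h5 (by rw [comp_star]; exact (star_leq _ _).2)
      rw [comp_rel, comp_star]
      exact (le_inf (le_inf h4 (wb_trans h6 (weaken_rel e2 h1)))
        (wb_trans h7 (weaken_rel e2 h2))).trans (B.wb_star _ _ _ _)
  join n s t := by
    refine (B.wb_plus n s t).trans ?_
    congr 2
    rw [inf_assoc, inf_comm]

/-- The composite of two abstract matrices is one. -/
theorem IsAbstractMatrix.comp {H : B.N ⊗ C.N ⟶ (Sig : S)} {K : C.N ⊗ D.N ⟶ (Sig : S)}
    (h : IsAbstractMatrix B C H) (k : IsAbstractMatrix C D K) :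
    IsAbstractMatrix B D (relComp C.overt H K) where
  zero := (h.isSecondClassMatrix.comp k.isSecondClassMatrix).zero
  plus := (h.isSecondClassMatrix.comp k.isSecondClassMatrix).plus
  mono a' a c c' := by
    have w : leq a' a ⊓ rel (relComp C.overt H K) a c ⊓ leq c c' ≤
      rel (relComp C.overt H K) a c := inf_le_left.trans inf_le_right
    refine relComp_elim _ w fun σ1 e1 h1 h2 => ?_
    have h3 : σ1 ≤ leq (fst _ _ ≫ a') (fst _ _ ≫ a) :=
      weaken_rel e1 (inf_le_left.trans inf_le_left)
    have h4 : σ1 ≤ leq (fst _ _ ≫ c) (fst _ _ ≫ c') := weaken_rel e1 inf_le_right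
    rw [comp_rel]
    refine relComp_intro _ (snd _ _) ?_ ?_
    · refine (le_inf (le_inf h3 h1) ?_).trans (h.mono _ _ _ _)
      rw [leq_refl]; exact le_top
    · refine (le_inf (le_inf ?_ h2) h4).trans (k.mono _ _ _ _)
      rw [leq_refl]; exact le_top
  round n m := by
    have c := h.isSecondClassMatrix.comp k.isSecondClassMatrix
    refine eq_of_forces fun σ => ⟨fun w => ?_, fun w => ?_⟩
    · rw [← c.comp_left] at w
      refine relComp_elim _ w fun σ1 e1 h1 h2 => ?_
      rw [← c.comp_right] at h2
      refine relComp_elim _ h2 fun σ2 e2 h3 h4 => ?_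
      have h5 := weaken_rel e2 h1
      rw [← Category.assoc, comp_some, comp_some]
      refine some_some_intro _ _ (fst _ _ ≫ snd _ _) (snd _ _) ?_
      simp only [comp_inf, comp_rel, wb, lift_fst_assoc, lift_snd,
        Category.assoc, Category.id_comp] at *
      exact le_inf (le_inf h5 h3) h4
    · refine some_some_elim _ _ w fun f σ1 a b _ h => ?_
      simp only [comp_inf, comp_rel, wb, lift_fst_assoc, lift_snd,
        Category.assoc, Category.id_comp, le_inf_iff] at *
      rw [← c.comp_left, ← c.comp_right]
      exact relComp_intro _ _ h.1.1 (relComp_intro _ _ h.1.2 h.2)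
  bot n := by
    rw [h.bot]
    refine eq_of_forces fun σ => ⟨fun w => ?_, fun w => ?_⟩
    · rw [← h.isSecondClassMatrix.comp_right] at w
      refine relComp_elim _ w fun σ1 e1 h1 h2 => ?_
      rw [comp_O, ← wb, k.bot] at h2
      rw [comp_rel, comp_O]
      exact relComp_intro _ _ h1 h2
    · refine relComp_elim _ w fun σ1 e1 h1 h2 => ?_
      rw [comp_O, ← k.bot] at h2
      rw [comp_rel, comp_O]
      exact h.isSecondClassMatrix.right_intro h1 h2
  top n := by
    rw [h.top]
    refine eq_of_forces fun σ => ⟨fun w => ?_, fun w => ?_⟩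
    · rw [← h.isSecondClassMatrix.comp_right] at w
      refine relComp_elim _ w fun σ1 e1 h1 h2 => ?_
      rw [comp_I, ← wb, k.top] at h2
      rw [comp_rel, comp_I]
      exact relComp_intro _ _ h1 h2
    · refine relComp_elim _ w fun σ1 e1 h1 h2 => ?_
      rw [comp_I, ← k.top] at h2
      rw [comp_rel, comp_I]
      exact h.isSecondClassMatrix.right_intro h1 h2
  meet n s t := by
    refine eq_of_forces fun σ => ⟨fun w => ?_, fun w => ?_⟩
    · refine relComp_elim _ w fun σ1 e1 h1 h2 => ?_
      rw [comp_star, k.meet] at h2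
      refine some_some_elim _ _ h2 fun f σ2 a b e2 h3 => ?_
      have h4 := weaken_rel' e2 h1
      simp only [comp_inf, comp_rel, comp_star, wb, lift_fst_assoc, lift_snd, Category.assoc, Category.id_comp, le_inf_iff] at h3
      obtain ⟨⟨h5, h6⟩, h7⟩ := h3
      have h8 := h.isSecondClassMatrix.right_intro h4 h7
      rw [h.meet] at h8
      refine some_some_elim _ _ h8 fun g σ3 a' b' e3 h9 => ?_
      have h10 := weaken_rel' e3 h5
      have h11 := weaken_rel' e3 h6
      rw [← Category.assoc, ← Category.assoc, comp_some, comp_some]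
      refine some_some_intro _ _ a' b' ?_
      simp only [comp_inf, comp_rel, comp_star, wb, lift_fst_assoc, lift_snd, Category.assoc, Category.id_comp, le_inf_iff] at *
      exact ⟨⟨relComp_intro _ _ h9.1.1 h10, relComp_intro _ _ h9.1.2 h11⟩, h9.2⟩
    · refine some_some_elim _ _ w fun f σ1 a b e1 h1 => ?_
      simp only [comp_inf, comp_rel, comp_star, wb, lift_fst_assoc, lift_snd, Category.assoc, Category.id_comp, le_inf_iff] at h1
      obtain ⟨⟨h2, h3⟩, h4⟩ := h1
      refine relComp_elim _ h2 fun σ2 e2 h5 h6 => ?_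
      have h7 := weaken_rel e2 h3
      refine relComp_elim _ h7 fun σ3 e3 h8 h9 => ?_
      have h10 := weaken_rel e3 h5
      have h11 := weaken_rel e3 h6
      have h12 := weaken_rel e3 (weaken_rel e2 h4)
      have h13 : σ3 ≤ rel H (fst _ _ ≫ fst _ _ ≫ f ≫ n)
          (ostar (fst _ _ ≫ snd _ _) (snd _ _)) := by
        rw [h.meet]
        refine some_some_intro _ _ (fst _ _ ≫ fst _ _ ≫ a) (fst _ _ ≫ fst _ _ ≫ b) ?_
        simp only [comp_inf, comp_rel, comp_star, wb, lift_fst_assoc, lift_snd,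
          Category.assoc, Category.id_comp, le_inf_iff] at *
        exact ⟨⟨h10, h8⟩, h12⟩
      rw [← h.isSecondClassMatrix.comp_right] at h13
      refine relComp_elim _ h13 fun σ4 e4 h14 h15 => ?_
      have h16 := weaken_rel e4 (weaken_rel e3 h6)
      have h17 := weaken_rel e4 h9
      simp only [comp_rel, comp_star] at *
      refine relComp_intro _ _ h14 ?_
      rw [k.meet]
      refine some_some_intro _ _ (fst _ _ ≫ fst _ _ ≫ snd _ _) (fst _ _ ≫ snd _ _) ?_
      simp only [comp_inf, comp_rel, comp_star, wb, lift_fst_assoc, lift_snd,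
        Category.assoc, Category.id_comp, le_inf_iff] at *
      exact ⟨⟨h16, h17⟩, h15⟩
  join n s t := by
    refine eq_of_forces fun σ => ⟨fun w => ?_, fun w => ?_⟩
    · refine relComp_elim _ w fun σ1 e1 h1 h2 => ?_
      rw [comp_plus, k.join] at h2
      refine some_some_elim _ _ h2 fun f σ2 a b e2 h3 => ?_
      have h4 := weaken_rel' e2 h1
      simp only [comp_inf, comp_rel, comp_plus, wb, lift_fst_assoc, lift_snd, Category.assoc, Category.id_comp, le_inf_iff] at h3
      obtain ⟨⟨h5, h6⟩, h7⟩ := h3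
      have h8 := h.isSecondClassMatrix.right_intro h4 h7
      rw [h.join] at h8
      refine some_some_elim _ _ h8 fun g σ3 a' b' e3 h9 => ?_
      have h10 := weaken_rel' e3 h5
      have h11 := weaken_rel' e3 h6
      rw [← Category.assoc, ← Category.assoc, comp_some, comp_some]
      refine some_some_intro _ _ a' b' ?_
      simp only [comp_inf, comp_rel, comp_plus, wb, lift_fst_assoc, lift_snd, Category.assoc, Category.id_comp, le_inf_iff] at *
      exact ⟨⟨relComp_intro _ _ h9.1.1 h10, relComp_intro _ _ h9.1.2 h11⟩, h9.2⟩
    · refine some_some_elim _ _ w fun f σ1 a b e1 h1 => ?_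
      simp only [comp_inf, comp_rel, comp_plus, wb, lift_fst_assoc, lift_snd, Category.assoc, Category.id_comp, le_inf_iff] at h1
      obtain ⟨⟨h2, h3⟩, h4⟩ := h1
      refine relComp_elim _ h2 fun σ2 e2 h5 h6 => ?_
      have h7 := weaken_rel e2 h3
      refine relComp_elim _ h7 fun σ3 e3 h8 h9 => ?_
      have h10 := weaken_rel e3 h5
      have h11 := weaken_rel e3 h6
      have h12 := weaken_rel e3 (weaken_rel e2 h4)
      have h13 : σ3 ≤ rel H (fst _ _ ≫ fst _ _ ≫ f ≫ n)
          (oplus (fst _ _ ≫ snd _ _) (snd _ _)) := by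
        rw [h.join]
        refine some_some_intro _ _ (fst _ _ ≫ fst _ _ ≫ a) (fst _ _ ≫ fst _ _ ≫ b) ?_
        simp only [comp_inf, comp_rel, comp_plus, wb, lift_fst_assoc, lift_snd,
          Category.assoc, Category.id_comp, le_inf_iff] at *
        exact ⟨⟨h10, h8⟩, h12⟩
      rw [← h.isSecondClassMatrix.comp_right] at h13
      refine relComp_elim _ h13 fun σ4 e4 h14 h15 => ?_
      have h16 := weaken_rel e4 (weaken_rel e3 h6)
      have h17 := weaken_rel e4 h9
      simp only [comp_rel, comp_plus] at *
      refine relComp_intro _ _ h14 ?_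
      rw [k.join]
      refine some_some_intro _ _ (fst _ _ ≫ fst _ _ ≫ snd _ _) (fst _ _ ≫ snd _ _) ?_
      simp only [comp_inf, comp_rel, comp_plus, wb, lift_fst_assoc, lift_snd,
        Category.assoc, Category.id_comp, le_inf_iff] at *
      exact ⟨⟨h16, h17⟩, h15⟩

end

end Composition

section Categories

variable {S : Type u} [Category.{v} S] [CartesianMonoidalCategory S] [Model S]

/-- An abstract matrix from `B` to `C`. -/
@[ext]
structure AbstractMatrix (B C : AbstractBasis S) where
  mat : B.N ⊗ C.N ⟶ (Sig : S)
  isAbstractMatrix : IsAbstractMatrix B C mat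

/-- The category of abstract lattice bases and abstract matrices: the identity is `≪` and
composition is relational. -/
instance : Category (AbstractBasis S) where
  Hom B C := AbstractMatrix B C
  id B := ⟨B.waybelow, isAbstractMatrix_id B⟩
  comp {_ C _} H K := ⟨relComp C.overt H.mat K.mat, H.isAbstractMatrix.comp K.isAbstractMatrix⟩
  id_comp H := AbstractMatrix.ext H.isAbstractMatrix.isSecondClassMatrix.comp_left
  comp_id H := AbstractMatrix.ext H.isAbstractMatrix.isSecondClassMatrix.comp_right
  assoc {_ C D _} H K L := AbstractMatrix.ext (relComp_assoc C.overt D.overt H.mat K.mat L.mat)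

/-- An abstract basis, as an object of the category of second class matrices. -/
structure SecondClassBasis (S : Type u) [Category.{v} S] [CartesianMonoidalCategory S]
    [Model S] where
  basis : AbstractBasis S

/-- A relation satisfying the conditions for the matrix of a second class morphism. -/
@[ext]
structure SecondClassMatrix (B C : SecondClassBasis S) where
  mat : B.basis.N ⊗ C.basis.N ⟶ (Sig : S)
  isSecondClassMatrix : IsSecondClassMatrix B.basis C.basis mat

/-- The category of abstract bases and second class matrices: the identity is `≪` and
composition is relational. -/
instance : Category (SecondClassBasis S) where
  Hom B C := SecondClassMatrix B C
  id B := ⟨B.basis.waybelow, isSecondClassMatrix_id B.basis⟩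
  comp {_ C _} H K :=
    ⟨relComp C.basis.overt H.mat K.mat, H.isSecondClassMatrix.comp K.isSecondClassMatrix⟩
  id_comp H := SecondClassMatrix.ext H.isSecondClassMatrix.comp_left
  comp_id H := SecondClassMatrix.ext H.isSecondClassMatrix.comp_right
  assoc {_ C D _} H K L :=
    SecondClassMatrix.ext (relComp_assoc C.basis.overt D.basis.overt H.mat K.mat L.mat)

/-- An object of `S`, as an object of the category `HS` of second class maps. -/
structure Hayo (S : Type u) [Category.{v} S] [CartesianMonoidalCategory S]
    [SierpinskiCategory S] where
  obj : S

/-- A second class map from `X` to `Y` is a morphism `Σ^Y ⟶ Σ^X`. -/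
instance : Category (Hayo S) where
  Hom X Y := (pow Y.obj : S) ⟶ pow X.obj
  id X := 𝟙 (pow X.obj)
  comp F G := G ≫ F
  id_comp F := Category.comp_id (X := (pow _ : S)) F
  comp_id F := Category.id_comp (X := (pow _ : S)) F
  assoc F G H := (Category.assoc (W := (pow _ : S)) H G F).symm

end Categories

end ASD

/-!
The worlds of a Kripke–Joyal semantics are the objects of `S`: a proposition `σ : Γ ⟶ Sig` holds
when `σ = ⊤`. By the Phoa principle `φ ↦ φ ∧ σ` is a nucleus on `Γ`, so that every proposition
classifies an open subobject (`exists_open`). Hence `σ ≤ τ` means that `τ` holds wherever `σ` does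
(`le_iff_forces`), and every functional of type `Σ^(Σ^X)` is monotone (`app_mono`). In this
language, induction over lists proves both propositions and equations, and `List N` is again overt
and discrete if `N` is.

A *presentation* of `X` by a basis `B` is a family of open predicates `β n` and of functionals
`A n`, for `n : B.N`, such that every `φ` is `∃ n. A n φ ∧ β n` and `n ≪ m` is `A n (β m)`. The
theorem follows from three facts.

* Every definable object is presented by an abstract basis. By the Scott principle definable
  objects are `Σ`-split subspaces of some `Σ^N` (`isSplit_of_definable`), and such a subspace is
  presented by the free distributive lattice on `N`, that is, by lists of lists of elements of `N`,
  whose imposed order is given by an explicit quantification over lists (`isImposedOrder_freeLe`).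

* Every abstract basis presents an object (`exists_presentation`). A functional `Φ` on `Σ^N`
  generates the rounded ideal `J Φ` of all `n ≪ ΣΠ L` with `L` a list of lists at which `Φ` holds,
  and a rounded ideal `θ` gives the functional `K θ = λ ξ. ∃ n. θ n ∧ ξ n`. The composite of `J` and
  `K` is a nucleus (`isNucleus_idealOf_meets`), and its subspace is the object sought. The Scott
  principle is what reduces the equation for a nucleus, for an arbitrary `F` of third order, to
  finitely many polynomials, which can be multiplied.

* For presented objects, the matrices `A n (H (γ m))` of the morphisms `H : Σ^Y ⟶ Σ^X` are exactly
  the second class matrices (`Presentation.ofMatrix_matrix`, `Presentation.matrix_ofMatrix`), and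
  those of inverse image maps are exactly the abstract matrices. For the latter, the rules for an
  abstract matrix say that `λ m. H (γ m) x` preserves the lattice operations; by the Scott
  principle it is then admissible (`Presentation.app_basicValues_eq`), so that `λ φ. H φ x` is prime
  and is given by a point of `Y`, since `Y` is sober (`Presentation.exists_powMap_eq`).
-/

namespace ASD

open SierpinskiCategory BasisData

/-! ### Terms and application -/

section Terms

variable {S : Type u} [Category.{v} S] [CartesianMonoidalCategory S] [SierpinskiCategory S]
  {Γ Δ X Y Z N M : S}

attribute [simp] comp_inf comp_sup comp_top comp_bot

@[simp]
theorem comp_app (f : Δ ⟶ Γ) (φ : Γ ⟶ pow X) (a : Γ ⟶ X) :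
    f ≫ app φ a = app (f ≫ φ) (f ≫ a) := by
  simp [app, ← Category.assoc]

@[simp]
theorem app_comp_lam (f : Δ ⟶ Γ) (θ : Γ ⊗ X ⟶ (Sig : S)) (a : Δ ⟶ X) :
    app (f ≫ lam θ) a = lift f a ≫ θ := by
  rw [comp_lam, app_lam, ← Category.assoc]; simp

@[simp]
theorem app_comp_comp_lam (g : Z ⟶ Δ) (f : Δ ⟶ Γ) (θ : Γ ⊗ X ⟶ (Sig : S)) (a : Z ⟶ X) :
    app (g ≫ f ≫ lam θ) a = lift (g ≫ f) a ≫ θ := by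
  rw [← Category.assoc, app_comp_lam]

@[simp]
theorem app_lam_id (θ : Γ ⊗ X ⟶ (Sig : S)) (a : Γ ⟶ X) :
    app (lam θ) a = lift (𝟙 Γ) a ≫ θ := app_lam θ a

theorem pow_ext {φ ψ : Γ ⟶ pow X}
    (h : ∀ {Δ : S} (f : Δ ⟶ Γ) (a : Δ ⟶ X), app (f ≫ φ) a = app (f ≫ ψ) a) : φ = ψ := by
  rw [← eta φ, ← eta ψ]
  exact congrArg lam (h (fst Γ X) (snd Γ X))

@[simp]
theorem app_powMap (f : X ⟶ Y) (φ : Γ ⟶ pow Y) (a : Γ ⟶ X) :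
    app (φ ≫ powMap f) a = app φ (a ≫ f) := by
  simp [powMap]

@[simp]
theorem app_powMap_assoc (f : X ⟶ Y) (b : Γ ⟶ Z) (φ : Z ⟶ pow Y) (a : Γ ⟶ X) :
    app (b ≫ φ ≫ powMap f) a = app (b ≫ φ) (a ≫ f) := by
  rw [← Category.assoc, app_powMap]

@[simp]
theorem app_point (a : Γ ⟶ X) (φ : Γ ⟶ pow X) : app (a ≫ point X) φ = app φ a := by
  simp [point]

@[simp]
theorem app_point_assoc (b : Γ ⟶ Z) (a : Z ⟶ X) (φ : Γ ⟶ pow X) :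
    app (b ≫ a ≫ point X) φ = app φ (b ≫ a) := by
  rw [← Category.assoc, app_point]

@[simp]
theorem comp_point_powMap (b : Γ ⟶ X) (H : pow Y ⟶ pow X) (φ : Γ ⟶ pow Y) :
    app (b ≫ point X ≫ powMap H) φ = app (φ ≫ H) b := by
  rw [← Category.assoc, app_powMap, app_point]

@[simp]
theorem comp_powMap (f : X ⟶ Y) (g : Y ⟶ Z) : powMap (S := S) (f ≫ g) = powMap g ≫ powMap f := by
  refine pow_ext fun f a => ?_
  simp

/-- The term `φ ∨ ψ` of type `Σ^X`. -/
def psup (φ ψ : Γ ⟶ pow X) : Γ ⟶ pow X :=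
  lam (app (fst _ _ ≫ φ) (snd _ _) ⊔ app (fst _ _ ≫ ψ) (snd _ _))

/-- The term `φ ∧ ψ` of type `Σ^X`. -/
def pinf (φ ψ : Γ ⟶ pow X) : Γ ⟶ pow X :=
  lam (app (fst _ _ ≫ φ) (snd _ _) ⊓ app (fst _ _ ≫ ψ) (snd _ _))

/-- The term `λ x. σ` of type `Σ^X`, for a proposition `σ`. -/
def pconst (X : S) (σ : Γ ⟶ (Sig : S)) : Γ ⟶ pow X := lam (fst Γ X ≫ σ)

@[simp]
theorem app_psup (φ ψ : Γ ⟶ pow X) (a : Γ ⟶ X) : app (psup φ ψ) a = app φ a ⊔ app ψ a := by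
  simp [psup]

@[simp]
theorem app_pinf (φ ψ : Γ ⟶ pow X) (a : Γ ⟶ X) : app (pinf φ ψ) a = app φ a ⊓ app ψ a := by
  simp [pinf]

@[simp]
theorem app_pconst (σ : Γ ⟶ (Sig : S)) (a : Γ ⟶ X) : app (pconst X σ) a = σ := by
  simp [pconst]

@[simp]
theorem comp_psup (f : Δ ⟶ Γ) (φ ψ : Γ ⟶ pow X) : f ≫ psup φ ψ = psup (f ≫ φ) (f ≫ ψ) := by
  refine pow_ext fun g a => ?_
  simp [psup]

@[simp]
theorem comp_pinf (f : Δ ⟶ Γ) (φ ψ : Γ ⟶ pow X) : f ≫ pinf φ ψ = pinf (f ≫ φ) (f ≫ ψ) := by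
  refine pow_ext fun g a => ?_
  simp [pinf]

@[simp]
theorem comp_pconst (f : Δ ⟶ Γ) (σ : Γ ⟶ (Sig : S)) : f ≫ pconst X σ = pconst X (f ≫ σ) := by
  refine pow_ext fun g a => ?_
  simp [pconst]

theorem forces_comp (f : Δ ⟶ Γ) {σ : Γ ⟶ (Sig : S)} (h : σ = ⊤) : f ≫ σ = ⊤ := by
  rw [h, comp_top]

end Terms

/-! ### Open subobjects and forcing -/

section Forcing

variable {S : Type u} [Category.{v} S] [CartesianMonoidalCategory S] [Model S]
  {Γ Δ X Y Z N M : S}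

/-- The Phoa principle makes every function of a proposition monotone. -/
theorem app_bot_le_app_top (F : Γ ⟶ pow (Sig : S)) : app F ⊥ ≤ app F ⊤ := by
  have := Model.phoa F ⊤
  rw [top_inf_eq] at this
  rw [this]; exact le_sup_left

theorem inf_app_inf (Φ : Γ ⟶ pow (pow X)) (φ : Γ ⟶ pow X) (σ : Γ ⟶ (Sig : S)) :
    σ ⊓ app Φ (pinf φ (pconst X σ)) = σ ⊓ app Φ φ := by
  let F : Γ ⟶ pow (Sig : S) :=
    lam (app (fst _ _ ≫ Φ) (pinf (fst _ _ ≫ φ) (pconst X (snd _ _))))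
  have key : ∀ τ : Γ ⟶ (Sig : S), app F τ = app Φ (pinf φ (pconst X τ)) := by
    intro τ; simp [F]
  have ht : app F ⊤ = app Φ φ := by
    rw [key]; congr 1; exact pow_ext fun f a => by simp
  rw [← key, Model.phoa, inf_sup_left, ht]
  have := app_bot_le_app_top F
  rw [ht] at this
  refine le_antisymm (sup_le (inf_le_inf_left _ this) ?_) ?_
  · exact inf_le_right
  · exact le_sup_of_le_right (le_inf inf_le_left le_rfl)

/-- Every proposition `σ` in context `Γ` is classified by an open subobject of `Γ`: the map
`φ ↦ φ ∧ σ` is a nucleus, by the Phoa principle, and its subspace is where `σ` holds. -/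
theorem exists_open (σ : Γ ⟶ (Sig : S)) :
    ∃ (U : S) (i : U ⟶ Γ), i ≫ σ = ⊤ ∧ ∀ τ : Γ ⟶ (Sig : S), i ≫ τ = ⊤ → σ ≤ τ := by
  let E : pow Γ ⟶ pow Γ := lam (app (fst (pow Γ) Γ) (snd (pow Γ) Γ) ⊓ snd _ _ ≫ σ)
  have hE : ∀ {Δ : S} (φ : Δ ⟶ pow Γ) (a : Δ ⟶ Γ), app (φ ≫ E) a = app φ a ⊓ a ≫ σ := by
    intro Δ φ a; simp [E, ← Category.assoc]
  have nuc : IsNucleus E := by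
    intro Δ F
    refine pow_ext fun f a => ?_
    rw [← Category.assoc, ← Category.assoc, hE, hE]
    simp only [app_comp_lam, comp_app, ← Category.assoc, lift_fst, lift_snd]
    rw [inf_comm, inf_comm (app _ _), ← inf_app_inf]
    congr 3
    refine pow_ext fun g b => ?_
    simp only [Category.assoc, comp_pinf, comp_pconst, app_pinf, app_pconst, app_point_assoc]
    have e := comp_point_powMap (g ≫ a) E b
    rw [Category.assoc, hE, Category.assoc] at e
    exact e.symm
  obtain ⟨U, i, I, h⟩ := Model.subspace E nuc
  have adm : ∀ {Δ : S} (φ : Δ ⟶ pow Γ) (b : Δ ⟶ U), app (φ ≫ E) (b ≫ i) = app φ (b ≫ i) := by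
    intro Δ φ b
    rw [← h.nucleus, ← app_powMap, ← app_powMap, Category.assoc, Category.assoc, h.split,
      Category.comp_id]
  refine ⟨U, i, ?_, fun τ hτ => ?_⟩
  · have := adm (pconst Γ ⊤) (𝟙 U)
    rw [hE, app_pconst] at this
    simpa using this
  · have hi : ∀ ρ : Γ ⟶ (Sig : S), i ≫ ρ = ⊤ →
        lam (snd (𝟙_ S) Γ ≫ ρ) ≫ powMap i = pconst U ⊤ := by
      intro ρ hρ
      refine pow_ext fun f a => ?_
      simp [hρ]
    have e : lam (snd (𝟙_ S) Γ ≫ τ) ≫ E = lam (snd (𝟙_ S) Γ ≫ (⊤ : Γ ⟶ (Sig : S))) ≫ E := by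
      rw [← h.nucleus, ← Category.assoc, ← Category.assoc, hi τ hτ, hi ⊤ (comp_top _)]
    have := congrArg (fun (t : 𝟙_ S ⟶ pow Γ) => app (toUnit Γ ≫ t) (𝟙 Γ)) e
    simp only [← Category.assoc, hE] at this
    simp at this
    exact this

/-- The order on propositions is Kripke–Joyal implication, with the objects of `S` as worlds. -/
theorem le_iff_forces {σ τ : Γ ⟶ (Sig : S)} :
    σ ≤ τ ↔ ∀ {Δ : S} (f : Δ ⟶ Γ), f ≫ σ = ⊤ → f ≫ τ = ⊤ := by
  refine ⟨fun h Δ f e => top_le_iff.1 (e ▸ comp_mono f h), fun h => ?_⟩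
  obtain ⟨U, i, h1, h2⟩ := exists_open σ
  exact h2 τ (h i h1)

theorem forces_ext {σ τ : Γ ⟶ (Sig : S)}
    (h : ∀ {Δ : S} (f : Δ ⟶ Γ), f ≫ σ = ⊤ ↔ f ≫ τ = ⊤) : σ = τ :=
  le_antisymm (le_iff_forces.2 fun f => (h f).1) (le_iff_forces.2 fun f => (h f).2)

theorem sup_forces_elim {σ τ ρ : Γ ⟶ (Sig : S)} (h : σ ⊔ τ = ⊤)
    (h1 : ∀ {Δ : S} (f : Δ ⟶ Γ), f ≫ σ = ⊤ → f ≫ ρ = ⊤)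
    (h2 : ∀ {Δ : S} (f : Δ ⟶ Γ), f ≫ τ = ⊤ → f ≫ ρ = ⊤) : ρ = ⊤ :=
  top_le_iff.1 (h ▸ sup_le (le_iff_forces.2 h1) (le_iff_forces.2 h2))

theorem sup_forces_left {σ τ : Γ ⟶ (Sig : S)} (h : σ = ⊤) : σ ⊔ τ = ⊤ := by rw [h, top_sup_eq]

theorem sup_forces_right {σ τ : Γ ⟶ (Sig : S)} (h : τ = ⊤) : σ ⊔ τ = ⊤ := by rw [h, sup_top_eq]

theorem inf_forces {σ τ : Γ ⟶ (Sig : S)} (h : σ = ⊤) (h' : τ = ⊤) : σ ⊓ τ = ⊤ := by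
  rw [h, h', inf_top_eq]

theorem inf_forces_iff {σ τ : Γ ⟶ (Sig : S)} : σ ⊓ τ = ⊤ ↔ σ = ⊤ ∧ τ = ⊤ := inf_eq_top_iff

theorem isExists_intro {θ : Γ ⊗ N ⟶ (Sig : S)} {σ : Γ ⟶ (Sig : S)} (h : IsExists θ σ)
    (a : Γ ⟶ N) (ha : lift (𝟙 Γ) a ≫ θ = ⊤) : σ = ⊤ := by
  have := comp_mono (lift (𝟙 Γ) a) ((h σ).1 le_rfl)
  rw [ha] at this
  simpa using this

theorem isExists_elim {θ : Γ ⊗ N ⟶ (Sig : S)} {σ τ : Γ ⟶ (Sig : S)} (h : IsExists θ σ)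
    (hσ : σ = ⊤) (k : ∀ {Δ : S} (f : Δ ⟶ Γ) (a : Δ ⟶ N), lift f a ≫ θ = ⊤ → f ≫ τ = ⊤) :
    τ = ⊤ := by
  have : σ ≤ τ := (h τ).2 <| le_iff_forces.2 fun f e => by
    have e' : lift (f ≫ fst Γ N) (f ≫ snd Γ N) ≫ θ = ⊤ := by
      rw [← comp_lift]; simpa using e
    have := k _ _ e'
    simpa using this
  exact top_le_iff.1 (hσ ▸ this)

theorem some_forces_intro (o : Overt N) {θ : Γ ⊗ N ⟶ (Sig : S)} (a : Γ ⟶ N)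
    (ha : lift (𝟙 Γ) a ≫ θ = ⊤) : o.some θ = ⊤ :=
  isExists_intro (o.adj θ) a ha

theorem some_forces_elim {o : Overt N} {θ : Γ ⊗ N ⟶ (Sig : S)} {τ : Γ ⟶ (Sig : S)}
    (h : o.some θ = ⊤)
    (k : ∀ {Δ : S} (f : Δ ⟶ Γ) (a : Δ ⟶ N), lift f a ≫ θ = ⊤ → f ≫ τ = ⊤) : τ = ⊤ :=
  isExists_elim (o.adj θ) h k

/-- A disjunct of an existential statement in a later world; the form that survives rewriting by
`comp_some`. -/
theorem comp_some_forces_intro (o : Overt N) (f : Δ ⟶ Γ) {θ : Γ ⊗ N ⟶ (Sig : S)} (a : Δ ⟶ N)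
    (ha : lift f a ≫ θ = ⊤) : f ≫ o.some θ = ⊤ := by
  rw [comp_some]
  refine some_forces_intro o a ?_
  rw [← Category.assoc]
  simpa using ha

/-- Functionals are monotone. -/
theorem app_mono {Φ : Γ ⟶ pow (pow X)} {φ ψ : Γ ⟶ pow X} (h : app Φ φ = ⊤)
    (k : ∀ {Δ : S} (f : Δ ⟶ Γ) (a : Δ ⟶ X), app (f ≫ φ) a = ⊤ → app (f ≫ ψ) a = ⊤) :
    app Φ ψ = ⊤ := by
  let F : Γ ⟶ pow (Sig : S) :=
    lam (app (fst _ _ ≫ Φ) (psup (fst _ _ ≫ φ) (pinf (fst _ _ ≫ ψ) (pconst X (snd _ _)))))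
  have h0 : app F ⊥ = app Φ φ := by
    simp only [F, app_lam_id, comp_app, comp_psup, comp_pinf, comp_pconst,
        lift_fst_assoc, lift_snd, Category.id_comp]
    congr 1; exact pow_ext fun f a => by simp
  have h1 : app F ⊤ = app Φ ψ := by
    simp only [F, app_lam_id, comp_app, comp_psup, comp_pinf, comp_pconst,
        lift_fst_assoc, lift_snd, Category.id_comp]
    congr 1
    refine pow_ext fun f a => ?_
    simp only [comp_psup, comp_pinf, comp_pconst, app_psup, app_pinf, app_pconst, comp_top,
      inf_top_eq, sup_eq_right]
    refine le_iff_forces.2 fun g e => ?_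
    simp only [comp_app, ← Category.assoc] at e ⊢
    exact k _ _ e
  have := app_bot_le_app_top F
  rw [h0, h1, h] at this
  exact top_le_iff.1 this

theorem eq_of_points {a b : Γ ⟶ X}
    (h : ∀ {Δ : S} (f : Δ ⟶ Γ) (φ : Δ ⟶ pow X), app φ (f ≫ a) = app φ (f ≫ b)) : a = b := by
  have hp : IsPrime (b ≫ point X) := by
    intro Δ f F
    simp
  refine (Model.sober (b ≫ point X) hp).unique ?_ rfl
  refine pow_ext fun f φ => ?_
  simp [h]

end Forcing

/-! ### Recursion and induction -/

section Recursion

variable {S : Type u} [Category.{v} S] [CartesianMonoidalCategory S]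

/-- Two terms with a variable of type `ℕ` agree if they satisfy the same recursion. Terms are given
as families over all contexts that commute with substitution. -/
theorem NaturalNumbers.term_ext (K : NaturalNumbers S) {P X : S}
    (t t' : ∀ {Δ : S}, (Δ ⟶ P) → (Δ ⟶ K.Nat) → (Δ ⟶ X))
    (s : ∀ {Δ : S}, (Δ ⟶ P) → (Δ ⟶ K.Nat) → (Δ ⟶ X) → (Δ ⟶ X))
    (ht : ∀ {Δ Δ' : S} (g : Δ' ⟶ Δ) (p : Δ ⟶ P) (k : Δ ⟶ K.Nat),
      g ≫ t p k = t (g ≫ p) (g ≫ k))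
    (ht' : ∀ {Δ Δ' : S} (g : Δ' ⟶ Δ) (p : Δ ⟶ P) (k : Δ ⟶ K.Nat),
      g ≫ t' p k = t' (g ≫ p) (g ≫ k))
    (hs : ∀ {Δ Δ' : S} (g : Δ' ⟶ Δ) (p : Δ ⟶ P) (k : Δ ⟶ K.Nat) (x : Δ ⟶ X),
      g ≫ s p k x = s (g ≫ p) (g ≫ k) (g ≫ x))
    (h0 : ∀ {Δ : S} (p : Δ ⟶ P), t p (toUnit Δ ≫ K.zero) = t' p (toUnit Δ ≫ K.zero))
    (h1 : ∀ {Δ : S} (p : Δ ⟶ P) (k : Δ ⟶ K.Nat), t p (k ≫ K.succ) = s p k (t p k))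
    (h1' : ∀ {Δ : S} (p : Δ ⟶ P) (k : Δ ⟶ K.Nat), t' p (k ≫ K.succ) = s p k (t' p k))
    {Δ : S} (p : Δ ⟶ P) (k : Δ ⟶ K.Nat) : t p k = t' p k := by
  have key : t (fst P K.Nat) (snd P K.Nat) = t' (fst P K.Nat) (snd P K.Nat) := by
    refine (K.recursion (t (𝟙 P) (toUnit P ≫ K.zero))
      (s (fst _ _ ≫ fst _ _) (fst _ _ ≫ snd _ _) (snd _ _))).unique ⟨?_, ?_⟩ ⟨?_, ?_⟩
    · rw [ht]; simp
    · rw [ht, hs]; simp [h1]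
    · rw [ht', h0]; simp
    · rw [ht', hs]; simp [h1']
  have := congrArg (lift p k ≫ ·) key
  simpa [ht, ht'] using this

namespace ListObject

variable {Γ Δ N P X : S} (L : ListObject N)

/-- The empty list. -/
def nl (Γ : S) : Γ ⟶ L.List := toUnit Γ ≫ L.nil

/-- The term `n :: l`. -/
def cs (n : Γ ⟶ N) (l : Γ ⟶ L.List) : Γ ⟶ L.List := lift n l ≫ L.cons

@[simp]
theorem comp_nl (f : Δ ⟶ Γ) : f ≫ L.nl Γ = L.nl Δ := by
  simp [nl, ← Category.assoc]

@[simp]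
theorem comp_cs (f : Δ ⟶ Γ) (n : Γ ⟶ N) (l : Γ ⟶ L.List) :
    f ≫ L.cs n l = L.cs (f ≫ n) (f ≫ l) := by
  simp [cs, ← Category.assoc]

theorem recur_nl (p : Γ ⟶ P) (z : P ⟶ X) (s : (P ⊗ (N ⊗ L.List)) ⊗ X ⟶ X) :
    lift p (L.nl Γ) ≫ L.recur z s = p ≫ z := by
  conv_rhs => rw [← L.recur_nil z s, ← Category.assoc]
  simp [nl]

theorem recur_cs (p : Γ ⟶ P) (n : Γ ⟶ N) (l : Γ ⟶ L.List) (z : P ⟶ X)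
    (s : (P ⊗ (N ⊗ L.List)) ⊗ X ⟶ X) :
    lift p (L.cs n l) ≫ L.recur z s =
      lift (lift p (lift n l)) (lift p l ≫ L.recur z s) ≫ s := by
  have := congrArg (lift p (lift n l) ≫ ·) (L.recur_cons z s)
  simp only [← Category.assoc, comp_lift] at this
  simpa [cs] using this

/-- Two terms with a list variable agree if they satisfy the same recursion. -/
theorem term_ext
    (t t' : ∀ {Δ : S}, (Δ ⟶ P) → (Δ ⟶ L.List) → (Δ ⟶ X))
    (s : ∀ {Δ : S}, (Δ ⟶ P) → (Δ ⟶ N) → (Δ ⟶ L.List) → (Δ ⟶ X) → (Δ ⟶ X))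
    (ht : ∀ {Δ Δ' : S} (g : Δ' ⟶ Δ) (p : Δ ⟶ P) (l : Δ ⟶ L.List),
      g ≫ t p l = t (g ≫ p) (g ≫ l))
    (ht' : ∀ {Δ Δ' : S} (g : Δ' ⟶ Δ) (p : Δ ⟶ P) (l : Δ ⟶ L.List),
      g ≫ t' p l = t' (g ≫ p) (g ≫ l))
    (hs : ∀ {Δ Δ' : S} (g : Δ' ⟶ Δ) (p : Δ ⟶ P) (n : Δ ⟶ N) (l : Δ ⟶ L.List) (x : Δ ⟶ X),
      g ≫ s p n l x = s (g ≫ p) (g ≫ n) (g ≫ l) (g ≫ x))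
    (h0 : ∀ {Δ : S} (p : Δ ⟶ P), t p (L.nl Δ) = t' p (L.nl Δ))
    (h1 : ∀ {Δ : S} (p : Δ ⟶ P) (n : Δ ⟶ N) (l : Δ ⟶ L.List),
      t p (L.cs n l) = s p n l (t p l))
    (h1' : ∀ {Δ : S} (p : Δ ⟶ P) (n : Δ ⟶ N) (l : Δ ⟶ L.List),
      t' p (L.cs n l) = s p n l (t' p l))
    {Δ : S} (p : Δ ⟶ P) (l : Δ ⟶ L.List) : t p l = t' p l := by
  have key : t (fst P L.List) (snd P L.List) = t' (fst P L.List) (snd P L.List) := by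
    rw [L.recur_unique (t (𝟙 P) (L.nl P))
      (s (fst _ _ ≫ fst _ _) (fst _ _ ≫ snd _ _ ≫ fst _ _) (fst _ _ ≫ snd _ _ ≫ snd _ _)
        (snd _ _)) (t (fst P L.List) (snd P L.List)) ?_ ?_]
    · symm
      refine L.recur_unique _ _ _ ?_ ?_
      · rw [ht', h0]; simp [nl]
      · have := h1' (fst P (N ⊗ L.List)) (snd _ _ ≫ fst _ _) (snd _ _ ≫ snd _ _)
        rw [ht', hs]
        simpa [ht', cs, ← comp_lift] using this
    · rw [ht]; simp [nl]
    · have := h1 (fst P (N ⊗ L.List)) (snd _ _ ≫ fst _ _) (snd _ _ ≫ snd _ _)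
      rw [ht, hs]
      simpa [ht, cs, ← comp_lift] using this
  have := congrArg (lift p l ≫ ·) key
  simpa [ht, ht'] using this

end ListObject

end Recursion

section Induction

variable {S : Type u} [Category.{v} S] [CartesianMonoidalCategory S] [Model S]

namespace ListObject

variable {Γ Δ N P X : S} (L : ListObject N)

/-- List induction for open predicates. -/
theorem induction
    (t : ∀ {Δ : S}, (Δ ⟶ P) → (Δ ⟶ L.List) → (Δ ⟶ (Sig : S)))
    (ht : ∀ {Δ Δ' : S} (g : Δ' ⟶ Δ) (p : Δ ⟶ P) (l : Δ ⟶ L.List),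
      g ≫ t p l = t (g ≫ p) (g ≫ l))
    (h0 : ∀ {Δ : S} (p : Δ ⟶ P), t p (L.nl Δ) = ⊤)
    (h1 : ∀ {Δ : S} (p : Δ ⟶ P) (n : Δ ⟶ N) (l : Δ ⟶ L.List),
      t p l = ⊤ → t p (L.cs n l) = ⊤)
    {Δ : S} (p : Δ ⟶ P) (l : Δ ⟶ L.List) : t p l = ⊤ := by
  refine L.term_ext t (fun _ _ => ⊤) (fun p n l x => x ⊔ t p (L.cs n l)) ht (by simp)
    (by simp [ht]) h0 (fun p n l => ?_) (by simp) p l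
  symm
  rw [sup_eq_right]
  refine le_iff_forces.2 fun f e => ?_
  rw [ht] at e ⊢
  simpa using h1 _ (f ≫ n) _ e

/-- List induction for an implication between open predicates, whose hypothesis is inherited by
the tail of a list. -/
theorem induction_of_tail
    (a b : ∀ {Δ : S}, (Δ ⟶ P) → (Δ ⟶ L.List) → (Δ ⟶ (Sig : S)))
    (ha : ∀ {Δ Δ' : S} (g : Δ' ⟶ Δ) (p : Δ ⟶ P) (l : Δ ⟶ L.List),
      g ≫ a p l = a (g ≫ p) (g ≫ l))
    (hb : ∀ {Δ Δ' : S} (g : Δ' ⟶ Δ) (p : Δ ⟶ P) (l : Δ ⟶ L.List),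
      g ≫ b p l = b (g ≫ p) (g ≫ l))
    (h0 : ∀ {Δ : S} (p : Δ ⟶ P), a p (L.nl Δ) = ⊤ → b p (L.nl Δ) = ⊤)
    (tail : ∀ {Δ : S} (p : Δ ⟶ P) (n : Δ ⟶ N) (l : Δ ⟶ L.List),
      a p (L.cs n l) = ⊤ → a p l = ⊤)
    (h1 : ∀ {Δ : S} (p : Δ ⟶ P) (n : Δ ⟶ N) (l : Δ ⟶ L.List),
      a p (L.cs n l) = ⊤ → b p l = ⊤ → b p (L.cs n l) = ⊤)
    {Δ : S} (p : Δ ⟶ P) (l : Δ ⟶ L.List) (h : a p l = ⊤) : b p l = ⊤ := by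
  have key := L.term_ext (fun p l => a p l ⊓ b p l) a
    (fun p n l x => a p (L.cs n l) ⊓ (x ⊔ b p (L.cs n l)))
    (by simp [ha, hb]) ha (by simp [ha, hb]) (fun p => ?_) (fun p n l => ?_) (fun p n l => ?_) p l
  · rw [h, top_inf_eq] at key; exact key
  · rw [inf_eq_left]
    refine le_iff_forces.2 fun f e => ?_
    rw [ha] at e; rw [hb]
    simpa using h0 (f ≫ p) (by simpa using e)
  · rw [inf_sup_left]
    symm
    rw [sup_eq_right]
    refine le_iff_forces.2 fun f e => ?_
    simp only [comp_inf, inf_forces_iff, ha, hb, comp_cs] at e ⊢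
    exact ⟨e.1, h1 _ _ _ e.1 e.2.2⟩
  · symm
    rw [inf_eq_left]
    refine le_iff_forces.2 fun f e => ?_
    rw [comp_sup]
    refine sup_forces_left ?_
    rw [ha] at e ⊢
    exact tail _ (f ≫ n) _ (by simpa using e)

/-! ### Lists over an overt discrete object -/

section Overt

/-- `D θ k` is `λ l. ∃ n₁ … n_k. θ (n_k :: … :: n₁ :: l)`. -/
theorem exists_prepend (o : Overt N) :
    ∃ D : (pow L.List : S) ⊗ (Model.naturals (S := S)).Nat ⟶ pow L.List,
    (∀ {Γ : S} (θ : Γ ⟶ pow L.List), lift θ (toUnit Γ ≫ Model.naturals.zero) ≫ D = θ) ∧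
    ∀ {Γ : S} (θ : Γ ⟶ pow L.List) (k : Γ ⟶ Model.naturals.Nat) (l : Γ ⟶ L.List),
      app (lift θ (k ≫ Model.naturals.succ) ≫ D) l =
        o.some (app (fst _ _ ≫ lift θ k ≫ D) (L.cs (snd _ _) (fst _ _ ≫ l))) := by
  obtain ⟨D, ⟨h0, h1⟩, -⟩ := (Model.naturals (S := S)).recursion (𝟙 (pow L.List : S))
    (lam (o.some (app (fst _ _ ≫ fst _ _ ≫ snd _ _) (L.cs (snd _ _) (fst _ _ ≫ snd _ _)))))
  refine ⟨D, fun {Γ} θ => ?_, fun {Γ} θ k l => ?_⟩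
  · have := congrArg (θ ≫ ·) h0
    simp only [← Category.assoc, comp_lift] at this
    simpa using this
  · have := congrArg (lift θ k ≫ ·) h1
    simp only [← Category.assoc, comp_lift] at this
    simp only [lift_fst, lift_snd, Category.comp_id] at this
    rw [this]
    simp [comp_some]

/-- Lists over an overt object form an overt object: the quantifier is `∃ k. ∃ n₁ … n_k`. -/
theorem nonempty_overt (o : Overt N) : Nonempty (Overt L.List) := by
  obtain ⟨D, h0, h1⟩ := L.exists_prepend o
  let K := Model.naturals (S := S)
  let oK : Overt K.Nat := Model.naturals_overt
  let ex : (pow L.List : S) ⟶ Sig := oK.some (app D (L.nl _))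
  have hex : ∀ {Γ : S} (θ : Γ ⟶ pow L.List), θ ≫ ex =
      oK.some (app (lift (fst _ _ ≫ θ) (snd _ _) ≫ D) (L.nl _)) := by
    intro Γ θ; simp [ex, comp_some]
  have intro' : ∀ {Γ : S} (θ : Γ ⟶ pow L.List) (l : Γ ⟶ L.List), app θ l = ⊤ → θ ≫ ex = ⊤ := by
    intro Γ θ l h
    have := L.induction_of_tail (P := Γ)
      (fun f l => oK.some (app (lift (fst _ _ ≫ f ≫ θ) (snd _ _) ≫ D) (fst _ _ ≫ l)))
      (fun f _ => f ≫ θ ≫ ex) (by simp [comp_some, comp_lift_assoc]) (by simp)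
      (fun f e => by rw [← Category.assoc, hex]; simpa using e)
      (fun f n l e => ?_) (fun _ _ _ _ e => e) (𝟙 Γ) l ?_
    · simpa using this
    · refine some_forces_elim e fun {Δ'} g k e => ?_
      refine comp_some_forces_intro _ _ (k ≫ K.succ) ?_
      simp only [comp_app, ← Category.assoc, comp_lift, lift_fst, lift_snd, comp_cs] at e ⊢
      rw [h1]
      exact some_forces_intro o (g ≫ n) (by simpa [← Category.assoc] using e)
    · refine some_forces_intro _ (toUnit Γ ≫ K.zero) ?_
      simp only [comp_app, ← Category.assoc, comp_lift, lift_fst, lift_snd]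
      rw [h0]; simpa using h
  have elim' : ∀ {Γ : S} (θ : Γ ⟶ pow L.List) (τ : Γ ⟶ (Sig : S)),
      (∀ {Δ : S} (f : Δ ⟶ Γ) (l : Δ ⟶ L.List), app (f ≫ θ) l = ⊤ → f ≫ τ = ⊤) →
      θ ≫ ex = ⊤ → τ = ⊤ := by
    intro Γ θ τ h e
    rw [hex] at e
    refine some_forces_elim e fun {Δ} f k e => ?_
    have key := K.term_ext (P := Γ) (X := pow L.List)
      (fun p k => psup (lift (p ≫ θ) k ≫ D) (pconst _ (p ≫ τ))) (fun p _ => pconst _ (p ≫ τ))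
      (fun p k x => psup (lam (o.some (app (fst _ _ ≫ fst _ _ ≫ x)
        (L.cs (snd _ _) (fst _ _ ≫ snd _ _))))) (pconst _ (p ≫ τ)))
      (by simp [← Category.assoc]) (by simp) ?_ ?_ ?_ ?_ f k
    · have := congrArg (fun φ => app φ (L.nl _)) key
      simp only [app_psup, app_pconst] at this
      rw [← this]
      refine sup_forces_left ?_
      simpa [← Category.assoc] using e
    · intro Δ Δ' g p k x
      refine pow_ext fun f a => ?_
      simp [comp_some]
    · intro Δ p
      rw [h0]
      refine pow_ext fun f a => ?_
      simp only [comp_psup, comp_pconst, app_psup, app_pconst, sup_eq_right]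
      refine le_iff_forces.2 fun g e => ?_
      simp only [comp_app, ← Category.assoc] at e ⊢
      exact h _ _ e
    · intro Δ p k
      refine pow_ext fun f a => ?_
      simp only [comp_psup, comp_pconst, app_psup, app_pconst]
      rw [← Category.assoc f, comp_lift, ← Category.assoc f k, h1]
      simp only [app_comp_lam, comp_some]
      refine forces_ext fun g => ⟨fun e => ?_, fun e => ?_⟩
      · simp only [comp_sup] at e ⊢
        refine sup_forces_elim e (fun g' e' => ?_) (fun g' e' => ?_)
        · rw [comp_sup]
          refine sup_forces_left ?_
          rw [← Category.assoc, comp_some] at e'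
          refine some_forces_elim e' fun g'' n e'' => ?_
          rw [← Category.assoc, ← Category.assoc]
          refine comp_some_forces_intro _ _ n ?_
          rw [comp_sup]
          refine sup_forces_left ?_
          simp [← Category.assoc] at e'' ⊢
          exact e''
        · rw [comp_sup]
          exact sup_forces_right e'
      · simp only [comp_sup] at e ⊢
        refine sup_forces_elim e (fun g' e' => ?_) (fun g' e' => ?_)
        · rw [← Category.assoc, comp_some] at e'
          refine some_forces_elim e' fun g'' n e'' => ?_
          simp only [comp_sup] at e''
          refine sup_forces_elim e'' (fun g3 e3 => ?_) (fun g3 e3 => ?_)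
          · rw [comp_sup, comp_sup, comp_sup]
            refine sup_forces_left ?_
            rw [← Category.assoc, ← Category.assoc, ← Category.assoc]
            refine comp_some_forces_intro _ _ (g3 ≫ n) ?_
            simp [← Category.assoc] at e3 ⊢
            exact e3
          · rw [comp_sup, comp_sup, comp_sup]
            refine sup_forces_right ?_
            simpa [← Category.assoc] using e3
        · rw [comp_sup]
          exact sup_forces_right e'
    · intro Δ p k
      refine pow_ext fun f a => ?_
      simp only [comp_psup, comp_pconst, app_psup, app_pconst]
      symm
      rw [sup_eq_right]
      refine le_iff_forces.2 fun g e => ?_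
      rw [app_comp_lam, comp_some, comp_some] at e
      refine some_forces_elim e fun g' n e' => ?_
      simpa [← Category.assoc] using e'
  refine ⟨ex, fun {Γ} θ τ => ⟨fun h => le_iff_forces.2 fun f e => ?_,
    fun h => le_iff_forces.2 fun f e => ?_⟩⟩
  · have e1 := intro' ((f ≫ fst _ _) ≫ lam θ) (f ≫ snd _ _)
        (by rw [app_comp_lam, ← comp_lift]; simpa using e)
    have := comp_mono (f ≫ fst _ _) h
    rw [← Category.assoc, e1] at this
    simpa using this
  · refine elim' (f ≫ lam θ) (f ≫ τ) (fun {Δ'} g l e' => ?_) (by simpa using e)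
    have := comp_mono (lift (g ≫ f) l) h
    rw [app_comp_comp_lam] at e'
    rw [e'] at this
    simpa using this

end Overt

end ListObject

end Induction

section DiscreteLists

variable {S : Type u} [Category.{v} S] [CartesianMonoidalCategory S]

attribute [simp] comp_some

theorem Discrete.eqv_self [SierpinskiCategory S]
    {N Γ : S} (d : Discrete N) (n : Γ ⟶ N) : rel d.eqv n n = ⊤ :=
  (d.eqv_iff n n).1 rfl

namespace ListObject

variable {Γ Δ N P X : S} (L : ListObject N)

/-- Case analysis: two terms with a list variable agree if they do so on `[]` and on `n :: l`. -/
theorem term_ext_cases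
    (t t' : ∀ {Δ : S}, (Δ ⟶ P) → (Δ ⟶ L.List) → (Δ ⟶ X))
    (ht : ∀ {Δ Δ' : S} (g : Δ' ⟶ Δ) (p : Δ ⟶ P) (l : Δ ⟶ L.List),
      g ≫ t p l = t (g ≫ p) (g ≫ l))
    (ht' : ∀ {Δ Δ' : S} (g : Δ' ⟶ Δ) (p : Δ ⟶ P) (l : Δ ⟶ L.List),
      g ≫ t' p l = t' (g ≫ p) (g ≫ l))
    (h0 : ∀ {Δ : S} (p : Δ ⟶ P), t p (L.nl Δ) = t' p (L.nl Δ))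
    (h1 : ∀ {Δ : S} (p : Δ ⟶ P) (n : Δ ⟶ N) (l : Δ ⟶ L.List),
      t p (L.cs n l) = t' p (L.cs n l))
    {Δ : S} (p : Δ ⟶ P) (l : Δ ⟶ L.List) : t p l = t' p l :=
  L.term_ext t t' (fun p n l _ => t p (L.cs n l)) ht ht' (by simp [ht]) h0 (fun _ _ _ => rfl)
    (fun p n l => (h1 p n l).symm) p l

variable [Model S]

/-- The proposition that a list is empty. -/
def isNil (l : Γ ⟶ L.List) : Γ ⟶ (Sig : S) := lift (toUnit Γ) l ≫ L.recur ⊤ ⊥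

@[simp]
theorem comp_isNil (f : Δ ⟶ Γ) (l : Γ ⟶ L.List) : f ≫ L.isNil l = L.isNil (f ≫ l) := by
  simp [isNil, comp_lift_assoc]

@[simp]
theorem isNil_nl : L.isNil (L.nl Γ) = ⊤ := by simp [isNil, recur_nl]

@[simp]
theorem isNil_cs (n : Γ ⟶ N) (l : Γ ⟶ L.List) : L.isNil (L.cs n l) = ⊥ := by
  simp [isNil, recur_cs]

/-- The proposition that `l` is of the form `n' :: l'` with `n = n'` and `φ l'`. -/
def headTail (d : Discrete N) (n : Γ ⟶ N) (φ : Γ ⟶ pow L.List) (l : Γ ⟶ L.List) :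
    Γ ⟶ (Sig : S) :=
  lift (lift n φ) l ≫ L.recur ⊥
    (rel d.eqv (fst _ _ ≫ fst _ _ ≫ fst _ _) (fst _ _ ≫ snd _ _ ≫ fst _ _) ⊓
      app (fst _ _ ≫ fst _ _ ≫ snd _ _) (fst _ _ ≫ snd _ _ ≫ snd _ _))

variable (d : Discrete N)

@[simp]
theorem comp_headTail (f : Δ ⟶ Γ) (n : Γ ⟶ N) (φ : Γ ⟶ pow L.List) (l : Γ ⟶ L.List) :
    f ≫ L.headTail d n φ l = L.headTail d (f ≫ n) (f ≫ φ) (f ≫ l) := by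
  simp [headTail, comp_lift_assoc]

@[simp]
theorem headTail_nl (n : Γ ⟶ N) (φ : Γ ⟶ pow L.List) : L.headTail d n φ (L.nl Γ) = ⊥ := by
  simp [headTail, recur_nl]

@[simp]
theorem headTail_cs (n : Γ ⟶ N) (φ : Γ ⟶ pow L.List) (n' : Γ ⟶ N) (l : Γ ⟶ L.List) :
    L.headTail d n φ (L.cs n' l) = rel d.eqv n n' ⊓ app φ l := by
  simp [headTail, recur_cs]

/-- The equality predicate on lists. -/
def eqList (l l' : Γ ⟶ L.List) : Γ ⟶ (Sig : S) :=
  app (lift (toUnit Γ) l ≫ L.recur (lam (L.isNil (snd _ _)))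
    (lam (L.headTail d (fst _ _ ≫ fst _ _ ≫ snd _ _ ≫ fst _ _) (fst _ _ ≫ snd _ _) (snd _ _)))) l'

@[simp]
theorem comp_eqList (f : Δ ⟶ Γ) (l l' : Γ ⟶ L.List) :
    f ≫ L.eqList d l l' = L.eqList d (f ≫ l) (f ≫ l') := by
  simp [eqList, comp_lift_assoc]

@[simp]
theorem eqList_nl (l : Γ ⟶ L.List) : L.eqList d (L.nl Γ) l = L.isNil l := by
  simp [eqList, recur_nl]

theorem eqList_cs (n : Γ ⟶ N) (l l' : Γ ⟶ L.List) :
    L.eqList d (L.cs n l) l' = L.headTail d n (lam (L.eqList d (fst _ _ ≫ l) (snd _ _))) l' := by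
  simp only [eqList, recur_cs]
  simp only [app_comp_lam, comp_headTail]
  simp only [lift_fst_assoc, lift_snd_assoc, lift_fst, lift_snd]
  congr 1
  refine pow_ext fun f a => ?_
  simp [comp_lift_assoc]

theorem eqList_self (l : Γ ⟶ L.List) : L.eqList d l l = ⊤ := by
  refine L.induction (P := Γ) (fun _ l => L.eqList d l l) (by simp) (by simp)
    (fun _ n l h => ?_) (𝟙 Γ) l
  simp only [eqList_cs, headTail_cs, app_lam_id, comp_eqList, lift_fst_assoc, lift_snd,
    Category.id_comp]
  exact inf_forces (d.eqv_self n) h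

/-- Equal lists have the same properties. Both sides satisfy the same recursion on `l`, as
functions of `l'` and `θ`, because `θ` may be replaced by `λ m. θ (n :: m)`. -/
theorem eqList_subst (l l' : Γ ⟶ L.List) (θ : Γ ⟶ pow L.List) :
    L.eqList d l l' ⊓ app θ l = L.eqList d l l' ⊓ app θ l' := by
  have key := L.term_ext (P := Γ) (X := pow (L.List ⊗ pow L.List))
    (fun _ l => lam (L.eqList d (fst _ _ ≫ l) (snd _ _ ≫ fst _ _) ⊓
      app (snd _ _ ≫ snd _ _) (fst _ _ ≫ l)))
    (fun _ l => lam (L.eqList d (fst _ _ ≫ l) (snd _ _ ≫ fst _ _) ⊓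
      app (snd _ _ ≫ snd _ _) (snd _ _ ≫ fst _ _)))
    (fun _ n _ x => lam (L.headTail d (fst _ _ ≫ n)
      (lam (app (fst _ _ ≫ fst _ _ ≫ x) (lift (snd _ _)
        (lam (app (fst _ _ ≫ fst _ _ ≫ snd _ _ ≫ snd _ _)
          (L.cs (fst _ _ ≫ fst _ _ ≫ fst _ _ ≫ n) (snd _ _)))))))
      (snd _ _ ≫ fst _ _)))
    (by intros; refine pow_ext fun f a => ?_; simp)
    (by intros; refine pow_ext fun f a => ?_; simp)
    (by
      intros; refine pow_ext fun f a => ?_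
      simp only [app_comp_lam, app_comp_comp_lam, comp_headTail,
          lift_fst_assoc, lift_snd_assoc, Category.assoc]
      congr 1
      refine pow_ext fun f a => ?_
      simp
      congr 2
      refine pow_ext fun f a => ?_
      simp [comp_lift_assoc])
    ?_ ?_ ?_ (𝟙 Γ) l
  · have := congrArg (fun φ => app φ (lift l' θ)) key
    simpa using this
  · intro Δ p
    refine pow_ext fun f a => ?_
    have := L.term_ext_cases (P := pow L.List)
      (fun θ l => L.isNil l ⊓ app θ (L.nl _)) (fun θ l => L.isNil l ⊓ app θ l)
      (by simp) (by simp) (by simp) (by simp) (a ≫ snd _ _) (a ≫ fst _ _)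
    simpa using this
  · intro Δ p n l
    refine pow_ext fun {Δ'} f a => ?_
    have := L.term_ext_cases (P := Δ' ⊗ pow L.List)
      (fun q m => L.headTail d (q ≫ fst _ _ ≫ f ≫ n)
        (lam (L.eqList d (fst _ _ ≫ q ≫ fst _ _ ≫ f ≫ l) (snd _ _))) m ⊓
        app (q ≫ snd _ _) (L.cs (q ≫ fst _ _ ≫ f ≫ n) (q ≫ fst _ _ ≫ f ≫ l)))
      (fun q m => L.headTail d (q ≫ fst _ _ ≫ f ≫ n)
        (lam (L.eqList d (fst _ _ ≫ q ≫ fst _ _ ≫ f ≫ l) (snd _ _) ⊓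
          app (fst _ _ ≫ q ≫ snd _ _)
            (L.cs (fst _ _ ≫ q ≫ fst _ _ ≫ f ≫ n) (fst _ _ ≫ q ≫ fst _ _ ≫ f ≫ l)))) m)
      (by
        intros; simp only [comp_headTail, comp_inf, comp_app, comp_cs, Category.assoc]; congr 2
        refine pow_ext fun f a => ?_; simp)
      (by
        intros; simp only [comp_headTail, Category.assoc]; congr 1
        refine pow_ext fun f a => ?_; simp)
      (by simp) (by simp [inf_assoc]) (lift (𝟙 _) (a ≫ snd _ _)) (a ≫ fst _ _)
    simp only [lift_fst_assoc, lift_snd, Category.id_comp] at this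
    simp only [app_comp_lam, comp_inf, comp_app, comp_headTail, lift_fst_assoc, lift_snd_assoc,
      eqList_cs, comp_cs]
    refine (Eq.trans ?_ this).trans ?_
    · congr 2
      refine pow_ext fun f a => ?_
      simp
    · congr 1
      refine pow_ext fun f a => ?_
      simp [comp_lam]
  · intro Δ p n l
    refine pow_ext fun {Δ'} f a => ?_
    have := L.term_ext_cases (P := Δ' ⊗ pow L.List)
      (fun q m => L.headTail d (q ≫ fst _ _ ≫ f ≫ n)
        (lam (L.eqList d (fst _ _ ≫ q ≫ fst _ _ ≫ f ≫ l) (snd _ _))) m ⊓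
        app (q ≫ snd _ _) m)
      (fun q m => L.headTail d (q ≫ fst _ _ ≫ f ≫ n)
        (lam (L.eqList d (fst _ _ ≫ q ≫ fst _ _ ≫ f ≫ l) (snd _ _) ⊓
          app (fst _ _ ≫ q ≫ snd _ _)
            (L.cs (fst _ _ ≫ q ≫ fst _ _ ≫ f ≫ n) (snd _ _)))) m)
      (by
        intros; simp only [comp_headTail, comp_inf, comp_app, Category.assoc]; congr 2
        refine pow_ext fun f a => ?_; simp)
      (by
        intros; simp only [comp_headTail, Category.assoc]; congr 1
        refine pow_ext fun f a => ?_; simp)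
      (by simp) (by
        intro Δ'' q n' m
        simp only [headTail_cs, app_lam_id, comp_eqList, comp_inf, comp_app,
            lift_fst_assoc, lift_snd, Category.id_comp, comp_cs]
        refine forces_ext fun g => ?_
        simp only [comp_inf, inf_forces_iff, comp_rel, ← d.eqv_iff, comp_app, comp_cs]
        constructor
        · rintro ⟨⟨h1, h2⟩, h3⟩
          rw [h1]; exact ⟨rfl, h2, h3⟩
        · rintro ⟨h1, h2, h3⟩
          rw [← h1]; exact ⟨⟨rfl, h2⟩, h3⟩)
      (lift (𝟙 _) (a ≫ snd _ _)) (a ≫ fst _ _)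
    simp only [lift_fst_assoc, lift_snd, Category.id_comp] at this
    simp only [app_comp_lam, comp_inf, comp_app, comp_headTail, lift_fst_assoc, lift_snd_assoc,
      eqList_cs, comp_cs]
    refine (Eq.trans ?_ this).trans ?_
    · congr 2
      refine pow_ext fun f a => ?_
      simp
    · congr 1
      refine pow_ext fun f a => ?_
      simp [comp_lam]

/-- Lists over a discrete object form a discrete object. -/
def discrete : Discrete L.List where
  eqv := L.eqList d (fst _ _) (snd _ _)
  eqv_iff a b := by
    have e : rel (L.eqList d (fst _ _) (snd _ _)) a b = L.eqList d a b := by simp [rel]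
    rw [e]
    refine ⟨fun h => h ▸ L.eqList_self d a, fun h => eq_of_points fun f φ => ?_⟩
    have := L.eqList_subst d (f ≫ a) (f ≫ b) φ
    rw [← comp_eqList, h] at this
    simpa using this

end ListObject

/-- An overt discrete object. -/
structure OvertDiscrete (S : Type u) [Category.{v} S] [CartesianMonoidalCategory S]
    [SierpinskiCategory S] where
  obj : S
  overt : Overt obj
  discrete : Discrete obj

namespace OvertDiscrete

variable [Model S] (A B : OvertDiscrete S) {Γ Δ X : S}

/-- The object of lists over which the Scott principle quantifies. -/
def lst : ListObject A.obj := Model.lists A.overt A.discrete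

/-- Lists over an overt discrete object. -/
noncomputable def list : OvertDiscrete S where
  obj := A.lst.List
  overt := (A.lst.nonempty_overt A.overt).some
  discrete := A.lst.discrete A.discrete

/-- The product of overt discrete objects. -/
def prod : OvertDiscrete S where
  obj := A.obj ⊗ B.obj
  overt :=
    { ex := A.overt.some (B.overt.some
        (app (fst _ _ ≫ fst _ _) (lift (fst _ _ ≫ snd _ _) (snd _ _))))
      adj := fun {Γ} θ τ => by
        simp only [comp_some, comp_app, some_le]
        constructor
        · intro h
          have := comp_mono (lift (lift (fst _ _) (snd _ _ ≫ fst _ _)) (snd _ _ ≫ snd _ _)) h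
          simp [comp_lift_assoc] at this
          simpa [← comp_lift] using this
        · intro h
          have := comp_mono (lift (fst _ _ ≫ fst _ _) (lift (fst _ _ ≫ snd _ _) (snd _ _)) :
            (Γ ⊗ A.obj) ⊗ B.obj ⟶ _) h
          simpa using this }
  discrete :=
    { eqv := rel A.discrete.eqv (fst _ _ ≫ fst _ _) (snd _ _ ≫ fst _ _) ⊓
        rel B.discrete.eqv (fst _ _ ≫ snd _ _) (snd _ _ ≫ snd _ _)
      eqv_iff := fun a b => by
        simp only [rel, comp_inf, comp_lift_assoc, lift_fst_assoc, lift_snd_assoc]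
        rw [inf_forces_iff]
        erw [← A.discrete.eqv_iff, ← B.discrete.eqv_iff]
        exact ⟨fun h => h ▸ ⟨rfl, rfl⟩, fun h => CartesianMonoidalCategory.hom_ext _ _ h.1 h.2⟩ }

end OvertDiscrete

end DiscreteLists

/-! ### Finite quantifiers -/

section Finite

variable {S : Type u} [Category.{v} S] [CartesianMonoidalCategory S]

namespace ListObject

variable {N Γ P X : S} (L : ListObject N)

/-- Recursion over lists in a context `P`, with a step that does not depend on the tail. -/
def fold (z : P ⟶ X) (s : P ⊗ (N ⊗ X) ⟶ X) : P ⊗ L.List ⟶ X :=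
  L.recur z (lift (fst _ _ ≫ fst _ _) (lift (fst _ _ ≫ snd _ _ ≫ fst _ _) (snd _ _)) ≫ s)

theorem fold_cs (z : P ⟶ X) (s : P ⊗ (N ⊗ X) ⟶ X) (p : Γ ⟶ P) (n : Γ ⟶ N)
    (l : Γ ⟶ L.List) : lift p (L.cs n l) ≫ L.fold z s =
      lift p (lift n (lift p l ≫ L.fold z s)) ≫ s := by
  simp [fold, recur_cs, comp_lift_assoc]

variable [SierpinskiCategory S]

theorem mem_nl (d : Discrete N) (n : Γ ⟶ N) : rel (L.mem d) n (L.nl Γ) = ⊥ := by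
  simp [rel, mem, recur_nl]

theorem mem_cs (d : Discrete N) (n m : Γ ⟶ N) (l : Γ ⟶ L.List) :
    rel (L.mem d) n (L.cs m l) = rel d.eqv n m ⊔ rel (L.mem d) n l := by
  simp [rel, mem, recur_cs, comp_lift_assoc]

theorem all_nl (ψ : Γ ⟶ pow N) : rel L.all ψ (L.nl Γ) = ⊤ := by
  simp [rel, all, recur_nl]

theorem all_cs (ψ : Γ ⟶ pow N) (n : Γ ⟶ N) (l : Γ ⟶ L.List) :
    rel L.all ψ (L.cs n l) = app ψ n ⊓ rel L.all ψ l := by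
  simp [rel, all, recur_cs]

end ListObject

variable [Model S]

namespace OvertDiscrete

variable (A : OvertDiscrete S) {Γ Δ P X : S}

/-- The empty list. -/
def nil (Γ : S) : Γ ⟶ A.list.obj := A.lst.nl Γ

variable {A} in
/-- The term `n :: l`. -/
def cons (n : Γ ⟶ A.obj) (l : Γ ⟶ A.list.obj) : Γ ⟶ A.list.obj := A.lst.cs n l

@[simp]
theorem comp_nil (f : Δ ⟶ Γ) : f ≫ A.nil Γ = A.nil Δ := A.lst.comp_nl f

@[simp]
theorem comp_cons (f : Δ ⟶ Γ) (n : Γ ⟶ A.obj) (l : Γ ⟶ A.list.obj) :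
    f ≫ cons n l = cons (f ≫ n) (f ≫ l) := A.lst.comp_cs f n l

theorem term_ext
    (t t' : ∀ {Δ : S}, (Δ ⟶ P) → (Δ ⟶ A.list.obj) → (Δ ⟶ X))
    (s : ∀ {Δ : S}, (Δ ⟶ P) → (Δ ⟶ A.obj) → (Δ ⟶ A.list.obj) → (Δ ⟶ X) → (Δ ⟶ X))
    (ht : ∀ {Δ Δ' : S} (g : Δ' ⟶ Δ) (p : Δ ⟶ P) (l : Δ ⟶ A.list.obj),
      g ≫ t p l = t (g ≫ p) (g ≫ l))
    (ht' : ∀ {Δ Δ' : S} (g : Δ' ⟶ Δ) (p : Δ ⟶ P) (l : Δ ⟶ A.list.obj),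
      g ≫ t' p l = t' (g ≫ p) (g ≫ l))
    (hs : ∀ {Δ Δ' : S} (g : Δ' ⟶ Δ) (p : Δ ⟶ P) (n : Δ ⟶ A.obj) (l : Δ ⟶ A.list.obj)
      (x : Δ ⟶ X), g ≫ s p n l x = s (g ≫ p) (g ≫ n) (g ≫ l) (g ≫ x))
    (h0 : ∀ {Δ : S} (p : Δ ⟶ P), t p (A.nil Δ) = t' p (A.nil Δ))
    (h1 : ∀ {Δ : S} (p : Δ ⟶ P) (n : Δ ⟶ A.obj) (l : Δ ⟶ A.list.obj),
      t p (cons n l) = s p n l (t p l))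
    (h1' : ∀ {Δ : S} (p : Δ ⟶ P) (n : Δ ⟶ A.obj) (l : Δ ⟶ A.list.obj),
      t' p (cons n l) = s p n l (t' p l))
    {Δ : S} (p : Δ ⟶ P) (l : Δ ⟶ A.list.obj) : t p l = t' p l :=
  A.lst.term_ext t t' s ht ht' hs h0 h1 h1' p l

theorem induction
    (t : ∀ {Δ : S}, (Δ ⟶ P) → (Δ ⟶ A.list.obj) → (Δ ⟶ (Sig : S)))
    (ht : ∀ {Δ Δ' : S} (g : Δ' ⟶ Δ) (p : Δ ⟶ P) (l : Δ ⟶ A.list.obj),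
      g ≫ t p l = t (g ≫ p) (g ≫ l))
    (h0 : ∀ {Δ : S} (p : Δ ⟶ P), t p (A.nil Δ) = ⊤)
    (h1 : ∀ {Δ : S} (p : Δ ⟶ P) (n : Δ ⟶ A.obj) (l : Δ ⟶ A.list.obj),
      t p l = ⊤ → t p (cons n l) = ⊤)
    {Δ : S} (p : Δ ⟶ P) (l : Δ ⟶ A.list.obj) : t p l = ⊤ :=
  A.lst.induction t ht h0 h1 p l

theorem induction_of_tail
    (a b : ∀ {Δ : S}, (Δ ⟶ P) → (Δ ⟶ A.list.obj) → (Δ ⟶ (Sig : S)))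
    (ha : ∀ {Δ Δ' : S} (g : Δ' ⟶ Δ) (p : Δ ⟶ P) (l : Δ ⟶ A.list.obj),
      g ≫ a p l = a (g ≫ p) (g ≫ l))
    (hb : ∀ {Δ Δ' : S} (g : Δ' ⟶ Δ) (p : Δ ⟶ P) (l : Δ ⟶ A.list.obj),
      g ≫ b p l = b (g ≫ p) (g ≫ l))
    (h0 : ∀ {Δ : S} (p : Δ ⟶ P), a p (A.nil Δ) = ⊤ → b p (A.nil Δ) = ⊤)
    (tail : ∀ {Δ : S} (p : Δ ⟶ P) (n : Δ ⟶ A.obj) (l : Δ ⟶ A.list.obj),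
      a p (cons n l) = ⊤ → a p l = ⊤)
    (h1 : ∀ {Δ : S} (p : Δ ⟶ P) (n : Δ ⟶ A.obj) (l : Δ ⟶ A.list.obj),
      a p (cons n l) = ⊤ → b p l = ⊤ → b p (cons n l) = ⊤)
    {Δ : S} (p : Δ ⟶ P) (l : Δ ⟶ A.list.obj) (h : a p l = ⊤) : b p l = ⊤ :=
  A.lst.induction_of_tail a b ha hb h0 tail h1 p l h

/-- Recursion over lists in a context `P`, with a step that does not depend on the tail. -/
def fold (z : P ⟶ X) (s : P ⊗ (A.obj ⊗ X) ⟶ X) : P ⊗ A.list.obj ⟶ X := A.lst.fold z s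

theorem fold_nil (z : P ⟶ X) (s : P ⊗ (A.obj ⊗ X) ⟶ X) (p : Γ ⟶ P) :
    lift p (A.nil Γ) ≫ A.fold z s = p ≫ z := A.lst.recur_nl p z _

theorem fold_cons (z : P ⟶ X) (s : P ⊗ (A.obj ⊗ X) ⟶ X) (p : Γ ⟶ P) (n : Γ ⟶ A.obj)
    (l : Γ ⟶ A.list.obj) : lift p (cons n l) ≫ A.fold z s =
      lift p (lift n (lift p l ≫ A.fold z s)) ≫ s := A.lst.fold_cs z s p n l

variable {A}

/-- The proposition `n ∈ l`. -/
def memb (n : Γ ⟶ A.obj) (l : Γ ⟶ A.list.obj) : Γ ⟶ (Sig : S) := rel (A.lst.mem A.discrete) n l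

/-- The proposition `∀ n ∈ l. ψ n`. -/
def all (ψ : Γ ⟶ pow A.obj) (l : Γ ⟶ A.list.obj) : Γ ⟶ (Sig : S) := rel A.lst.all ψ l

/-- The proposition `∃ n ∈ l. ψ n`. -/
noncomputable def any (ψ : Γ ⟶ pow A.obj) (l : Γ ⟶ A.list.obj) : Γ ⟶ (Sig : S) :=
  lift ψ l ≫ A.fold ⊥ (app (fst _ _) (snd _ _ ≫ fst _ _) ⊔ snd _ _ ≫ snd _ _)

/-- The term `λ n. n ∈ l`. -/
noncomputable def mset (l : Γ ⟶ A.list.obj) : Γ ⟶ pow A.obj := lam (memb (snd _ _) (fst _ _ ≫ l))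

/-- The concatenation of two lists. -/
noncomputable def append (l m : Γ ⟶ A.list.obj) : Γ ⟶ A.list.obj :=
  lift m l ≫ A.fold (𝟙 _) (cons (snd _ _ ≫ fst _ _) (snd _ _ ≫ snd _ _))

@[simp]
theorem comp_memb (f : Δ ⟶ Γ) (n : Γ ⟶ A.obj) (l : Γ ⟶ A.list.obj) :
    f ≫ memb n l = memb (f ≫ n) (f ≫ l) := comp_rel _ _ _ _

@[simp]
theorem comp_all (f : Δ ⟶ Γ) (ψ : Γ ⟶ pow A.obj) (l : Γ ⟶ A.list.obj) :
    f ≫ all ψ l = all (f ≫ ψ) (f ≫ l) := comp_rel _ _ _ _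

@[simp]
theorem comp_any (f : Δ ⟶ Γ) (ψ : Γ ⟶ pow A.obj) (l : Γ ⟶ A.list.obj) :
    f ≫ any ψ l = any (f ≫ ψ) (f ≫ l) := comp_rel _ _ _ _

@[simp]
theorem comp_mset (f : Δ ⟶ Γ) (l : Γ ⟶ A.list.obj) : f ≫ mset l = mset (f ≫ l) := by
  simp [mset, comp_lam]

@[simp]
theorem app_mset (l : Γ ⟶ A.list.obj) (n : Γ ⟶ A.obj) : app (mset l) n = memb n l := by
  simp [mset]

@[simp]
theorem comp_append (f : Δ ⟶ Γ) (l m : Γ ⟶ A.list.obj) :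
    f ≫ append l m = append (f ≫ l) (f ≫ m) := by
  simp [append, comp_lift_assoc]

@[simp]
theorem memb_nil (n : Γ ⟶ A.obj) : memb n (A.nil Γ) = ⊥ := A.lst.mem_nl _ n

@[simp]
theorem memb_cons (n m : Γ ⟶ A.obj) (l : Γ ⟶ A.list.obj) :
    memb n (cons m l) = rel A.discrete.eqv n m ⊔ memb n l := A.lst.mem_cs _ n m l

@[simp]
theorem all_nil (ψ : Γ ⟶ pow A.obj) : all ψ (A.nil Γ) = ⊤ := A.lst.all_nl ψ

@[simp]
theorem all_cons (ψ : Γ ⟶ pow A.obj) (n : Γ ⟶ A.obj) (l : Γ ⟶ A.list.obj) :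
    all ψ (cons n l) = app ψ n ⊓ all ψ l := A.lst.all_cs ψ n l

@[simp]
theorem any_nil (ψ : Γ ⟶ pow A.obj) : any ψ (A.nil Γ) = ⊥ := by
  simp [any, fold_nil]

@[simp]
theorem any_cons (ψ : Γ ⟶ pow A.obj) (n : Γ ⟶ A.obj) (l : Γ ⟶ A.list.obj) :
    any ψ (cons n l) = app ψ n ⊔ any ψ l := by
  simp [any, fold_cons]

@[simp]
theorem append_nil (m : Γ ⟶ A.list.obj) : append (A.nil Γ) m = m := by
  simp [append, fold_nil]

@[simp]
theorem append_cons (n : Γ ⟶ A.obj) (l m : Γ ⟶ A.list.obj) :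
    append (cons n l) m = cons n (append l m) := by
  simp [append, fold_cons]

theorem all_append (ψ : Γ ⟶ pow A.obj) (l m : Γ ⟶ A.list.obj) :
    all ψ (append l m) = all ψ l ⊓ all ψ m := by
  have := A.term_ext (P := Γ) (fun f l => all (f ≫ ψ) (append l (f ≫ m)))
    (fun f l => all (f ≫ ψ) l ⊓ all (f ≫ ψ) (f ≫ m)) (fun f n _ x => app (f ≫ ψ) n ⊓ x)
    (by simp) (by simp) (by simp) (by simp) (by simp) (by simp [inf_assoc]) (𝟙 Γ) l
  simpa using this

theorem any_append (ψ : Γ ⟶ pow A.obj) (l m : Γ ⟶ A.list.obj) :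
    any ψ (append l m) = any ψ l ⊔ any ψ m := by
  have := A.term_ext (P := Γ) (fun f l => any (f ≫ ψ) (append l (f ≫ m)))
    (fun f l => any (f ≫ ψ) l ⊔ any (f ≫ ψ) (f ≫ m)) (fun f n _ x => app (f ≫ ψ) n ⊔ x)
    (by simp) (by simp) (by simp) (by simp) (by simp) (by simp [sup_assoc]) (𝟙 Γ) l
  simpa using this

theorem any_eq_some (ψ : Γ ⟶ pow A.obj) (l : Γ ⟶ A.list.obj) :
    any ψ l = A.overt.some (memb (snd _ _) (fst _ _ ≫ l) ⊓ app (fst _ _ ≫ ψ) (snd _ _)) := by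
  have := A.term_ext (P := Γ) (fun f l => any (f ≫ ψ) l)
    (fun f l => A.overt.some (memb (snd _ _) (fst _ _ ≫ l) ⊓ app (fst _ _ ≫ f ≫ ψ) (snd _ _)))
    (fun f m _ x => app (f ≫ ψ) m ⊔ x)
    (by simp) (by simp) (by simp) ?_ (by simp) ?_ (𝟙 Γ) l
  · simpa using this
  · intro Δ p
    simp only [any_nil]
    symm
    rw [eq_bot_iff, some_le]
    simp
  · intro Δ p n l
    refine forces_ext fun f => ⟨fun e => ?_, fun e => ?_⟩
    · rw [comp_some] at e
      refine some_forces_elim e fun g m e => ?_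
      simp at e
      refine sup_forces_elim e.1 (fun g' e' => ?_) (fun g' e' => ?_)
      · simp only [comp_rel, ← A.discrete.eqv_iff] at e'
        simp only [comp_sup]
        refine sup_forces_left ?_
        have := forces_comp g' e.2
        simp only [comp_app] at this ⊢
        rwa [e'] at this
      · simp only [comp_sup]
        refine sup_forces_right ?_
        simp only [← Category.assoc]
        refine comp_some_forces_intro _ _ (g' ≫ m) ?_
        have := forces_comp g' e.2
        simp at this e' ⊢
        exact ⟨e', this⟩
    · simp only [comp_sup] at e
      refine sup_forces_elim e (fun g e' => ?_) (fun g e' => ?_)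
      · rw [← Category.assoc]
        refine comp_some_forces_intro _ _ (g ≫ f ≫ n) ?_
        simp at e' ⊢
        exact ⟨sup_forces_left (A.discrete.eqv_self _), e'⟩
      · rw [← Category.assoc] at e' ⊢
        rw [comp_some] at e'
        refine some_forces_elim e' fun g' m e => ?_
        rw [← Category.assoc]
        refine comp_some_forces_intro _ _ m ?_
        simp at e ⊢
        exact ⟨sup_forces_right e.1, e.2⟩

theorem any_intro {ψ : Γ ⟶ pow A.obj} {l : Γ ⟶ A.list.obj} (n : Γ ⟶ A.obj)
    (h : memb n l = ⊤) (h' : app ψ n = ⊤) : any ψ l = ⊤ := by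
  rw [any_eq_some]
  refine some_forces_intro _ n ?_
  simp [h, h']

theorem any_elim {ψ : Γ ⟶ pow A.obj} {l : Γ ⟶ A.list.obj} {τ : Γ ⟶ (Sig : S)}
    (h : any ψ l = ⊤)
    (k : ∀ {Δ : S} (f : Δ ⟶ Γ) (n : Δ ⟶ A.obj), memb n (f ≫ l) = ⊤ → app (f ≫ ψ) n = ⊤ →
      f ≫ τ = ⊤) : τ = ⊤ := by
  rw [any_eq_some] at h
  refine some_forces_elim h fun f n e => ?_
  simp at e
  exact k f n e.1 e.2

theorem memb_cons_self (n : Γ ⟶ A.obj) (l : Γ ⟶ A.list.obj) : memb n (cons n l) = ⊤ := by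
  rw [memb_cons]
  exact sup_forces_left (A.discrete.eqv_self n)

theorem all_elim {ψ : Γ ⟶ pow A.obj} {l : Γ ⟶ A.list.obj} (h : all ψ l = ⊤)
    {n : Γ ⟶ A.obj} (hn : memb n l = ⊤) : app ψ n = ⊤ := by
  have := A.term_ext (P := Γ)
    (fun f l => (all (f ≫ ψ) l ⊓ memb (f ≫ n) l) ⊔ app (f ≫ ψ) (f ≫ n))
    (fun f l => app (f ≫ ψ) (f ≫ n)) (fun f m _ x => app (f ≫ ψ) m ⊓ x ⊔ app (f ≫ ψ) (f ≫ n))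
    (by simp) (by simp) (by simp) (by simp) ?_ (by simp) (𝟙 Γ) l
  · simpa [h, hn] using this.symm
  · intro Δ p m l
    refine forces_ext fun f => ⟨fun e => ?_, fun e => ?_⟩
    · simp at e ⊢
      refine sup_forces_elim e (fun g e => ?_) (fun g e => ?_)
      · simp at e ⊢
        obtain ⟨⟨h1, h2⟩, h3⟩ := e
        refine sup_forces_elim h3 (fun g e => ?_) (fun g e => ?_)
        · simp only [comp_rel, ← A.discrete.eqv_iff] at e
          simp only [comp_sup, comp_app]
          refine sup_forces_right ?_
          have := forces_comp g h1
          simp only [comp_app] at this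
          rwa [← e] at this
        · have h1 := forces_comp g h1
          have h2 := forces_comp g h2
          simp at h1 h2 e ⊢
          simp [h1, h2, e]
      · simp at e ⊢
        simp [e]
    · simp at e ⊢
      refine sup_forces_elim e (fun g e => ?_) (fun g e => ?_)
      · simp at e ⊢
        refine sup_forces_elim e.2 (fun g h => ?_) (fun g h => ?_)
        · have h1 := forces_comp g e.1
          simp at h h1 ⊢
          simp [h, h1]
        · simp at h ⊢
          simp [h]
      · simp at e ⊢
        simp [e]

theorem all_mono {ψ φ : Γ ⟶ pow A.obj} {l : Γ ⟶ A.list.obj} (h : all ψ l = ⊤)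
    (k : ∀ {Δ : S} (f : Δ ⟶ Γ) (n : Δ ⟶ A.obj), app (f ≫ ψ) n = ⊤ → app (f ≫ φ) n = ⊤) :
    all φ l = ⊤ := by
  refine A.induction_of_tail (P := Γ) (fun f l => all (f ≫ ψ) l) (fun f l => all (f ≫ φ) l)
    (by simp) (by simp) (by simp) (fun f n l e => ?_) (fun f n l e e' => ?_) (𝟙 Γ) l
    (by simpa using h) |> fun h => by simpa using h
  · simp at e; exact e.2
  · simp at e ⊢; exact ⟨k _ _ e.1, e'⟩

theorem all_mset (l : Γ ⟶ A.list.obj) : all (mset l) l = ⊤ := by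
  refine A.induction (P := Γ) (fun _ l => all (mset l) l) (by simp) (by simp)
    (fun _ n l h => ?_) (𝟙 Γ) l
  simp only [all_cons, app_mset, memb_cons_self, top_inf_eq]
  refine all_mono h fun f m e => ?_
  simp at e ⊢
  exact sup_forces_right e

theorem all_intro {ψ : Γ ⟶ pow A.obj} {l : Γ ⟶ A.list.obj}
    (k : ∀ {Δ : S} (f : Δ ⟶ Γ) (n : Δ ⟶ A.obj), memb n (f ≫ l) = ⊤ → app (f ≫ ψ) n = ⊤) :
    all ψ l = ⊤ :=
  all_mono (all_mset l) fun f n e => k f n (by simpa using e)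

theorem all_pinf (ψ φ : Γ ⟶ pow A.obj) (l : Γ ⟶ A.list.obj) :
    all (pinf ψ φ) l = all ψ l ⊓ all φ l := by
  have := A.term_ext (P := Γ) (fun f l => all (f ≫ pinf ψ φ) l)
    (fun f l => all (f ≫ ψ) l ⊓ all (f ≫ φ) l) (fun f n _ x => app (f ≫ pinf ψ φ) n ⊓ x)
    (by simp) (by simp) (by simp) (by simp) (by simp) ?_ (𝟙 Γ) l
  · simpa using this
  · intro Δ p n l
    simp only [all_cons, comp_pinf, app_pinf]
    ac_rfl

/-- The Scott principle, as an elimination rule. -/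
theorem scott_elim {Φ : Γ ⟶ pow (pow A.obj)} {ξ : Γ ⟶ pow A.obj} {τ : Γ ⟶ (Sig : S)}
    (h : app Φ ξ = ⊤)
    (k : ∀ {Δ : S} (f : Δ ⟶ Γ) (l : Δ ⟶ A.list.obj), app (f ≫ Φ) (mset l) = ⊤ →
      all (f ≫ ξ) l = ⊤ → f ≫ τ = ⊤) : τ = ⊤ := by
  refine isExists_elim (Model.scott A.overt A.discrete Φ ξ) h fun f l e => ?_
  rw [comp_inf, inf_forces_iff] at e
  refine k f l ?_ ?_
  · have := e.1
    rw [comp_app, lift_fst_assoc] at this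
    rw [← this]
    congr 1
    refine pow_ext fun g a => ?_
    rw [app_comp_comp_lam, comp_rel, lift_snd, lift_fst_assoc, Category.assoc, lift_snd]
    exact (congrArg (app · a) (comp_mset (A := A) g l)).trans (app_mset _ _)
  · have := e.2
    rw [comp_rel, lift_fst_assoc, lift_snd] at this
    exact this

theorem scott_intro {Φ : Γ ⟶ pow (pow A.obj)} {ξ : Γ ⟶ pow A.obj} (l : Γ ⟶ A.list.obj)
    (h : app Φ (mset l) = ⊤) (h' : all ξ l = ⊤) : app Φ ξ = ⊤ :=
  app_mono h fun f n e => all_elim (l := f ≫ l) (by simpa using forces_comp f h') (by simpa using e)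

end OvertDiscrete

end Finite

/-! ### The free distributive lattice on an overt discrete object -/

section FreeLattice

variable {S : Type u} [Category.{v} S] [CartesianMonoidalCategory S] [Model S]

namespace OvertDiscrete

variable {A : OvertDiscrete S} {Γ Δ P X : S}

/-- Induction along a membership `n ∈ l`. -/
theorem induction_memb
    (t : ∀ {Δ : S}, (Δ ⟶ P) → (Δ ⟶ A.obj) → (Δ ⟶ A.list.obj) → (Δ ⟶ (Sig : S)))
    (ht : ∀ {Δ Δ' : S} (g : Δ' ⟶ Δ) (p : Δ ⟶ P) (n : Δ ⟶ A.obj) (l : Δ ⟶ A.list.obj),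
      g ≫ t p n l = t (g ≫ p) (g ≫ n) (g ≫ l))
    (h0 : ∀ {Δ : S} (p : Δ ⟶ P) (n : Δ ⟶ A.obj) (l : Δ ⟶ A.list.obj), t p n (cons n l) = ⊤)
    (h1 : ∀ {Δ : S} (p : Δ ⟶ P) (n m : Δ ⟶ A.obj) (l : Δ ⟶ A.list.obj),
      t p n l = ⊤ → t p n (cons m l) = ⊤)
    {Δ : S} (p : Δ ⟶ P) (n : Δ ⟶ A.obj) (l : Δ ⟶ A.list.obj) (h : memb n l = ⊤) :
    t p n l = ⊤ := by
  have := A.term_ext (P := P ⊗ A.obj)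
    (fun q l => memb (q ≫ snd _ _) l ⊔ t (q ≫ fst _ _) (q ≫ snd _ _) l)
    (fun q l => t (q ≫ fst _ _) (q ≫ snd _ _) l)
    (fun q m l x => x ⊔ t (q ≫ fst _ _) (q ≫ snd _ _) (cons m l))
    (by simp [ht]) (by simp [ht]) (by simp [ht]) (by simp) ?_ ?_ (lift p n) l
  · simpa [h] using this.symm
  · intro Δ q m l
    refine le_antisymm (sup_le ?_ le_sup_right) (sup_le (sup_le ?_ ?_) le_sup_right)
    · rw [memb_cons]
      refine sup_le (le_iff_forces.2 fun f e => ?_) (le_sup_of_le_left le_sup_left)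
      simp only [comp_rel, ← A.discrete.eqv_iff] at e
      simp only [comp_sup, ht, comp_cons]
      rw [← e]
      exact sup_forces_right (h0 _ _ _)
    · rw [memb_cons]
      exact le_sup_of_le_left le_sup_right
    · refine le_iff_forces.2 fun f e => ?_
      simp only [comp_sup, ht, comp_cons] at e ⊢
      exact sup_forces_right (h1 _ _ _ _ e)
  · intro Δ q m l
    symm
    rw [sup_eq_right]
    refine le_iff_forces.2 fun f e => ?_
    simp only [ht, comp_cons] at e ⊢
    exact h1 _ _ _ _ e

/-- The term `λ l. ∀ n ∈ l. ξ n`. -/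
noncomputable def allOf (ξ : Γ ⟶ pow A.obj) : Γ ⟶ pow A.list.obj :=
  lam (all (fst _ _ ≫ ξ) (snd _ _))

@[simp]
theorem comp_allOf (f : Δ ⟶ Γ) (ξ : Γ ⟶ pow A.obj) : f ≫ allOf ξ = allOf (f ≫ ξ) := by
  simp [allOf, comp_lam]

@[simp]
theorem app_allOf (ξ : Γ ⟶ pow A.obj) (l : Γ ⟶ A.list.obj) : app (allOf ξ) l = all ξ l := by
  simp [allOf]

/-- The proposition `∃ l ∈ L. ∀ n ∈ l. ξ n`: the value at `ξ` of the lattice polynomial that the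
list of lists `L` denotes. -/
noncomputable def anyAll (ξ : Γ ⟶ pow A.obj) (L : Γ ⟶ A.list.list.obj) : Γ ⟶ (Sig : S) :=
  any (allOf ξ) L

@[simp]
theorem comp_anyAll (f : Δ ⟶ Γ) (ξ : Γ ⟶ pow A.obj) (L : Γ ⟶ A.list.list.obj) :
    f ≫ anyAll ξ L = anyAll (f ≫ ξ) (f ≫ L) := by
  simp [anyAll]

/-- The term `λ ξ. ∃ l ∈ L. ∀ n ∈ l. ξ n`. -/
noncomputable def anyAllOf (L : Γ ⟶ A.list.list.obj) : Γ ⟶ pow (pow A.obj) :=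
  lam (anyAll (snd _ _) (fst _ _ ≫ L))

@[simp]
theorem comp_anyAllOf (f : Δ ⟶ Γ) (L : Γ ⟶ A.list.list.obj) :
    f ≫ anyAllOf L = anyAllOf (f ≫ L) := by
  simp [anyAllOf, comp_lam]

@[simp]
theorem comp_anyAllOf_assoc (f : Δ ⟶ Γ) (L : Γ ⟶ A.list.list.obj) (h : pow (pow A.obj) ⟶ X) :
    f ≫ anyAllOf L ≫ h = anyAllOf (f ≫ L) ≫ h := by
  rw [← Category.assoc, comp_anyAllOf]

@[simp]
theorem app_anyAllOf (L : Γ ⟶ A.list.list.obj) (ξ : Γ ⟶ pow A.obj) :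
    app (anyAllOf L) ξ = anyAll ξ L := by
  simp [anyAllOf]

/-- The term `λ l. Φ (λ n. n ∈ l)`. -/
noncomputable def onLists (Φ : Γ ⟶ pow (pow A.obj)) : Γ ⟶ pow A.list.obj :=
  lam (app (fst _ _ ≫ Φ) (mset (snd _ _)))

@[simp]
theorem comp_onLists (f : Δ ⟶ Γ) (Φ : Γ ⟶ pow (pow A.obj)) :
    f ≫ onLists Φ = onLists (f ≫ Φ) := by
  simp [onLists, comp_lam]

@[simp]
theorem app_onLists (Φ : Γ ⟶ pow (pow A.obj)) (l : Γ ⟶ A.list.obj) :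
    app (onLists Φ) l = app Φ (mset l) := by
  simp [onLists]

/-- The proposition `∀ l ∈ L. Φ (λ n. n ∈ l)`. -/
noncomputable def allOn (Φ : Γ ⟶ pow (pow A.obj)) (L : Γ ⟶ A.list.list.obj) : Γ ⟶ (Sig : S) :=
  all (onLists Φ) L

@[simp]
theorem comp_allOn (f : Δ ⟶ Γ) (Φ : Γ ⟶ pow (pow A.obj)) (L : Γ ⟶ A.list.list.obj) :
    f ≫ allOn Φ L = allOn (f ≫ Φ) (f ≫ L) := by
  simp [allOn]

/-- The list of all `l ++ m` for `m ∈ M`. -/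
noncomputable def mapAppend (l : Γ ⟶ A.list.obj) (M : Γ ⟶ A.list.list.obj) :
    Γ ⟶ A.list.list.obj :=
  lift l M ≫ A.list.fold (A.list.nil _)
    (cons (append (fst _ _) (snd _ _ ≫ fst _ _)) (snd _ _ ≫ snd _ _))

@[simp]
theorem comp_mapAppend (f : Δ ⟶ Γ) (l : Γ ⟶ A.list.obj) (M : Γ ⟶ A.list.list.obj) :
    f ≫ mapAppend l M = mapAppend (f ≫ l) (f ≫ M) := by
  simp [mapAppend, comp_lift_assoc]

@[simp]
theorem mapAppend_nil (l : Γ ⟶ A.list.obj) : mapAppend l (A.list.nil Γ) = A.list.nil Γ := by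
  simp [mapAppend, fold_nil]

@[simp]
theorem mapAppend_cons (l m : Γ ⟶ A.list.obj) (M : Γ ⟶ A.list.list.obj) :
    mapAppend l (cons m M) = cons (append l m) (mapAppend l M) := by
  simp [mapAppend, fold_cons]

/-- The list of all `l ++ m` for `l ∈ L` and `m ∈ M`. -/
noncomputable def star (L M : Γ ⟶ A.list.list.obj) : Γ ⟶ A.list.list.obj :=
  lift M L ≫ A.list.fold (A.list.nil _)
    (append (mapAppend (snd _ _ ≫ fst _ _) (fst _ _)) (snd _ _ ≫ snd _ _))

@[simp]
theorem comp_fstar (f : Δ ⟶ Γ) (L M : Γ ⟶ A.list.list.obj) :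
    f ≫ star L M = star (f ≫ L) (f ≫ M) := by
  simp [star, comp_lift_assoc]

@[simp]
theorem star_nil (M : Γ ⟶ A.list.list.obj) : star (A.list.nil Γ) M = A.list.nil Γ := by
  simp [star, fold_nil]

@[simp]
theorem star_cons (l : Γ ⟶ A.list.obj) (L M : Γ ⟶ A.list.list.obj) :
    star (cons l L) M = append (mapAppend l M) (star L M) := by
  simp [star, fold_cons]

variable (A) in
/-- The list `[[]]`, which denotes the empty meet. -/
noncomputable def unit (Γ : S) : Γ ⟶ A.list.list.obj := cons (A.nil Γ) (A.list.nil Γ)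

@[simp]
theorem comp_unit (f : Δ ⟶ Γ) : f ≫ A.unit Γ = A.unit Δ := by
  simp [unit]

@[simp]
theorem anyAll_nil (ξ : Γ ⟶ pow A.obj) : anyAll ξ (A.list.nil Γ) = ⊥ := any_nil _

@[simp]
theorem anyAll_cons (ξ : Γ ⟶ pow A.obj) (l : Γ ⟶ A.list.obj) (L : Γ ⟶ A.list.list.obj) :
    anyAll ξ (cons l L) = all ξ l ⊔ anyAll ξ L := by
  simp [anyAll]

@[simp]
theorem anyAll_unit (ξ : Γ ⟶ pow A.obj) : anyAll ξ (A.unit Γ) = ⊤ := by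
  simp [unit]

@[simp]
theorem anyAll_append (ξ : Γ ⟶ pow A.obj) (L M : Γ ⟶ A.list.list.obj) :
    anyAll ξ (append L M) = anyAll ξ L ⊔ anyAll ξ M := any_append _ _ _

theorem anyAll_mapAppend (ξ : Γ ⟶ pow A.obj) (l : Γ ⟶ A.list.obj) (M : Γ ⟶ A.list.list.obj) :
    anyAll ξ (mapAppend l M) = all ξ l ⊓ anyAll ξ M := by
  have := A.list.term_ext (P := Γ) (fun f M => anyAll (f ≫ ξ) (mapAppend (f ≫ l) M))
    (fun f M => all (f ≫ ξ) (f ≫ l) ⊓ anyAll (f ≫ ξ) M)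
    (fun f m _ x => (all (f ≫ ξ) (f ≫ l) ⊓ all (f ≫ ξ) m) ⊔ x)
    (by simp) (by simp) (by simp) (by simp) (by simp [all_append]) (by simp [inf_sup_left]) (𝟙 Γ) M
  simpa using this

@[simp]
theorem anyAll_star (ξ : Γ ⟶ pow A.obj) (L M : Γ ⟶ A.list.list.obj) :
    anyAll ξ (star L M) = anyAll ξ L ⊓ anyAll ξ M := by
  have := A.list.term_ext (P := Γ) (fun f L => anyAll (f ≫ ξ) (star L (f ≫ M)))
    (fun f L => anyAll (f ≫ ξ) L ⊓ anyAll (f ≫ ξ) (f ≫ M))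
    (fun f l _ x => (all (f ≫ ξ) l ⊓ anyAll (f ≫ ξ) (f ≫ M)) ⊔ x)
    (by simp) (by simp) (by simp) (by simp) (by simp [anyAll_mapAppend])
    (by simp [inf_sup_right]) (𝟙 Γ) L
  simpa using this

@[simp]
theorem allOn_nil (Φ : Γ ⟶ pow (pow A.obj)) : allOn Φ (A.list.nil Γ) = ⊤ := all_nil _

@[simp]
theorem allOn_cons (Φ : Γ ⟶ pow (pow A.obj)) (l : Γ ⟶ A.list.obj) (L : Γ ⟶ A.list.list.obj) :
    allOn Φ (cons l L) = app Φ (mset l) ⊓ allOn Φ L := by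
  simp [allOn]

@[simp]
theorem allOn_append (Φ : Γ ⟶ pow (pow A.obj)) (L M : Γ ⟶ A.list.list.obj) :
    allOn Φ (append L M) = allOn Φ L ⊓ allOn Φ M := all_append _ _ _

theorem allOn_pinf (Φ Ψ : Γ ⟶ pow (pow A.obj)) (L : Γ ⟶ A.list.list.obj) :
    allOn (pinf Φ Ψ) L = allOn Φ L ⊓ allOn Ψ L := by
  rw [allOn, allOn, allOn, ← all_pinf]
  congr 1
  exact pow_ext fun f l => by simp

theorem allOn_intro {Φ : Γ ⟶ pow (pow A.obj)} {L : Γ ⟶ A.list.list.obj}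
    (k : ∀ {Δ : S} (f : Δ ⟶ Γ) (l : Δ ⟶ A.list.obj), memb l (f ≫ L) = ⊤ →
      app (f ≫ Φ) (mset l) = ⊤) : allOn Φ L = ⊤ :=
  all_intro fun f l e => by simpa using k f l e

theorem allOn_elim {Φ : Γ ⟶ pow (pow A.obj)} {L : Γ ⟶ A.list.list.obj} (h : allOn Φ L = ⊤)
    {l : Γ ⟶ A.list.obj} (hl : memb l L = ⊤) : app Φ (mset l) = ⊤ := by
  simpa using all_elim h hl

theorem allOn_mono {Φ Ψ : Γ ⟶ pow (pow A.obj)} {L : Γ ⟶ A.list.list.obj} (h : allOn Φ L = ⊤)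
    (k : ∀ {Δ : S} (f : Δ ⟶ Γ) (ξ : Δ ⟶ pow A.obj), app (f ≫ Φ) ξ = ⊤ → app (f ≫ Ψ) ξ = ⊤) :
    allOn Ψ L = ⊤ :=
  allOn_intro fun f l e => k f _ (allOn_elim (by simpa using forces_comp f h) e)

/-- If `Φ` holds at every member of `L`, then it holds wherever the polynomial `L` does. -/
theorem allOn_cut {Φ : Γ ⟶ pow (pow A.obj)} {L : Γ ⟶ A.list.list.obj} {ξ : Γ ⟶ pow A.obj}
    (h : allOn Φ L = ⊤) (h' : anyAll ξ L = ⊤) : app Φ ξ = ⊤ := by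
  refine any_elim h' fun f l e e' => ?_
  have h1 := allOn_elim (by simpa using forces_comp f h) e
  rw [comp_app]
  exact scott_intro l h1 (by simpa using e')

theorem allOn_self (L : Γ ⟶ A.list.list.obj) : allOn (anyAllOf L) L = ⊤ := by
  refine allOn_intro fun f l e => ?_
  simp only [comp_anyAllOf, app_anyAllOf]
  exact any_intro l e (by simp [all_mset])

theorem allOn_trans {Φ : Γ ⟶ pow (pow A.obj)} {L M : Γ ⟶ A.list.list.obj}
    (h : allOn (anyAllOf L) M = ⊤) (h' : allOn Φ L = ⊤) : allOn Φ M = ⊤ :=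
  allOn_mono h fun f ξ e => allOn_cut (L := f ≫ L) (by simpa using forces_comp f h')
    (by simpa using e)

theorem star_singleton (n : Γ ⟶ A.obj) (l : Γ ⟶ A.list.obj) :
    star (cons (cons n (A.nil Γ)) (A.list.nil Γ)) (cons l (A.list.nil Γ)) =
      cons (cons n l) (A.list.nil Γ) := by
  simp

variable (A) in
/-- The order of the free distributive lattice: `L ≼ M` if each member of `L` contains one of
`M`. -/
noncomputable def freeLe : A.list.list.obj ⊗ A.list.list.obj ⟶ (Sig : S) :=
  allOn (anyAllOf (snd _ _)) (fst _ _)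

@[simp]
theorem rel_freeLe (L M : Γ ⟶ A.list.list.obj) : rel A.freeLe L M = allOn (anyAllOf M) L := by
  simp [rel, freeLe]

/-- Any relation satisfying the rules contains the order of the free distributive lattice. -/
theorem rules_of_freeLe {R : Γ ⊗ (A.list.list.obj ⊗ A.list.list.obj) ⟶ (Sig : S)}
    (hR : OrderRules (A.list.nil _) (A.unit _) (append (fst _ _) (snd _ _))
      (star (fst _ _) (snd _ _)) R) (p : Δ ⟶ Γ) (L M : Δ ⟶ A.list.list.obj)
    (h : allOn (anyAllOf M) L = ⊤) : rel R p (lift L M) = ⊤ := by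
  have refl : ∀ {Δ : S} (p : Δ ⟶ Γ) (L : Δ ⟶ A.list.list.obj), rel R p (lift L L) = ⊤ :=
    fun p L => hR.refl p L
  have le_one : ∀ {Δ : S} (p : Δ ⟶ Γ) (L : Δ ⟶ A.list.list.obj),
      rel R p (lift L (A.unit _)) = ⊤ := fun p L => by simpa using hR.le_one p L
  have zero_le : ∀ {Δ : S} (p : Δ ⟶ Γ) (L : Δ ⟶ A.list.list.obj),
      rel R p (lift (A.list.nil _) L) = ⊤ := fun p L => by simpa using hR.zero_le p L
  have trans : ∀ {Δ : S} (p : Δ ⟶ Γ) {K L M : Δ ⟶ A.list.list.obj}, rel R p (lift K L) = ⊤ →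
      rel R p (lift L M) = ⊤ → rel R p (lift K M) = ⊤ := fun p K L M h h' => by
    have := hR.trans p K L M
    rw [h, h', top_inf_eq] at this
    exact top_le_iff.1 this
  have le_star : ∀ {Δ : S} (p : Δ ⟶ Γ) (K L M : Δ ⟶ A.list.list.obj),
      rel R p (lift K (star L M)) = rel R p (lift K L) ⊓ rel R p (lift K M) :=
    fun p K L M => by rw [hR.le_mul]; simp
  have append_le : ∀ {Δ : S} (p : Δ ⟶ Γ) (L M K : Δ ⟶ A.list.list.obj),
      rel R p (lift (append L M) K) = rel R p (lift L K) ⊓ rel R p (lift M K) :=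
    fun p L M K => by rw [hR.add_le]; simp
  have star_le : ∀ {Δ : S} (p : Δ ⟶ Γ) (L M : Δ ⟶ A.list.list.obj),
      rel R p (lift (star L M) L) = ⊤ ∧ rel R p (lift (star L M) M) = ⊤ := fun p L M => by
    rw [← inf_forces_iff, ← le_star]; exact refl p _
  have le_append : ∀ {Δ : S} (p : Δ ⟶ Γ) (L M : Δ ⟶ A.list.list.obj),
      rel R p (lift L (append L M)) = ⊤ ∧ rel R p (lift M (append L M)) = ⊤ := fun p L M => by
    rw [← inf_forces_iff, ← append_le]; exact refl p _
  -- A list is below `M` if each of its members is.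
  have left : ∀ {Δ : S} (p : Δ ⟶ Γ) (L M : Δ ⟶ A.list.list.obj), rel R p (lift L M) =
      all (lam (rel R (fst _ _ ≫ p) (lift (cons (snd _ _) (A.list.nil _)) (fst _ _ ≫ M)))) L := by
    intro Δ p L M
    have := A.list.term_ext (P := Δ) (fun f L => rel R (f ≫ p) (lift L (f ≫ M)))
      (fun f L => all (lam (rel R (fst _ _ ≫ f ≫ p)
        (lift (cons (snd _ _) (A.list.nil _)) (fst _ _ ≫ f ≫ M)))) L)
      (fun f l _ x => rel R (f ≫ p) (lift (cons l (A.list.nil _)) (f ≫ M)) ⊓ x)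
      (by simp) (by simp [comp_lam]) (by simp) (fun f => by simp [zero_le]) (fun f l L => ?_)
      (by simp) (𝟙 Δ) L
    · simpa using this
    · rw [← append_le]; simp
  -- A meet is above `L` if each of its factors is.
  have right : ∀ {Δ : S} (p : Δ ⟶ Γ) (L : Δ ⟶ A.list.list.obj) (m : Δ ⟶ A.list.obj),
      rel R p (lift L (cons m (A.list.nil _))) =
      all (lam (rel R (fst _ _ ≫ p) (lift (fst _ _ ≫ L)
        (cons (cons (snd _ _) (A.nil _)) (A.list.nil _))))) m := by
    intro Δ p L m
    have := A.term_ext (P := Δ) (fun f m => rel R (f ≫ p) (lift (f ≫ L) (cons m (A.list.nil _))))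
      (fun f m => all (lam (rel R (fst _ _ ≫ f ≫ p) (lift (fst _ _ ≫ f ≫ L)
        (cons (cons (snd _ _) (A.nil _)) (A.list.nil _))))) m)
      (fun f n _ x => rel R (f ≫ p) (lift (f ≫ L)
        (cons (cons n (A.nil _)) (A.list.nil _))) ⊓ x)
      (by simp) (by simp [comp_lam]) (by simp)
      (fun f => by simpa [unit] using le_one _ _) (fun f n m => ?_)
      (by simp) (𝟙 Δ) m
    · simpa using this
    · rw [← star_singleton, le_star]
  have memb_right : ∀ {Δ : S} (p : Δ ⟶ Γ) (l : Δ ⟶ A.list.obj) (M : Δ ⟶ A.list.list.obj),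
      memb l M = ⊤ → rel R p (lift (cons l (A.list.nil _)) M) = ⊤ := by
    intro Δ p l M hl
    refine A.list.induction_memb (P := Γ) (fun p l M => rel R p (lift (cons l (A.list.nil _)) M))
      (by simp) (fun p l M => ?_) (fun p l m M h => ?_) p l M hl
    · simpa using (le_append p (cons l (A.list.nil _)) M).1
    · exact trans p h (by simpa using (le_append p (cons m (A.list.nil _)) M).2)
  have memb_left : ∀ {Δ : S} (p : Δ ⟶ Γ) (n : Δ ⟶ A.obj) (m : Δ ⟶ A.list.obj),
      memb n m = ⊤ → rel R p (lift (cons m (A.list.nil _))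
        (cons (cons n (A.nil _)) (A.list.nil _))) = ⊤ := by
    intro Δ p n m hn
    refine A.induction_memb (P := Γ) (fun p n m => rel R p (lift (cons m (A.list.nil _))
        (cons (cons n (A.nil _)) (A.list.nil _)))) (by simp) (fun p n m => ?_)
      (fun p n k m h => ?_) p n m hn
    · have := star_le p (cons (cons n (A.nil _)) (A.list.nil _)) (cons m (A.list.nil _))
      rw [star_singleton] at this
      exact this.1
    · have := star_le p (cons (cons k (A.nil _)) (A.list.nil _)) (cons m (A.list.nil _))
      rw [star_singleton] at this
      exact trans p this.2 h
  rw [left]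
  refine all_intro fun f l hl => ?_
  have h1 := allOn_elim (by simpa using forces_comp f h) hl
  rw [app_anyAllOf] at h1
  have key : rel R (f ≫ p) (lift (cons l (A.list.nil _)) (f ≫ M)) = ⊤ := by
    refine any_elim h1 fun g m hm e => ?_
    simp only [comp_allOf, app_allOf, comp_mset] at e
    rw [comp_rel, comp_lift, comp_cons, comp_nil]
    refine trans _ ?_ (memb_right _ m _ hm)
    rw [right]
    refine all_intro fun g' n hn => ?_
    have := all_elim (by simpa using forces_comp g' e) hn
    rw [app_mset] at this
    simpa using memb_left (g' ≫ g ≫ f ≫ p) _ _ this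
  simpa using key

/-- The free distributive lattice has an imposed order. -/
theorem isImposedOrder_freeLe : IsImposedOrder (A.list.nil (𝟙_ S)) (A.unit _)
    (append (fst _ _) (snd _ _)) (star (fst _ _) (snd _ _)) A.freeLe where
  rules := by
    have key : ∀ {Δ : S} (f : Δ ⟶ 𝟙_ S) (L M : Δ ⟶ A.list.list.obj),
        rel (snd (𝟙_ S) _ ≫ A.freeLe) f (lift L M) = allOn (anyAllOf M) L := by
      intro Δ f L M
      rw [← rel_freeLe]; simp [rel]
    have hinf : ∀ {Δ : S} (K L M : Δ ⟶ A.list.list.obj),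
        allOn (anyAllOf L) K ⊓ allOn (anyAllOf M) K = allOn (anyAllOf (star L M)) K := by
      intro Δ K L M
      rw [← allOn_pinf]
      congr 1
      exact pow_ext fun f a => by simp
    constructor
    · intro Δ f L; rw [key]; simp
    · intro Δ f L; rw [key]; exact allOn_self L
    · intro Δ f L; rw [key]; exact allOn_intro fun g l e => by simp
    · intro Δ f K L M
      rw [key]
      simp only [comp_append, comp_fstar, lift_fst, lift_snd]
      refine allOn_mono (allOn_self _) fun g ξ e => ?_
      simpa [inf_sup_left] using e
    · intro Δ f K L M
      rw [key, key, key]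
      refine le_iff_forces.2 fun g e => ?_
      simp only [comp_inf, inf_forces_iff, comp_allOn, comp_anyAllOf] at e ⊢
      exact allOn_trans e.1 e.2
    · intro Δ f K L M
      rw [key, key, key, hinf]
      simp
    · intro Δ f L M K
      rw [key, key, key]
      simp
  least {Γ} R hR := by
    refine le_iff_forces.2 fun {Δ} f e => ?_
    have := rules_of_freeLe hR (f ≫ fst _ _) (f ≫ snd _ _ ≫ fst _ _) (f ≫ snd _ _ ≫ snd _ _)
      (by simpa [freeLe] using e)
    simpa [rel, ← comp_lift] using this

end OvertDiscrete

end FreeLattice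

/-! ### Directed joins -/

section Directed

variable {S : Type u} [Category.{v} S] [CartesianMonoidalCategory S] [Model S]
  {Γ Δ X Y N M : S}

theorem some_some_forces_intro (o : Overt N) (o' : Overt M) {θ : (Γ ⊗ N) ⊗ M ⟶ (Sig : S)}
    (a : Γ ⟶ N) (b : Γ ⟶ M) (h : lift (lift (𝟙 Γ) a) b ≫ θ = ⊤) : o.some (o'.some θ) = ⊤ :=
  top_le_iff.1 (some_some_intro o o' a b h.ge)

theorem some_some_forces_elim {o : Overt N} {o' : Overt M} {θ : (Γ ⊗ N) ⊗ M ⟶ (Sig : S)}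
    {τ : Γ ⟶ (Sig : S)} (h : o.some (o'.some θ) = ⊤)
    (k : ∀ {Δ : S} (f : Δ ⟶ Γ) (a : Δ ⟶ N) (b : Δ ⟶ M), lift (lift f a) b ≫ θ = ⊤ →
      f ≫ τ = ⊤) : τ = ⊤ := by
  refine some_forces_elim h fun f a e => ?_
  rw [comp_some] at e
  refine some_forces_elim e fun g b e => ?_
  rw [← Category.assoc]
  refine k (g ≫ f) (g ≫ a) b ?_
  simpa [comp_lift_assoc] using e

namespace OvertDiscrete

variable {A : OvertDiscrete S}

/-- The sum of a list, for a given zero and addition. -/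
noncomputable def sum (zero : 𝟙_ S ⟶ A.obj) (add : A.obj ⊗ A.obj ⟶ A.obj)
    (l : Γ ⟶ A.list.obj) : Γ ⟶ A.obj :=
  lift (toUnit Γ) l ≫ A.fold zero (snd _ _ ≫ add)

variable (zero : 𝟙_ S ⟶ A.obj) (add : A.obj ⊗ A.obj ⟶ A.obj)

@[simp]
theorem comp_sum (f : Δ ⟶ Γ) (l : Γ ⟶ A.list.obj) :
    f ≫ sum zero add l = sum zero add (f ≫ l) := by
  simp [sum, comp_lift_assoc]

@[simp]
theorem comp_sum_assoc (f : Δ ⟶ Γ) (l : Γ ⟶ A.list.obj) (h : A.obj ⟶ X) :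
    f ≫ sum zero add l ≫ h = sum zero add (f ≫ l) ≫ h := by
  rw [← Category.assoc, comp_sum]

@[simp]
theorem sum_nil : sum zero add (A.nil Γ) = toUnit Γ ≫ zero := by
  simp [sum, fold_nil]

@[simp]
theorem sum_cons (n : Γ ⟶ A.obj) (l : Γ ⟶ A.list.obj) :
    sum zero add (cons n l) = lift n (sum zero add l) ≫ add := by
  simp [sum, fold_cons]

theorem app_sum_of_all {θ : Γ ⟶ pow A.obj}
    (h0 : app θ (toUnit Γ ≫ zero) = ⊤)
    (h1 : ∀ {Δ : S} (f : Δ ⟶ Γ) (n m : Δ ⟶ A.obj), app (f ≫ θ) n = ⊤ → app (f ≫ θ) m = ⊤ →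
      app (f ≫ θ) (lift n m ≫ add) = ⊤) {l : Γ ⟶ A.list.obj} (h : all θ l = ⊤) :
    app θ (sum zero add l) = ⊤ := by
  have := A.induction_of_tail (P := Γ) (fun f l => all (f ≫ θ) l)
    (fun f l => app (f ≫ θ) (sum zero add l)) (by simp) (by simp) (fun f _ => ?_)
    (fun f n l e => ?_) (fun f n l e e' => ?_) (𝟙 Γ) l (by simpa using h)
  · simpa using this
  · simpa using forces_comp f h0
  · simp at e; exact e.2
  · simp at e
    rw [sum_cons]
    exact h1 f _ _ e.1 e'

/-- A family `φ` that takes finite sums to finite joins. -/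
structure IsJoinHom (φ : A.obj ⟶ pow X) : Prop where
  zero : ∀ {Γ : S} (x : Γ ⟶ X), app ((toUnit Γ ≫ zero) ≫ φ) x = ⊥
  add : ∀ {Γ : S} (n m : Γ ⟶ A.obj) (x : Γ ⟶ X),
    app ((lift n m ≫ add) ≫ φ) x = app (n ≫ φ) x ⊔ app (m ≫ φ) x

variable {zero add}

theorem IsJoinHom.sum {φ : A.obj ⟶ pow X} (hφ : IsJoinHom zero add φ) (l : Γ ⟶ A.list.obj)
    (x : Γ ⟶ X) : app (sum zero add l ≫ φ) x =
      any (lam (app (snd _ _ ≫ φ) (fst _ _ ≫ x))) l := by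
  have := A.term_ext (P := Γ) (fun f l => app (OvertDiscrete.sum zero add l ≫ φ) (f ≫ x))
    (fun f l => any (lam (app (snd _ _ ≫ φ) (fst _ _ ≫ f ≫ x))) l)
    (fun f n _ y => app (n ≫ φ) (f ≫ x) ⊔ y)
    (by simp [← Category.assoc]) (by simp [comp_lam]) (by simp) (fun f => ?_) (fun f n l => ?_)
    (by simp) (𝟙 Γ) l
  · simpa using this
  · rw [sum_nil, hφ.zero, any_nil]
  · rw [sum_cons, hφ.add]

/-- Every functional preserves the join of `φ n` over an ideal `θ`, by the Scott principle. -/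
theorem IsJoinHom.app_elim {φ : A.obj ⟶ pow X} (hφ : IsJoinHom zero add φ)
    {Φ : Γ ⟶ pow (pow X)} {ψ : Γ ⟶ pow X} (θ : Γ ⟶ pow A.obj)
    (hψ : ∀ {Δ : S} (f : Δ ⟶ Γ) (x : Δ ⟶ X), app (f ≫ ψ) x = ⊤ →
      A.overt.some (app (fst _ _ ≫ f ≫ θ) (snd _ _) ⊓ app (snd _ _ ≫ φ) (fst _ _ ≫ x)) = ⊤)
    (h0 : app θ (toUnit Γ ≫ zero) = ⊤)
    (h1 : ∀ {Δ : S} (f : Δ ⟶ Γ) (n m : Δ ⟶ A.obj), app (f ≫ θ) n = ⊤ → app (f ≫ θ) m = ⊤ →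
      app (f ≫ θ) (lift n m ≫ add) = ⊤)
    {τ : Γ ⟶ (Sig : S)} (h : app Φ ψ = ⊤)
    (k : ∀ {Δ : S} (f : Δ ⟶ Γ) (n : Δ ⟶ A.obj), app (f ≫ θ) n = ⊤ →
      app (f ≫ Φ) (n ≫ φ) = ⊤ → f ≫ τ = ⊤) : τ = ⊤ := by
  let J : pow A.obj ⟶ pow X := lam (A.overt.some
    (app (fst _ _ ≫ fst _ _) (snd _ _) ⊓ app (snd _ _ ≫ φ) (fst _ _ ≫ snd _ _)))
  have hJ : ∀ {Δ : S} (ξ : Δ ⟶ pow A.obj) (x : Δ ⟶ X), app (ξ ≫ J) x =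
      A.overt.some (app (fst _ _ ≫ ξ) (snd _ _) ⊓ app (snd _ _ ≫ φ) (fst _ _ ≫ x)) := by
    intro Δ ξ x; simp [J]
  have h2 : app (lam (app (fst _ _ ≫ Φ) (snd _ _ ≫ J))) θ = ⊤ := by
    simp only [app_lam_id, comp_app, lift_fst_assoc, lift_snd_assoc, Category.id_comp]
    refine app_mono h fun f x e => ?_
    rw [← Category.assoc, hJ]
    exact hψ f x e
  refine scott_elim h2 fun f l e e' => ?_
  refine k f (OvertDiscrete.sum zero add l) (app_sum_of_all zero add ?_ ?_ e') ?_
  · simpa using forces_comp f h0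
  · intro Δ' g n m
    rw [← Category.assoc]
    exact h1 _ n m
  · simp only [app_comp_lam, comp_app, lift_fst_assoc, lift_snd_assoc] at e
    refine app_mono e fun g x e => ?_
    rw [← Category.assoc, hJ] at e
    rw [comp_sum_assoc, hφ.sum]
    refine some_forces_elim e fun g' n e => ?_
    simp at e
    rw [comp_any]
    exact any_intro n (by simpa using e.1) (by simpa using e.2)

end OvertDiscrete

end Directed

/-! ### Presentations of objects by bases -/

section Presentations

variable {S : Type u} [Category.{v} S] [CartesianMonoidalCategory S]

namespace BasisData

variable [SierpinskiCategory S] {B : BasisData S} {Γ Δ X : S}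

@[simp]
theorem comp_oplus (f : Δ ⟶ Γ) (a b : Γ ⟶ B.N) : f ≫ oplus a b = oplus (f ≫ a) (f ≫ b) := by
  simp [oplus, ← Category.assoc]

@[simp]
theorem comp_oplus_assoc (f : Δ ⟶ Γ) (a b : Γ ⟶ B.N) (h : B.N ⟶ X) :
    f ≫ oplus a b ≫ h = oplus (f ≫ a) (f ≫ b) ≫ h := by
  rw [← Category.assoc, comp_oplus]

@[simp]
theorem comp_ostar (f : Δ ⟶ Γ) (a b : Γ ⟶ B.N) : f ≫ ostar a b = ostar (f ≫ a) (f ≫ b) := by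
  simp [ostar, ← Category.assoc]

@[simp]
theorem comp_ostar_assoc (f : Δ ⟶ Γ) (a b : Γ ⟶ B.N) (h : B.N ⟶ X) :
    f ≫ ostar a b ≫ h = ostar (f ≫ a) (f ≫ b) ≫ h := by
  rw [← Category.assoc, comp_ostar]

@[simp]
theorem comp_bzero (f : Δ ⟶ Γ) : f ≫ B.O Γ = B.O Δ := by
  simp [O, ← Category.assoc]

@[simp]
theorem comp_bzero_assoc (f : Δ ⟶ Γ) (h : B.N ⟶ X) : f ≫ B.O Γ ≫ h = B.O Δ ≫ h := by
  rw [← Category.assoc, comp_bzero]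

@[simp]
theorem comp_bone (f : Δ ⟶ Γ) : f ≫ B.I Γ = B.I Δ := by
  simp [I, ← Category.assoc]

@[simp]
theorem comp_bone_assoc (f : Δ ⟶ Γ) (h : B.N ⟶ X) : f ≫ B.I Γ ≫ h = B.I Δ ≫ h := by
  rw [← Category.assoc, comp_bone]

variable (B) in
/-- The carrier of a basis, as an overt discrete object. -/
abbrev od : OvertDiscrete S := ⟨B.N, B.overt, B.discrete⟩

end BasisData

/-- A basis of open predicates `β n` and compact coverings `A n` on `X`, indexed by the carrier of
`B`: the `β n` are closed under the lattice operations, `A n` takes sums to meets, every `φ`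
is `∃ n. A n φ ∧ β n`, and `n ≪ m` is `A n (β m)`. -/
structure Presentation [SierpinskiCategory S] (B : BasisData S) (X : S) where
  β : B.N ⟶ pow X
  A : B.N ⟶ pow (pow X)
  β_zero : ∀ {Γ : S} (x : Γ ⟶ X), app (B.O Γ ≫ β) x = ⊥
  β_one : ∀ {Γ : S} (x : Γ ⟶ X), app (B.I Γ ≫ β) x = ⊤
  β_plus : ∀ {Γ : S} (n m : Γ ⟶ B.N) (x : Γ ⟶ X),
    app (oplus n m ≫ β) x = app (n ≫ β) x ⊔ app (m ≫ β) x
  β_star : ∀ {Γ : S} (n m : Γ ⟶ B.N) (x : Γ ⟶ X),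
    app (ostar n m ≫ β) x = app (n ≫ β) x ⊓ app (m ≫ β) x
  A_zero : ∀ {Γ : S} (φ : Γ ⟶ pow X), app (B.O Γ ≫ A) φ = ⊤
  A_plus : ∀ {Γ : S} (n m : Γ ⟶ B.N) (φ : Γ ⟶ pow X),
    app (oplus n m ≫ A) φ = app (n ≫ A) φ ⊓ app (m ≫ A) φ
  expand : ∀ {Γ : S} (φ : Γ ⟶ pow X) (x : Γ ⟶ X), app φ x =
    B.overt.some (app (snd _ _ ≫ A) (fst _ _ ≫ φ) ⊓ app (snd _ _ ≫ β) (fst _ _ ≫ x))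
  wb_eq : ∀ {Γ : S} (n m : Γ ⟶ B.N), wb n m = app (n ≫ A) (m ≫ β)

namespace Presentation

variable [Model S] {B : BasisData S} {X : S} (p : Presentation B X) {Γ Δ : S}

include p

theorem expand_intro {φ : Γ ⟶ pow X} {x : Γ ⟶ X} (n : Γ ⟶ B.N) (h : app (n ≫ p.A) φ = ⊤)
    (h' : app (n ≫ p.β) x = ⊤) : app φ x = ⊤ := by
  rw [p.expand]
  refine some_forces_intro _ n ?_
  simp [h, h']

theorem expand_elim {φ : Γ ⟶ pow X} {x : Γ ⟶ X} {τ : Γ ⟶ (Sig : S)} (h : app φ x = ⊤)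
    (k : ∀ {Δ : S} (f : Δ ⟶ Γ) (n : Δ ⟶ B.N), app (n ≫ p.A) (f ≫ φ) = ⊤ →
      app (n ≫ p.β) (f ≫ x) = ⊤ → f ≫ τ = ⊤) : τ = ⊤ := by
  rw [p.expand] at h
  refine some_forces_elim h fun f n e => ?_
  simp at e
  exact k f n e.1 e.2

theorem isJoinHom : OvertDiscrete.IsJoinHom (A := B.od) B.zero B.add p.β :=
  ⟨fun x => p.β_zero x, fun n m x => p.β_plus n m x⟩

/-- Functionals are determined by their values on the basis. -/
theorem app_elim {Φ : Γ ⟶ pow (pow X)} {φ : Γ ⟶ pow X} {τ : Γ ⟶ (Sig : S)} (h : app Φ φ = ⊤)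
    (k : ∀ {Δ : S} (f : Δ ⟶ Γ) (n : Δ ⟶ B.N), app (n ≫ p.A) (f ≫ φ) = ⊤ →
      app (f ≫ Φ) (n ≫ p.β) = ⊤ → f ≫ τ = ⊤) : τ = ⊤ := by
  refine p.isJoinHom.app_elim (lam (app (snd _ _ ≫ p.A) (fst _ _ ≫ φ))) ?_ ?_ ?_ h ?_
  · intro Δ f x e
    rw [p.expand] at e
    simpa using e
  · simpa [O] using p.A_zero φ
  · intro Δ f n m e e'
    simp at e e' ⊢
    have := p.A_plus n m (f ≫ φ)
    rw [e, e'] at this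
    simpa [oplus] using this
  · intro Δ f n e e'
    exact k f n (by simpa using e) e'

theorem app_intro {Φ : Γ ⟶ pow (pow X)} {φ : Γ ⟶ pow X} (n : Γ ⟶ B.N)
    (h : app (n ≫ p.A) φ = ⊤) (h' : app Φ (n ≫ p.β) = ⊤) : app Φ φ = ⊤ :=
  app_mono h' fun f x e => p.expand_intro (f ≫ n) (by simpa using forces_comp f h)
    (by simpa using e)

/-- The rules for `≪` hold in any presentation, provided that `≪` respects the imposed order. -/
def toAbstractBasis (mono : ∀ {Γ : S} (m' m n n' : Γ ⟶ B.N),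
    leq m' m ⊓ wb m n ⊓ leq n n' ≤ wb m' n') : AbstractBasis S where
  toBasisData := B
  zero_wb := by intros; rw [p.wb_eq, p.A_zero]
  plus_wb n m q := by rw [p.wb_eq, p.wb_eq, p.wb_eq, p.A_plus]
  mono := mono
  interpolate {Γ} n m := by
    have hp := @p.wb_eq
    refine forces_ext fun f => ⟨fun e => ?_, fun e => ?_⟩
    · rw [comp_rel] at e
      change wb _ _ = ⊤ at e
      rw [hp] at e
      refine p.app_elim e fun g k e e' => ?_
      rw [← Category.assoc]
      refine comp_some_forces_intro _ _ k ?_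
      simp only [wb, comp_inf, comp_rel, lift_fst_assoc, lift_snd] at hp ⊢
      rw [hp, hp]
      simp only [Category.assoc] at e e' ⊢
      rw [e, e', inf_top_eq]
    · rw [comp_some] at e
      refine some_forces_elim e fun g k e => ?_
      simp only [wb, comp_inf, comp_rel, lift_fst_assoc, lift_snd,
        Category.assoc, inf_forces_iff] at hp e ⊢
      rw [hp] at e ⊢
      rw [hp] at e
      simp only [Category.assoc] at e ⊢
      exact p.app_intro k e.2 e.1
  wb_star n m q r := by
    rw [p.wb_eq, p.wb_eq, p.wb_eq, p.wb_eq]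
    refine le_iff_forces.2 fun f e => ?_
    simp at e ⊢
    obtain ⟨⟨h1, h2⟩, h3⟩ := e
    refine app_mono h1 fun g x e => ?_
    have h2 := forces_comp g h2
    have h3 := forces_comp g h3
    have := p.β_star (g ≫ f ≫ q) (g ≫ f ≫ r) x
    simp at h2 h3 this e ⊢
    rw [← Category.assoc, ← Category.assoc] at h2 h3
    rw [this, p.expand_intro _ h2 (by simpa using e), p.expand_intro _ h3 (by simpa using e),
      inf_top_eq]
  wb_plus {Γ} n q r := by
    have hp := @p.wb_eq
    refine forces_ext fun f => ⟨fun e => ?_, fun e => ?_⟩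
    · rw [comp_rel] at e
      change wb _ _ = ⊤ at e
      rw [hp] at e
      have e1 : app (lam (app (fst _ _ ≫ f ≫ n ≫ p.A) (psup (snd _ _) (fst _ _ ≫ f ≫ r ≫ p.β))))
          (f ≫ q ≫ p.β) = ⊤ := by
        simp
        rw [← e]
        simp only [Category.assoc]
        congr 1
        refine pow_ext fun g x => ?_
        have := p.β_plus (g ≫ f ≫ q) (g ≫ f ≫ r) x
        simp at this ⊢
        exact this.symm
      refine p.app_elim e1 fun {Δ'} g q' h1 h2 => ?_
      have e2 : app (lam (app (fst _ _ ≫ g ≫ f ≫ n ≫ p.A) (psup (fst _ _ ≫ q' ≫ p.β) (snd _ _))))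
          (g ≫ f ≫ r ≫ p.β) = ⊤ := by
        simpa using h2
      refine p.app_elim e2 fun {Δ''} g' r' h3 h4 => ?_
      have h1 := forces_comp g' h1
      rw [← Category.assoc, ← Category.assoc]
      rw [comp_some, comp_some]
      refine some_some_forces_intro _ _ (g' ≫ q') r' ?_
      simp only [wb] at hp
      simp only [wb, comp_inf, lift_fst_assoc, lift_snd, comp_lift_assoc, lift_snd_assoc,
        Category.assoc, inf_forces_iff, hp, Category.id_comp, comp_app] at h1 h3 ⊢
      refine ⟨⟨?_, h1⟩, h3⟩
      simp at h4
      rw [← h4]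
      congr 1
      refine pow_ext fun g x => ?_
      have := p.β_plus (g ≫ g' ≫ q') (g ≫ r') x
      simp at this ⊢
      exact this
    · rw [comp_some, comp_some] at e
      refine some_some_forces_elim e fun {Δ'} g q' r' e => ?_
      simp only [wb] at hp
      simp only [wb, comp_inf, lift_fst_assoc, lift_snd, comp_lift_assoc, lift_snd_assoc,
        Category.assoc, inf_forces_iff, hp, comp_app] at e ⊢
      obtain ⟨⟨h1, h2⟩, h3⟩ := e
      refine app_mono h1 fun {Δ''} g' x e => ?_
      have h2 := forces_comp g' h2
      have h3 := forces_comp g' h3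
      have i1 := p.β_plus (g' ≫ q') (g' ≫ r') x
      have i2 := p.β_plus (g' ≫ g ≫ f ≫ q) (g' ≫ g ≫ f ≫ r) x
      simp at i1 i2 e h2 h3 ⊢
      rw [i1] at e
      rw [i2]
      refine sup_forces_elim e (fun g3 e3 => ?_) (fun g3 e3 => ?_)
      · have h2 := forces_comp g3 h2
        simp at h2 e3 ⊢
        exact sup_forces_left (p.expand_intro (g3 ≫ g' ≫ q') (by simpa using h2)
          (by simpa using e3))
      · have h3 := forces_comp g3 h3
        simp at h3 e3 ⊢
        exact sup_forces_right (p.expand_intro (g3 ≫ g' ≫ r') (by simpa using h3)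
          (by simpa using e3))

end Presentation

end Presentations

/-! ### Definable objects have bases -/

section Split

variable {S : Type u} [Category.{v} S] [CartesianMonoidalCategory S] [Model S] {Γ Δ X Y : S}

open OvertDiscrete

/-- `X` is a `Σ`-split subspace of `Σ^N` for some overt discrete `N`. -/
def IsSplit (X : S) : Prop :=
  ∃ (A : OvertDiscrete S) (i : X ⟶ pow A.obj) (I : pow X ⟶ pow (pow A.obj)),
    I ≫ powMap i = 𝟙 (pow X)

theorem IsSplit.of_split (hY : IsSplit Y) (i : X ⟶ Y) (I : pow X ⟶ pow Y)
    (h : I ≫ powMap i = 𝟙 (pow X)) : IsSplit X := by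
  obtain ⟨A, j, J, e⟩ := hY
  refine ⟨A, i ≫ j, I ≫ J, ?_⟩
  rw [comp_powMap, Category.assoc, ← Category.assoc J, e, Category.id_comp, h]

theorem IsSplit.of_retract (hY : IsSplit Y) (i : X ⟶ Y) (r : Y ⟶ X) (h : i ≫ r = 𝟙 X) :
    IsSplit X := by
  refine hY.of_split i (powMap r) ?_
  refine pow_ext fun f a => ?_
  simp [h]

/-- An overt discrete object is embedded in its powerset `Σ^N` by singletons. -/
theorem isSplit_of_overtDiscrete (A : OvertDiscrete S) : IsSplit A.obj := by
  refine ⟨A, lam A.discrete.eqv, lam (A.overt.some (app (fst _ _ ≫ fst _ _) (snd _ _) ⊓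
    app (fst _ _ ≫ snd _ _) (snd _ _))), pow_ext fun {Δ} φ n => ?_⟩
  have e0 : ∀ {Δ : S} (n m : Δ ⟶ A.obj), app (n ≫ lam A.discrete.eqv) m =
      rel A.discrete.eqv n m := fun n m => by rw [app_comp_lam]; rfl
  rw [app_powMap_assoc, app_comp_lam, Category.comp_id]
  refine forces_ext fun f => ⟨fun e => ?_, fun e => ?_⟩
  · rw [← Category.assoc, comp_some] at e
    refine some_forces_elim e fun g m e => ?_
    simp only [comp_lift, comp_inf, comp_app, lift_fst, lift_snd,
      inf_forces_iff, ← Category.assoc] at e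
    rw [e0, ← A.discrete.eqv_iff] at e
    rw [← e.2] at e
    simpa using e.1
  · rw [← Category.assoc]
    refine comp_some_forces_intro _ _ (f ≫ n) ?_
    simp at e ⊢
    exact ⟨e, A.discrete.eqv_self _⟩

theorem isSplit_pow_obj (A : OvertDiscrete S) : IsSplit (pow A.obj : S) :=
  ⟨A, 𝟙 _, 𝟙 _, pow_ext fun f a => by simp⟩

/-- The term `λ l. Φ (λ n. n ∈ l)`, as a function of `Φ`. -/
noncomputable def toLists (A : OvertDiscrete S) : pow (pow A.obj) ⟶ (pow A.list.obj : S) :=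
  onLists (𝟙 _)

@[simp]
theorem app_toLists {A : OvertDiscrete S} (Φ : Γ ⟶ pow (pow A.obj)) (l : Γ ⟶ A.list.obj) :
    app (Φ ≫ toLists A) l = app Φ (mset l) := by
  simp [toLists]

/-- By the Scott principle `Σ^(Σ^N)` is a retract of `Σ^(List N)`. -/
theorem IsSplit.power (hX : IsSplit X) : IsSplit (pow X : S) := by
  obtain ⟨A, i, I, h⟩ := hX
  let r : pow A.list.obj ⟶ pow X := lam (A.list.overt.some (app (fst _ _ ≫ fst _ _) (snd _ _) ⊓
    all (fst _ _ ≫ snd _ _ ≫ i) (snd _ _)))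
  have hr : ∀ {Γ : S} (θ : Γ ⟶ pow A.list.obj) (x : Γ ⟶ X), app (θ ≫ r) x =
      A.list.overt.some (app (fst _ _ ≫ θ) (snd _ _) ⊓ all (fst _ _ ≫ x ≫ i) (snd _ _)) := by
    intro Γ θ x; simp [r]
  refine (isSplit_pow_obj A.list).of_retract (I ≫ toLists A) r (pow_ext fun φ x => ?_)
  have e1 : app (φ ≫ 𝟙 (pow X)) x = app (φ ≫ I) (x ≫ i) := by
    rw [← app_powMap, Category.assoc, h]
  rw [e1, ← Category.assoc, ← Category.assoc, hr]
  refine forces_ext fun f => ⟨fun e => ?_, fun e => ?_⟩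
  · rw [comp_some] at e
    refine some_forces_elim e fun g l e => ?_
    simp only [← Category.assoc, comp_inf, comp_app, comp_all, lift_fst, lift_snd,
      app_toLists, comp_mset, inf_forces_iff] at e ⊢
    exact scott_intro l e.1 e.2
  · rw [comp_app] at e
    refine scott_elim e fun g l e e' => ?_
    simp only [← Category.assoc] at e e' ⊢
    refine comp_some_forces_intro _ _ l ?_
    simp only [← Category.assoc, comp_inf, comp_app, comp_all, lift_fst, lift_snd,
      app_toLists, comp_mset, inf_forces_iff] at e e' ⊢
    exact ⟨e, e'⟩

/-- `Σ^N × Σ^M` is a retract of `Σ^(List N × List M)`. -/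
theorem isSplit_pow_tensor (A B : OvertDiscrete S) : IsSplit ((pow A.obj : S) ⊗ pow B.obj) := by
  let i : (pow A.obj : S) ⊗ pow B.obj ⟶ pow (A.list.obj ⊗ B.list.obj) :=
    lam (all (fst _ _ ≫ fst _ _) (snd _ _ ≫ fst A.list.obj B.list.obj) ⊓
      all (fst _ _ ≫ snd _ _) (snd _ _ ≫ snd A.list.obj B.list.obj))
  have hi : ∀ {Γ : S} (p : Γ ⟶ (pow A.obj : S) ⊗ pow B.obj) (l : Γ ⟶ A.list.obj)
      (m : Γ ⟶ B.list.obj), app (p ≫ i) (lift l m) = all (p ≫ fst _ _) l ⊓ all (p ≫ snd _ _) m := by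
    intro Γ p l m; simp [i]
  let r : (pow (A.list.obj ⊗ B.list.obj) : S) ⟶ pow A.obj ⊗ pow B.obj :=
    lift (lam (app (fst _ _) (lift (cons (snd _ _) (A.nil _)) (B.nil _))))
      (lam (app (fst _ _) (lift (A.nil _) (cons (snd _ _) (B.nil _)))))
  have hr1 : ∀ {Γ Δ : S} (f : Γ ⟶ Δ) (θ : Δ ⟶ pow (A.list.obj ⊗ B.list.obj)) (a : Γ ⟶ A.obj),
      app (f ≫ θ ≫ r ≫ fst _ _) a = app (f ≫ θ) (lift (cons a (A.nil _)) (B.nil _)) := by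
    intro Γ Δ f θ a; rw [← Category.assoc f]; simp [r]
  have hr2 : ∀ {Γ Δ : S} (f : Γ ⟶ Δ) (θ : Δ ⟶ pow (A.list.obj ⊗ B.list.obj)) (a : Γ ⟶ B.obj),
      app (f ≫ θ ≫ r ≫ snd _ _) a = app (f ≫ θ) (lift (A.nil _) (cons a (B.nil _))) := by
    intro Γ Δ f θ a; rw [← Category.assoc f]; simp [r]
  suffices h : i ≫ r = 𝟙 _ from
    (isSplit_pow_obj (A.list.prod B.list)).of_retract i r h
  refine CartesianMonoidalCategory.hom_ext _ _ ?_ ?_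
  · refine pow_ext fun f a => ?_
    have h1 : app (f ≫ i ≫ r ≫ fst _ _) a = app (f ≫ fst _ _) a := by
      rw [hr1, hi]; simp
    rw [Category.id_comp, ← h1]
    simp only [Category.assoc]
  · refine pow_ext fun f a => ?_
    have h1 : app (f ≫ i ≫ r ≫ snd _ _) a = app (f ≫ snd _ _) a := by
      rw [hr2, hi]; simp
    rw [Category.id_comp, ← h1]
    simp only [Category.assoc]

theorem IsSplit.prod (hX : IsSplit X) (hY : IsSplit Y) : IsSplit (X ⊗ Y) := by
  obtain ⟨A, i, I, h⟩ := hX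
  obtain ⟨B, j, J, k⟩ := hY
  have hI : ∀ {Γ : S} (φ : Γ ⟶ pow X) (x : Γ ⟶ X), app (φ ≫ I) (x ≫ i) = app φ x := fun φ x => by
    rw [← app_powMap, Category.assoc, h, Category.comp_id]
  have hJ : ∀ {Γ : S} (φ : Γ ⟶ pow Y) (x : Γ ⟶ Y), app (φ ≫ J) (x ≫ j) = app φ x := fun φ x => by
    rw [← app_powMap, Category.assoc, k, Category.comp_id]
  -- `λ x. φ (x, y)` and its extension along `i`
  let P : (pow (X ⊗ Y) : S) ⊗ Y ⟶ pow X :=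
      lam (app (fst _ _ ≫ fst _ _) (lift (snd _ _) (fst _ _ ≫ snd _ _)))
  have hP : ∀ {Γ : S} (φ : Γ ⟶ pow (X ⊗ Y)) (y : Γ ⟶ Y) (x : Γ ⟶ X),
      app (lift φ y ≫ P) x = app φ (lift x y) := fun φ y x => by simp [P]
  let Q : (pow (X ⊗ Y) : S) ⊗ pow A.obj ⟶ pow Y :=
    lam (app ((lift (fst _ _ ≫ fst _ _) (snd _ _) ≫ P) ≫ I) (fst _ _ ≫ snd _ _))
  have hQ : ∀ {Γ : S} (φ : Γ ⟶ pow (X ⊗ Y)) (ξ : Γ ⟶ pow A.obj) (y : Γ ⟶ Y),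
      app (lift φ ξ ≫ Q) y = app ((lift φ y ≫ P) ≫ I) ξ := fun φ ξ y => by
    simp [Q, comp_lift_assoc]
  let R : (pow (X ⊗ Y) : S) ⟶ pow (pow A.obj ⊗ pow B.obj) :=
    lam (app ((lift (fst _ _) (snd _ _ ≫ fst _ _) ≫ Q) ≫ J) (snd _ _ ≫ snd _ _))
  have hR : ∀ {Γ : S} (φ : Γ ⟶ pow (X ⊗ Y)) (ξ : Γ ⟶ pow A.obj) (ζ : Γ ⟶ pow B.obj),
      app (φ ≫ R) (lift ξ ζ) = app ((lift φ ξ ≫ Q) ≫ J) ζ := fun φ ξ ζ => by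
    simp [R, comp_lift_assoc]
  refine (isSplit_pow_tensor A B).of_split (lift (fst _ _ ≫ i) (snd _ _ ≫ j)) R
    (pow_ext fun φ a => ?_)
  rw [app_powMap_assoc, comp_lift, hR, ← Category.assoc a, ← Category.assoc a, hJ, hQ, hI, hP]
  simp [← comp_lift]

theorem isSplit_of_definable (h : Definable X) : IsSplit X := by
  induction h with
  | overtDiscrete o d => exact isSplit_of_overtDiscrete ⟨_, o, d⟩
  | prod _ _ h1 h2 => exact h1.prod h2
  | pow _ h => exact h.power
  | subspace E i I _ _ hI h => exact h.of_split i I hI.split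

/-- The basis of a `Σ`-split subspace of `Σ^N`, indexed by the free distributive lattice on `N`. -/
noncomputable abbrev splitBasis (A : OvertDiscrete S) (i : X ⟶ pow A.obj)
    (I : pow X ⟶ pow (pow A.obj)) : BasisData S where
  N := A.list.list.obj
  overt := A.list.list.overt
  discrete := A.list.list.discrete
  zero := A.list.nil _
  one := A.unit _
  add := append (fst _ _) (snd _ _)
  mul := star (fst _ _) (snd _ _)
  waybelow := allOn ((anyAllOf (snd _ _) ≫ powMap i) ≫ I) (fst _ _)
  le := A.freeLe
  isImposedOrder := isImposedOrder_freeLe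

section

variable {A : OvertDiscrete S} {i : X ⟶ pow A.obj} {I : pow X ⟶ pow (pow A.obj)}

theorem splitBasis_wb (L M : Γ ⟶ A.list.list.obj) : wb (B := splitBasis A i I) L M =
    allOn ((anyAllOf M ≫ powMap i) ≫ I) L := by
  refine (comp_allOn _ _ _).trans ?_
  rw [← Category.assoc, ← Category.assoc, comp_anyAllOf]
  simp only [lift_fst, lift_snd]

theorem splitBasis_leq (L M : Γ ⟶ A.list.list.obj) : leq (B := splitBasis A i I) L M =
    allOn (anyAllOf M) L := rel_freeLe L M

theorem app_anyAllOf_powMap (L : Γ ⟶ A.list.list.obj) (x : Γ ⟶ X) :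
    app (L ≫ anyAllOf (𝟙 A.list.list.obj) ≫ powMap i) x = anyAll (x ≫ i) L := by
  simp

theorem app_lam_allOn (L : Γ ⟶ A.list.list.obj) (φ : Γ ⟶ pow X) :
    app (L ≫ lam (allOn (snd A.list.list.obj _ ≫ I) (fst _ _))) φ = allOn (φ ≫ I) L := by
  simp

/-- The presentation of a `Σ`-split subspace of `Σ^N`: `β L x` is `∃ l ∈ L. ∀ n ∈ l. i x n` and
`A L φ` is `∀ l ∈ L. I φ (λ n. n ∈ l)`. -/
noncomputable def splitPresentation (h : I ≫ powMap i = 𝟙 (pow X)) :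
    Presentation (splitBasis A i I) X where
  β := anyAllOf (𝟙 A.list.list.obj) ≫ powMap i
  A := lam (allOn (snd A.list.list.obj _ ≫ I) (fst _ _))
  β_zero x := by simp [O, splitBasis]
  β_one x := by simp [BasisData.I, splitBasis]
  β_plus {Γ} (n m : Γ ⟶ A.list.list.obj) x := by
    change app ((lift n m ≫ append (fst _ _) (snd _ _)) ≫ _) x = _
    rw [app_anyAllOf_powMap, app_anyAllOf_powMap, app_anyAllOf_powMap]
    simp
  β_star {Γ} (n m : Γ ⟶ A.list.list.obj) x := by
    change app ((lift n m ≫ star (fst _ _) (snd _ _)) ≫ _) x = _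
    rw [app_anyAllOf_powMap, app_anyAllOf_powMap, app_anyAllOf_powMap]
    simp
  A_zero φ := by simp [O, splitBasis]
  A_plus {Γ} (n m : Γ ⟶ A.list.list.obj) φ := by
    change app ((lift n m ≫ append (fst _ _) (snd _ _)) ≫ _) φ = _
    rw [app_lam_allOn, app_lam_allOn, app_lam_allOn]
    simp
  expand {Γ} φ x := by
    change _ = A.list.list.overt.some _
    rw [app_lam_allOn, app_anyAllOf_powMap]
    have e0 : app φ x = app (φ ≫ I) (x ≫ i) := by
      rw [← app_powMap, Category.assoc, h, Category.comp_id]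
    rw [e0]
    refine forces_ext fun f => ⟨fun e => ?_, fun e => ?_⟩
    · rw [comp_app] at e
      refine scott_elim e fun g l e e' => ?_
      rw [← Category.assoc]
      refine comp_some_forces_intro _ _ (cons l (A.list.nil _)) ?_
      simp at e e' ⊢
      exact ⟨e, e'⟩
    · rw [comp_some] at e
      refine some_forces_elim e fun g L e => ?_
      simp at e ⊢
      exact allOn_cut e.1 e.2
  wb_eq {Γ} (n m : Γ ⟶ A.list.list.obj) := by
    rw [splitBasis_wb, app_lam_allOn]
    simp [← Category.assoc]

theorem splitBasis_mono {Γ : S}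
    (m' m n n' : Γ ⟶ (splitBasis A i I).N) : leq m' m ⊓ wb m n ⊓ leq n n' ≤ wb m' n' := by
  change Γ ⟶ A.list.list.obj at m' m n n'
  rw [splitBasis_leq, splitBasis_leq, splitBasis_wb, splitBasis_wb]
  refine le_iff_forces.2 fun f e => ?_
  simp only [comp_inf, inf_forces_iff, comp_allOn, comp_anyAllOf, ← Category.assoc] at e ⊢
  obtain ⟨⟨h1, h2⟩, h3⟩ := e
  refine allOn_trans h1 (allOn_mono h2 fun g ξ e => ?_)
  have e1 : app (lam (app ((snd _ _ ≫ I)) (fst _ _ ≫ ξ)))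
      (((g ≫ anyAllOf (f ≫ n)) ≫ powMap i)) = ⊤ := by
    simpa using e
  have h3 := forces_comp g h3
  have := app_mono (ψ := (g ≫ anyAllOf (f ≫ n')) ≫ powMap i) e1 fun g' x e => ?_
  · simpa using this
  · have h3 := forces_comp g' h3
    simp at e h3 ⊢
    simpa using allOn_cut h3 e

end

/-- Every definable object is presented by an abstract basis. -/
theorem exists_presentation_of_definable (h : Definable X) :
    ∃ B : AbstractBasis S, Nonempty (Presentation B.toBasisData X) := by
  obtain ⟨A, i, I, e⟩ := isSplit_of_definable h
  exact ⟨(splitPresentation e).toAbstractBasis splitBasis_mono, ⟨splitPresentation e⟩⟩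

end Split

/-! ### Lattice polynomials in an abstract basis -/

section Polynomials

variable {S : Type u} [Category.{v} S] [CartesianMonoidalCategory S] [Model S]
  {B : AbstractBasis S} {Γ Δ X : S}

open OvertDiscrete

theorem leq_forces_trans {a b c : Γ ⟶ B.N} (h : leq a b = ⊤) (h' : leq b c = ⊤) :
    leq a c = ⊤ := by
  have := B.isImposedOrder.rules.trans (toUnit Γ) a b c
  rw [rel_le, rel_le, rel_le, h, h', top_inf_eq] at this
  exact top_le_iff.1 this

theorem leq_bone (a : Γ ⟶ B.N) : leq a (B.I Γ) = ⊤ := by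
  rw [← rel_le]; exact B.isImposedOrder.rules.le_one _ a

theorem leq_ostar {a b c : Γ ⟶ B.N} (h : leq a b = ⊤) (h' : leq a c = ⊤) :
    leq a (ostar b c) = ⊤ := by
  have := B.isImposedOrder.rules.le_mul (toUnit Γ) a b c
  rw [rel_le, rel_le, h, h', top_inf_eq] at this
  rw [← rel_le]; exact this.symm

theorem oplus_leq {a b c : Γ ⟶ B.N} (h : leq a c = ⊤) (h' : leq b c = ⊤) :
    leq (oplus a b) c = ⊤ := by
  have := B.isImposedOrder.rules.add_le (toUnit Γ) a b c
  rw [rel_le, rel_le, h, h', top_inf_eq] at this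
  rw [← rel_le]; exact this.symm

theorem oplus_leq_oplus {a b c d : Γ ⟶ B.N} (h : leq a c = ⊤) (h' : leq b d = ⊤) :
    leq (oplus a b) (oplus c d) = ⊤ :=
  oplus_leq (leq_forces_trans h (leq_plus c d).1) (leq_forces_trans h' (leq_plus c d).2)

theorem ostar_leq_ostar {a b c d : Γ ⟶ B.N} (h : leq a c = ⊤) (h' : leq b d = ⊤) :
    leq (ostar a b) (ostar c d) = ⊤ :=
  leq_ostar (leq_forces_trans (star_leq a b).1 h) (leq_forces_trans (star_leq a b).2 h')

theorem ostar_leq_comm (a b : Γ ⟶ B.N) : leq (ostar a b) (ostar b a) = ⊤ :=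
  leq_ostar (star_leq a b).2 (star_leq a b).1

theorem ostar_oplus_leq (k n m : Γ ⟶ B.N) :
    leq (ostar k (oplus n m)) (oplus (ostar k n) (ostar k m)) = ⊤ := by
  rw [← rel_le]; exact B.isImposedOrder.rules.distrib _ k n m

theorem oplus_ostar_leq (k n m : Γ ⟶ B.N) :
    leq (ostar (oplus n m) k) (oplus (ostar n k) (ostar m k)) = ⊤ :=
  leq_forces_trans (ostar_leq_comm _ _) (leq_forces_trans (ostar_oplus_leq _ _ _)
    (oplus_leq_oplus (ostar_leq_comm _ _) (ostar_leq_comm _ _)))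

theorem leq_wb {a b c : Γ ⟶ B.N} (h : leq a b = ⊤) (h' : wb b c = ⊤) : wb a c = ⊤ :=
  top_le_iff.1 (wb_mono_left h'.ge h)

theorem wb_leq {a b c : Γ ⟶ B.N} (h : wb a b = ⊤) (h' : leq b c = ⊤) : wb a c = ⊤ :=
  top_le_iff.1 (wb_mono_right h.ge h')

theorem wb_forces_trans {a b c : Γ ⟶ B.N} (h : wb a b = ⊤) (h' : wb b c = ⊤) : wb a c = ⊤ :=
  top_le_iff.1 (wb_trans h.ge h'.ge)

theorem oplus_wb {a b c : Γ ⟶ B.N} (h : wb a c = ⊤) (h' : wb b c = ⊤) :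
    wb (oplus a b) c = ⊤ := by
  rw [← B.plus_wb, h, h', top_inf_eq]

theorem wb_ostar {n m p q : Γ ⟶ B.N} (h : wb n m = ⊤) (h1 : wb m p = ⊤) (h2 : wb m q = ⊤) :
    wb n (ostar p q) = ⊤ := by
  have := B.wb_star n m p q
  rw [h, h1, h2] at this
  simpa using this

theorem wb_forces_elim {a c : Γ ⟶ B.N} {τ : Γ ⟶ (Sig : S)} (h : wb a c = ⊤)
    (k : ∀ {Δ : S} (f : Δ ⟶ Γ) (b : Δ ⟶ B.N), wb (f ≫ a) b = ⊤ → wb b (f ≫ c) = ⊤ →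
      f ≫ τ = ⊤) : τ = ⊤ := by
  rw [B.interpolate] at h
  refine some_forces_elim h fun f b e => ?_
  simp at e
  exact k f b e.1 e.2

theorem wb_oplus_elim {n p q : Γ ⟶ B.N} {τ : Γ ⟶ (Sig : S)} (h : wb n (oplus p q) = ⊤)
    (k : ∀ {Δ : S} (f : Δ ⟶ Γ) (p' q' : Δ ⟶ B.N), wb (f ≫ n) (oplus p' q') = ⊤ →
      wb p' (f ≫ p) = ⊤ → wb q' (f ≫ q) = ⊤ → f ≫ τ = ⊤) : τ = ⊤ := by
  rw [B.wb_plus] at h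
  refine some_some_forces_elim h fun f p' q' e => ?_
  simp at e
  exact k f p' q' e.1.1 e.1.2 e.2

theorem wb_oplus_intro {n p q : Γ ⟶ B.N} (p' q' : Γ ⟶ B.N) (h : wb n (oplus p' q') = ⊤)
    (h1 : wb p' p = ⊤) (h2 : wb q' q = ⊤) : wb n (oplus p q) = ⊤ := by
  rw [B.wb_plus]
  refine some_some_forces_intro _ _ p' q' ?_
  simp
  exact ⟨⟨h, h1⟩, h2⟩

/-- The product of a list of elements of a basis. -/
noncomputable def prod (l : Γ ⟶ B.od.list.obj) : Γ ⟶ B.N := sum (A := B.od) B.one B.mul l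

@[simp]
theorem comp_prod (f : Δ ⟶ Γ) (l : Γ ⟶ B.od.list.obj) : f ≫ prod l = prod (f ≫ l) :=
  comp_sum _ _ f l

@[simp]
theorem prod_nil : prod (B.od.nil Γ) = B.I Γ := sum_nil _ _

@[simp]
theorem prod_cons (n : Γ ⟶ B.N) (l : Γ ⟶ B.od.list.obj) :
    prod (cons (A := B.od) n l) = ostar n (prod l) := sum_cons (A := B.od) B.one B.mul n l

/-- The sum of the products of the members of a list of lists of elements of a basis. -/
noncomputable def poly (L : Γ ⟶ B.od.list.list.obj) : Γ ⟶ B.N :=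
  lift (toUnit Γ) L ≫ B.od.list.fold B.zero (oplus (prod (snd _ _ ≫ fst _ _)) (snd _ _ ≫ snd _ _))

@[simp]
theorem comp_poly (f : Δ ⟶ Γ) (L : Γ ⟶ B.od.list.list.obj) : f ≫ poly L = poly (f ≫ L) := by
  simp [poly, comp_lift_assoc]

@[simp]
theorem poly_nil : poly (B.od.list.nil Γ) = B.O Γ := by
  simp [poly, fold_nil, O]

@[simp]
theorem poly_cons (l : Γ ⟶ B.od.list.obj) (L : Γ ⟶ B.od.list.list.obj) :
    poly (cons l L) = oplus (prod l) (poly L) := by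
  simp [poly, fold_cons]

theorem leq_poly_singleton (l : Γ ⟶ B.od.list.obj) :
    leq (prod l) (poly (cons l (B.od.list.nil Γ))) = ⊤ := by
  rw [poly_cons]; exact (leq_plus _ _).1

theorem leq_prod_singleton (n : Γ ⟶ B.N) :
    leq n (prod (cons (A := B.od) n (B.od.nil Γ))) = ⊤ := by
  rw [prod_cons, prod_nil]; exact leq_ostar (leq_refl n) (leq_bone n)

theorem prod_leq {n : Γ ⟶ B.N} {l : Γ ⟶ B.od.list.obj} (h : memb (A := B.od) n l = ⊤) :
    leq (prod l) n = ⊤ := by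
  refine B.od.induction_memb (P := Γ) (fun _ n l => leq (B := B.toBasisData) (prod l) n)
    (by simp [leq]) (fun _ n l => ?_) (fun _ n m l h => ?_) (𝟙 Γ) n l h
  · rw [prod_cons]; exact (star_leq _ _).1
  · rw [prod_cons]; exact leq_forces_trans (star_leq _ _).2 h

/-- `ΣΠ L` is the least upper bound of the products of its members. -/
theorem poly_leq {p : Γ ⟶ B.N} {L : Γ ⟶ B.od.list.list.obj}
    (k : ∀ {Δ : S} (f : Δ ⟶ Γ) (l : Δ ⟶ B.od.list.obj), memb l (f ≫ L) = ⊤ →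
      leq (prod l) (f ≫ p) = ⊤) : leq (poly L) p = ⊤ := by
  have := B.od.list.induction_of_tail (P := Γ)
    (fun f L' => all (mset (f ≫ L)) L') (fun f L' => leq (B := B.toBasisData) (poly L') (f ≫ p))
    (by simp) (by simp [leq]) (fun f _ => ?_) (fun f n l e => ?_) (fun f n l e e' => ?_) (𝟙 Γ) L
    (by simpa using all_mset L)
  · simpa using this
  · rw [poly_nil]; exact zero_leq _
  · simp at e; exact e.2
  · simp at e
    rw [poly_cons]
    exact oplus_leq (k f n e.1) e'

theorem poly_append_leq (L M : Γ ⟶ B.od.list.list.obj) :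
    leq (poly L) (poly (append L M)) = ⊤ ∧ leq (poly M) (poly (append L M)) = ⊤ := by
  rw [← inf_forces_iff]
  refine B.od.list.induction (P := Γ) (fun f L => leq (B := B.toBasisData) (poly L)
    (poly (append L (f ≫ M))) ⊓ leq (B := B.toBasisData) (poly (f ≫ M)) (poly (append L (f ≫ M))))
    (by simp [leq]) (fun f => ?_) (fun f l L h => ?_) (𝟙 Γ) L |> fun h => by simpa using h
  · simp [leq_refl, zero_leq]
  · rw [inf_forces_iff] at h ⊢
    simp only [append_cons, poly_cons]
    exact ⟨oplus_leq_oplus (leq_refl _) h.1, leq_forces_trans h.2 (leq_plus _ _).2⟩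

theorem ostar_prod_leq (l m : Γ ⟶ B.od.list.obj) :
    leq (ostar (prod l) (prod m)) (prod (append l m)) = ⊤ := by
  refine B.od.induction (P := Γ) (fun f l => leq (B := B.toBasisData)
    (ostar (prod l) (prod (f ≫ m))) (prod (append l (f ≫ m)))) (by simp [leq])
    (fun f => ?_) (fun f n l h => ?_) (𝟙 Γ) l |> fun h => by simpa using h
  · rw [append_nil]; exact (star_leq _ _).2
  · rw [append_cons, prod_cons, prod_cons]
    have h1 := star_leq (ostar n (prod l)) (prod (f ≫ m))
    refine leq_ostar (leq_forces_trans h1.1 (star_leq _ _).1) (leq_forces_trans ?_ h)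
    exact leq_ostar (leq_forces_trans h1.1 (star_leq _ _).2) h1.2

theorem ostar_poly_leq_mapAppend (l : Γ ⟶ B.od.list.obj) (M : Γ ⟶ B.od.list.list.obj) :
    leq (ostar (prod l) (poly M)) (poly (mapAppend l M)) = ⊤ := by
  refine B.od.list.induction (P := Γ) (fun f M => leq (B := B.toBasisData)
    (ostar (prod (f ≫ l)) (poly M)) (poly (mapAppend (f ≫ l) M))) (by simp [leq])
    (fun f => ?_) (fun f m M h => ?_) (𝟙 Γ) M |> fun h => by simpa using h
  · rw [mapAppend_nil, poly_nil]; exact (star_leq _ _).2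
  · rw [mapAppend_cons, poly_cons, poly_cons]
    exact leq_forces_trans (ostar_oplus_leq _ _ _) (oplus_leq_oplus (ostar_prod_leq _ _) h)

theorem ostar_poly_leq (L M : Γ ⟶ B.od.list.list.obj) :
    leq (ostar (poly L) (poly M)) (poly (OvertDiscrete.star L M)) = ⊤ := by
  refine B.od.list.induction (P := Γ) (fun f L => leq (B := B.toBasisData)
    (ostar (poly L) (poly (f ≫ M))) (poly (OvertDiscrete.star L (f ≫ M)))) (by simp [leq])
    (fun f => ?_) (fun f l L h => ?_) (𝟙 Γ) L |> fun h => by simpa using h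
  · rw [star_nil, poly_nil]; exact (star_leq _ _).1
  · rw [star_cons, poly_cons]
    refine leq_forces_trans (oplus_ostar_leq _ _ _) (oplus_leq ?_ ?_)
    · exact leq_forces_trans (ostar_poly_leq_mapAppend _ _) (poly_append_leq _ _).1
    · exact leq_forces_trans h (poly_append_leq _ _).2

/-- A rounded ideal for `≪`. -/
structure IsRoundedIdeal (θ : Γ ⟶ pow B.N) : Prop where
  zero : app θ (B.O Γ) = ⊤
  add : ∀ {Δ : S} (f : Δ ⟶ Γ) (n m : Δ ⟶ B.N), app (f ≫ θ) n = ⊤ → app (f ≫ θ) m = ⊤ →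
    app (f ≫ θ) (oplus n m) = ⊤
  lower : ∀ {Δ : S} (f : Δ ⟶ Γ) (n m : Δ ⟶ B.N), wb n m = ⊤ → app (f ≫ θ) m = ⊤ →
    app (f ≫ θ) n = ⊤
  round : ∀ {Δ : S} (f : Δ ⟶ Γ) (n : Δ ⟶ B.N), app (f ≫ θ) n = ⊤ →
    B.overt.some (wb (fst _ _ ≫ n) (snd _ _) ⊓ app (fst _ _ ≫ f ≫ θ) (snd _ _)) = ⊤

theorem IsRoundedIdeal.round_elim {θ : Γ ⟶ pow B.N} (hθ : IsRoundedIdeal θ) {n : Γ ⟶ B.N}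
    {τ : Γ ⟶ (Sig : S)} (h : app θ n = ⊤)
    (k : ∀ {Δ : S} (f : Δ ⟶ Γ) (m : Δ ⟶ B.N), wb (f ≫ n) m = ⊤ → app (f ≫ θ) m = ⊤ →
      f ≫ τ = ⊤) : τ = ⊤ := by
  refine some_forces_elim (hθ.round (𝟙 Γ) n (by simpa using h)) fun f m e => ?_
  simp at e
  exact k f m e.1 e.2

theorem IsRoundedIdeal.comp {θ : Γ ⟶ pow B.N} (hθ : IsRoundedIdeal θ) (f : Δ ⟶ Γ) :
    IsRoundedIdeal (f ≫ θ) where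
  zero := by simpa using forces_comp f hθ.zero
  add g n m := by rw [← Category.assoc]; exact hθ.add _ n m
  lower g n m := by rw [← Category.assoc]; exact hθ.lower _ n m
  round g n := by rw [← Category.assoc g f]; exact hθ.round _ n

/-- A rounded ideal contains `n` if `n ≪ ΣΠ L` and it contains everything way below the product
of any member of `L`: the summands are removed from the sum, one by one. -/
theorem IsRoundedIdeal.of_wb_poly {θ : Γ ⟶ pow B.N} (hθ : IsRoundedIdeal θ) {n : Γ ⟶ B.N}
    {L : Γ ⟶ B.od.list.list.obj} (h : wb n (poly L) = ⊤)
    (k : ∀ {Δ : S} (f : Δ ⟶ Γ) (l : Δ ⟶ B.od.list.obj) (m : Δ ⟶ B.N), memb l (f ≫ L) = ⊤ →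
      wb m (prod l) = ⊤ → app (f ≫ θ) m = ⊤) : app θ n = ⊤ := by
  -- `e f L'` is `∃ m. n ≪ m + ΣΠ L' ∧ θ m`
  let e : ∀ {Δ : S}, (Δ ⟶ Γ) → (Δ ⟶ B.od.list.list.obj) → (Δ ⟶ (Sig : S)) := fun f L' =>
    B.overt.some (wb (fst _ _ ≫ f ≫ n) (oplus (snd _ _) (fst _ _ ≫ poly L')) ⊓
      app (fst _ _ ≫ f ≫ θ) (snd _ _))
  have e_comp : ∀ {Δ Δ' : S} (g : Δ' ⟶ Δ) (f : Δ ⟶ Γ) (L' : Δ ⟶ B.od.list.list.obj),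
      g ≫ e f L' = e (g ≫ f) (g ≫ L') := fun g f L' => by simp [e]
  have e_intro : ∀ {Δ : S} {f : Δ ⟶ Γ} {L' : Δ ⟶ B.od.list.list.obj} (m : Δ ⟶ B.N),
      wb (f ≫ n) (oplus m (poly L')) = ⊤ → app (f ≫ θ) m = ⊤ → e f L' = ⊤ :=
    fun m h1 h2 => some_forces_intro _ m (by simp [h2]; exact h1)
  have h1 : e (𝟙 Γ) (B.od.list.nil Γ) = ⊤ := by
    have := B.od.list.induction_of_tail (P := Γ)
      (fun f L' => e f L' ⊓ all (mset (f ≫ L)) L') (fun f _ => e f (B.od.list.nil _))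
      (by simp [e_comp]) (by simp [e_comp]) (fun f h => ?_) (fun f l L' h => ?_)
      (fun f l L' _ h => h) (𝟙 Γ) L ?_
    · exact this
    · rw [inf_forces_iff] at h; exact h.1
    · rw [inf_forces_iff, all_cons, inf_forces_iff, app_mset] at h
      obtain ⟨h0, hl, h'⟩ := h
      rw [inf_forces_iff]
      refine ⟨some_forces_elim h0 fun {Δ'} g m h0 => ?_, h'⟩
      simp only [wb, comp_inf, comp_rel, lift_fst_assoc, lift_snd, comp_oplus, comp_app,
        inf_forces_iff, comp_poly, comp_prod, poly_cons] at h0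
      -- `n ≪ m + (Πl + ΣΠ L') ≼ Πl + (m + ΣΠ L')`
      have h2 : wb (g ≫ f ≫ n) (oplus (prod (g ≫ l)) (oplus m (poly (g ≫ L')))) = ⊤ := by
        refine wb_leq h0.1 (oplus_leq ?_ (oplus_leq_oplus (leq_refl _) ?_))
        · exact leq_forces_trans (leq_plus _ _).1 (leq_plus _ _).2
        · exact (leq_plus _ _).2
      refine wb_oplus_elim h2 fun {Δ2} g2 p' q' h3 h4 h5 => ?_
      refine wb_forces_elim h4 fun {Δ3} g3 p h6 h7 => ?_
      have h8 : app ((g3 ≫ g2 ≫ g ≫ f) ≫ θ) p = ⊤ := by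
        refine k _ (g3 ≫ g2 ≫ g ≫ l) p ?_ (by simpa using h7)
        simpa using forces_comp (g3 ≫ g2 ≫ g) hl
      have h9 : app ((g3 ≫ g2 ≫ g ≫ f) ≫ θ) (g3 ≫ g2 ≫ m) = ⊤ := by
        simpa using forces_comp (g3 ≫ g2) h0.2
      have h10 : wb (g3 ≫ g2 ≫ g ≫ f ≫ n) (oplus p (g3 ≫ g2 ≫ oplus m (poly (g ≫ L')))) = ⊤ :=
        wb_oplus_intro (g3 ≫ p') (g3 ≫ q') (by simpa using forces_comp g3 h3) h6
          (by simpa using forces_comp g3 h5)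
      rw [e_comp, e_comp, e_comp]
      refine e_intro (oplus p (g3 ≫ g2 ≫ m)) ?_ (by simpa using hθ.add _ _ _ h8 h9)
      simp only [comp_oplus, comp_poly] at h10
      simp only [Category.assoc]
      refine wb_leq h10 (oplus_leq ?_ (oplus_leq_oplus ?_ (leq_refl _)))
      · exact leq_forces_trans (leq_plus _ _).1 (leq_plus _ _).1
      · exact (leq_plus _ _).2
    · rw [inf_forces_iff]
      refine ⟨e_intro (B.O Γ) ?_ ?_, by simpa using all_mset L⟩
      · rw [Category.id_comp]; exact wb_leq h (leq_plus _ _).2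
      · rw [Category.id_comp]; exact hθ.zero
  refine some_forces_elim h1 fun f m h2 => ?_
  simp at h2
  rw [comp_app]
  refine hθ.lower f _ m ?_ h2.2
  exact wb_leq h2.1 (oplus_leq (leq_refl _) (zero_leq _))

end Polynomials

/-! ### The object presented by an abstract basis -/

section Spectrum

variable {S : Type u} [Category.{v} S] [CartesianMonoidalCategory S] [Model S]
  {B : AbstractBasis S} {Γ Δ X : S}

open OvertDiscrete

variable (B) in
/-- The rounded ideal `λ n. ∃ L. n ≪ ΣΠ L ∧ ∀ l ∈ L. Φ (λ n. n ∈ l)`, as a function of `Φ`. -/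
noncomputable def idealOf : pow (pow B.N) ⟶ (pow B.N : S) :=
  lam (B.od.list.list.overt.some (wb (fst _ _ ≫ snd _ _) (poly (snd _ _)) ⊓
    allOn (A := B.od) (fst _ _ ≫ fst _ _) (snd _ _)))

variable (B) in
/-- The function `λ ξ. ∃ n. θ n ∧ ξ n`, as a function of `θ`. -/
noncomputable def meets : pow B.N ⟶ (pow (pow B.N) : S) :=
  lam (B.overt.some (app (fst _ _ ≫ fst _ _) (snd _ _) ⊓ app (fst _ _ ≫ snd _ _) (snd _ _)))

theorem idealOf_intro {Φ : Γ ⟶ pow (pow B.N)} {n : Γ ⟶ B.N} (L : Γ ⟶ B.od.list.list.obj)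
    (h : wb n (poly L) = ⊤) (h' : allOn (A := B.od) Φ L = ⊤) : app (Φ ≫ idealOf B) n = ⊤ := by
  rw [idealOf, app_comp_lam]
  refine comp_some_forces_intro _ _ L ?_
  simp only [wb, comp_inf, comp_rel, lift_fst_assoc, lift_snd, comp_poly, inf_forces_iff,
    comp_allOn, lift_fst]
  exact ⟨h, h'⟩

theorem idealOf_elim {Φ : Γ ⟶ pow (pow B.N)} {n : Γ ⟶ B.N} {τ : Γ ⟶ (Sig : S)}
    (h : app (Φ ≫ idealOf B) n = ⊤)
    (k : ∀ {Δ : S} (f : Δ ⟶ Γ) (L : Δ ⟶ B.od.list.list.obj), wb (f ≫ n) (poly L) = ⊤ →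
      allOn (A := B.od) (f ≫ Φ) L = ⊤ → f ≫ τ = ⊤) : τ = ⊤ := by
  rw [idealOf, app_comp_lam, comp_some] at h
  refine some_forces_elim h fun f L e => ?_
  simp at e
  exact k f L e.1 e.2

theorem app_meets (θ : Γ ⟶ pow B.N) (ξ : Γ ⟶ pow B.N) : app (θ ≫ meets B) ξ =
    B.overt.some (app (fst _ _ ≫ θ) (snd _ _) ⊓ app (fst _ _ ≫ ξ) (snd _ _)) := by
  simp [meets]

theorem meets_intro {θ ξ : Γ ⟶ pow B.N} (n : Γ ⟶ B.N) (h : app θ n = ⊤) (h' : app ξ n = ⊤) :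
    app (θ ≫ meets B) ξ = ⊤ := by
  rw [app_meets]
  refine some_forces_intro _ n ?_
  simp [h, h']

theorem meets_elim {θ ξ : Γ ⟶ pow B.N} {τ : Γ ⟶ (Sig : S)} (h : app (θ ≫ meets B) ξ = ⊤)
    (k : ∀ {Δ : S} (f : Δ ⟶ Γ) (n : Δ ⟶ B.N), app (f ≫ θ) n = ⊤ → app (f ≫ ξ) n = ⊤ →
      f ≫ τ = ⊤) : τ = ⊤ := by
  rw [app_meets] at h
  refine some_forces_elim h fun f n e => ?_
  simp at e
  exact k f n e.1 e.2

theorem isRoundedIdeal_idealOf (Φ : Γ ⟶ pow (pow B.N)) : IsRoundedIdeal (Φ ≫ idealOf B) where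
  zero := idealOf_intro (B.od.list.nil Γ) (zero_wb' _) (by simp)
  add f n m h h' := by
    rw [← Category.assoc] at h h' ⊢
    refine idealOf_elim h fun g L h1 h2 => ?_
    have h' := forces_comp g h'
    rw [comp_app, ← Category.assoc] at h' ⊢
    refine idealOf_elim h' fun g' M h3 h4 => ?_
    rw [comp_app, ← Category.assoc]
    refine idealOf_intro (append (g' ≫ L) M) ?_ ?_
    · rw [comp_oplus, comp_oplus]
      refine oplus_wb (wb_leq ?_ (poly_append_leq _ _).1) (wb_leq h3 (poly_append_leq _ _).2)
      simpa using forces_comp g' h1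
    · rw [allOn_append, inf_forces_iff]
      exact ⟨by simpa using forces_comp g' h2, h4⟩
  lower f n m h h' := by
    rw [← Category.assoc] at h' ⊢
    refine idealOf_elim h' fun g L h1 h2 => ?_
    rw [comp_app, ← Category.assoc]
    exact idealOf_intro L (wb_forces_trans (by simpa using forces_comp g h) h1) h2
  round f n h := by
    rw [← Category.assoc] at h ⊢
    refine idealOf_elim h fun g L h1 h2 => ?_
    refine wb_forces_elim h1 fun g' m h3 h4 => ?_
    rw [← Category.assoc]
    refine comp_some_forces_intro _ _ m ?_
    simp only [wb, comp_inf, comp_rel, lift_fst_assoc, lift_snd, comp_app, inf_forces_iff]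
    refine ⟨by simpa using h3, ?_⟩
    have := idealOf_intro (Φ := g' ≫ g ≫ f ≫ Φ) (n := m) (g' ≫ L) (by simpa using h4)
      (by simpa using forces_comp g' h2)
    simpa using this

theorem leq_idealOf {Φ : Γ ⟶ pow (pow B.N)} {n m : Γ ⟶ B.N} (h : leq n m = ⊤)
    (h' : app (Φ ≫ idealOf B) m = ⊤) : app (Φ ≫ idealOf B) n = ⊤ := by
  refine idealOf_elim h' fun g L h1 h2 => ?_
  rw [comp_app, ← Category.assoc]
  refine idealOf_intro L (leq_wb ?_ h1) h2
  simpa [leq] using forces_comp g h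

/-- A rounded ideal `θ` is recovered from the functional `λ ξ. ∃ n. θ n ∧ ξ n`. -/
theorem IsRoundedIdeal.meets_idealOf {θ : Γ ⟶ pow B.N} (hθ : IsRoundedIdeal θ) :
    θ ≫ meets B ≫ idealOf B = θ := by
  refine pow_ext fun f n => forces_ext fun {Δ'} g => ?_
  simp only [comp_app, ← Category.assoc]
  generalize g ≫ n = n
  have hθ := hθ.comp (g ≫ f)
  generalize (g ≫ f) ≫ θ = θ at hθ
  refine ⟨fun e => ?_, fun e => ?_⟩
  · refine idealOf_elim e fun g L h1 h2 => ?_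
    rw [comp_app]
    refine (hθ.comp g).of_wb_poly h1 fun g' l m h3 h4 => ?_
    have h5 := allOn_elim (by simpa using forces_comp g' h2) h3
    rw [← Category.assoc, ← Category.assoc] at h5
    refine meets_elim h5 fun g3 n' h6 h7 => ?_
    rw [comp_app]
    have h8 := hθ.lower (g3 ≫ g' ≫ g) (g3 ≫ m) n'
      (wb_leq (by simpa using forces_comp g3 h4) (prod_leq (l := g3 ≫ l) (by simpa using h7)))
      (by simpa using h6)
    simpa using h8
  · refine hθ.round_elim e fun g m h1 h2 => ?_
    rw [comp_app, ← Category.assoc]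
    refine idealOf_intro (cons (cons (A := B.od) m (B.od.nil _)) (B.od.list.nil _)) ?_ ?_
    · exact wb_leq h1 (leq_forces_trans (leq_prod_singleton m) (leq_poly_singleton _))
    · simp only [allOn_cons, allOn_nil, inf_top_eq]
      rw [← Category.assoc]
      exact meets_intro m h2 (by rw [app_mset (A := B.od)]; exact memb_cons_self (A := B.od) _ _)

/-- The product of the members of a list of polynomials. -/
noncomputable def starAll (T : Γ ⟶ B.od.list.list.list.obj) : Γ ⟶ B.od.list.list.obj :=
  lift (toUnit Γ) T ≫ B.od.list.list.fold (B.od.unit _)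
    (OvertDiscrete.star (snd _ _ ≫ fst _ _) (snd _ _ ≫ snd _ _))

@[simp]
theorem comp_starAll (f : Δ ⟶ Γ) (T : Γ ⟶ B.od.list.list.list.obj) :
    f ≫ starAll T = starAll (f ≫ T) := by
  simp [starAll, comp_lift_assoc]

@[simp]
theorem starAll_nil : starAll (B.od.list.list.nil Γ) = B.od.unit Γ := by
  simp [starAll, fold_nil]

@[simp]
theorem starAll_cons (M : Γ ⟶ B.od.list.list.obj) (T : Γ ⟶ B.od.list.list.list.obj) :
    starAll (cons M T) = OvertDiscrete.star M (starAll T) := by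
  simp [starAll, fold_cons]

theorem anyAll_starAll {ξ : Γ ⟶ pow B.N} {T : Γ ⟶ B.od.list.list.list.obj}
    (h : anyAll (A := B.od) ξ (starAll T) = ⊤) {M : Γ ⟶ B.od.list.list.obj}
    (hM : memb M T = ⊤) : anyAll (A := B.od) ξ M = ⊤ := by
  have := B.od.list.list.term_ext (P := Γ) (fun f T => anyAll (A := B.od) (f ≫ ξ) (starAll T))
    (fun f T => all (lam (anyAll (A := B.od) (fst _ _ ≫ f ≫ ξ) (snd _ _))) T)
    (fun f M _ x => anyAll (A := B.od) (f ≫ ξ) M ⊓ x)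
    (by simp) (by simp [comp_lam]) (by simp) (by simp) (by simp) (by simp) (𝟙 Γ) T
  simp only [Category.id_comp] at this
  rw [h] at this
  simpa using all_elim this.symm hM

/-- An element way below an element that is way below each of finitely many polynomials is way
below their product. -/
theorem wb_poly_starAll {n k : Γ ⟶ B.N} (h : wb n k = ⊤) {T : Γ ⟶ B.od.list.list.list.obj}
    (hT : all (lam (wb (B := B.toBasisData) (fst _ _ ≫ k) (poly (snd _ _)))) T = ⊤) :
    wb n (poly (starAll T)) = ⊤ := by
  let b : ∀ {Δ : S}, (Δ ⟶ Γ) → (Δ ⟶ B.od.list.list.list.obj) → (Δ ⟶ (Sig : S)) := fun f T =>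
    B.overt.some (wb (fst _ _ ≫ f ≫ n) (snd _ _) ⊓ wb (snd _ _) (fst _ _ ≫ f ≫ k) ⊓
      wb (snd _ _) (fst _ _ ≫ poly (starAll T)))
  have b_intro : ∀ {Δ : S} {f : Δ ⟶ Γ} {T : Δ ⟶ B.od.list.list.list.obj} (m : Δ ⟶ B.N),
      wb (f ≫ n) m = ⊤ → wb m (f ≫ k) = ⊤ → wb m (poly (starAll T)) = ⊤ → b f T = ⊤ :=
    fun m h1 h2 h3 => some_forces_intro _ m (by simp; exact ⟨⟨h1, h2⟩, h3⟩)
  have b_comp : ∀ {Δ Δ' : S} (g : Δ' ⟶ Δ) (f : Δ ⟶ Γ) (T : Δ ⟶ B.od.list.list.list.obj),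
      g ≫ b f T = b (g ≫ f) (g ≫ T) := fun g f T => by simp [b]
  have h1 : b (𝟙 Γ) T = ⊤ := by
    refine B.od.list.list.induction_of_tail (P := Γ)
      (fun f T => all (f ≫ lam (wb (B := B.toBasisData) (fst _ _ ≫ k) (poly (snd _ _)))) T) b
      (by simp) b_comp (fun f _ => ?_) (fun f M T e => ?_) (fun f M T e e' => ?_) (𝟙 Γ) T
      (by simpa using hT)
    · refine wb_forces_elim (by simpa using forces_comp f h : wb (f ≫ n) (f ≫ k) = ⊤)
        fun {Δ'} g m e e' => ?_
      rw [b_comp]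
      refine b_intro m (by simpa using e) (by simpa using e') ?_
      refine wb_leq e' (leq_forces_trans (leq_bone _) ?_)
      have := leq_poly_singleton (B.od.nil Δ')
      rw [prod_nil] at this
      simpa [unit] using this
    · rw [all_cons, inf_forces_iff] at e; exact e.2
    · rw [all_cons, inf_forces_iff, app_comp_lam] at e
      refine some_forces_elim e' fun g m e' => ?_
      simp only [wb, comp_inf, comp_rel, lift_fst_assoc, lift_snd, comp_starAll, comp_poly,
        inf_forces_iff] at e' e
      obtain ⟨⟨h1, h2⟩, h3⟩ := e'
      refine wb_forces_elim h1 fun g' m' h4 h5 => ?_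
      rw [b_comp, b_comp]
      have h2 := forces_comp g' h2
      have h3 := forces_comp g' h3
      have h6 := forces_comp (g' ≫ g) e.1
      simp only [comp_rel, comp_poly, comp_starAll, Category.assoc] at h2 h3 h6
      refine b_intro m' (by simpa using h4) (wb_forces_trans h5 (by simpa using h2)) ?_
      rw [comp_cons, comp_cons, starAll_cons]
      exact wb_leq (wb_ostar h5 (wb_forces_trans h2 h6) h3) (ostar_poly_leq _ _)
  refine some_forces_elim h1 fun f m e => ?_
  simp at e
  simpa using wb_forces_trans e.1.1 e.2

end Spectrum

section Spectrum

variable {S : Type u} [Category.{v} S] [CartesianMonoidalCategory S] [Model S]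
  {B : AbstractBasis S} {Γ Δ X : S}

open OvertDiscrete

theorem lam_app_comp {Y Z : S} (t : Y ⟶ Z) (F : Γ ⟶ pow Z) :
    lam (app (fst _ _ ≫ F) (snd _ _ ≫ t)) = F ≫ powMap t :=
  pow_ext fun f a => by simp

theorem meets_idealOf_intro {Φ : Γ ⟶ pow (pow B.N)} {l : Γ ⟶ B.od.list.obj} {k : Γ ⟶ B.N}
    (h : wb k (prod l) = ⊤) (h' : app Φ (mset (A := B.od) l) = ⊤) :
    app (Φ ≫ idealOf B ≫ meets B)
      (mset (A := B.od) (cons (A := B.od) k (B.od.nil Γ))) = ⊤ := by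
  rw [← Category.assoc]
  refine meets_intro k (idealOf_intro (cons l (B.od.list.nil _))
    (wb_leq h (leq_poly_singleton _)) ?_) ?_
  · simp only [allOn_cons, allOn_nil, inf_top_eq]; exact h'
  · rw [app_mset (A := B.od)]; exact memb_cons_self (A := B.od) _ _

/-- A functional that holds at every `Φ` that covers something above `k` holds, by the Scott
principle, at every `Φ` that covers one of a finite list of polynomials way above `k`; their
product is then a cover of `n ≪ k`. -/
theorem idealOf_of_functional {F : Γ ⟶ pow (pow (pow (pow B.N)))} {n k : Γ ⟶ B.N}
    (h : wb n k = ⊤) (hF : app F (k ≫ point B.N ≫ powMap (idealOf B)) = ⊤) :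
    app (lam (app (fst _ _ ≫ F) (snd _ _ ≫ point (pow B.N))) ≫ idealOf B) n = ⊤ := by
  -- `λ Φ. ∃ M. T M ∧ ∀ l ∈ M. Φ (λ n. n ∈ l)`
  let c : pow B.od.list.list.obj ⟶ pow (pow (pow B.N)) := lam (B.od.list.list.overt.some
    (app (fst _ _ ≫ fst _ _) (snd _ _) ⊓ allOn (A := B.od) (fst _ _ ≫ snd _ _) (snd _ _)))
  have hc : ∀ {Δ : S} (T : Δ ⟶ pow B.od.list.list.obj) (Φ : Δ ⟶ pow (pow B.N)),
      app (T ≫ c) Φ = B.od.list.list.overt.some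
        (app (fst _ _ ≫ T) (snd _ _) ⊓ allOn (A := B.od) (fst _ _ ≫ Φ) (snd _ _)) := by
    intro Δ T Φ; simp [c]
  have h1 : app (lam (app (fst _ _ ≫ F) (snd _ _ ≫ c)))
      (lam (wb (B := B.toBasisData) (fst _ _ ≫ k) (poly (snd _ B.od.list.list.obj)))) = ⊤ := by
    rw [app_lam_id]
    simp only [comp_app, lift_fst_assoc, lift_snd_assoc, Category.id_comp]
    refine app_mono hF fun f Φ e => ?_
    rw [← Category.assoc, comp_point_powMap] at e
    refine idealOf_elim e fun g M h2 h3 => ?_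
    rw [comp_app, ← Category.assoc, ← Category.assoc, hc]
    refine some_forces_intro _ M ?_
    simp
    refine ⟨by simpa using h2, h3⟩
  refine scott_elim h1 fun f T h2 h3 => ?_
  rw [comp_app, ← Category.assoc]
  refine idealOf_intro (starAll T) (wb_poly_starAll (k := f ≫ k) (by simpa using forces_comp f h)
    (by simpa [comp_lam] using h3)) (allOn_intro fun {Δ'} g l e => ?_)
  have h2 := forces_comp g h2
  simp only [comp_app, app_comp_comp_lam, lift_fst_assoc, lift_snd_assoc] at h2 ⊢
  refine app_mono h2 fun g' Φ h4 => ?_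
  rw [← Category.assoc, hc] at h4
  refine some_forces_elim h4 fun g3 M h5 => ?_
  simp only [comp_inf, comp_allOn, lift_fst_assoc, lift_snd, comp_mset, app_mset,
    inf_forces_iff] at h5
  have h6 : anyAll (A := B.od) (mset (g3 ≫ g' ≫ l)) (starAll (g3 ≫ g' ≫ g ≫ T)) = ⊤ := by
    have := allOn_elim (allOn_self (starAll (g ≫ T))) (by simpa using e)
    simpa using forces_comp (g3 ≫ g') this
  have h7 := allOn_cut h5.2 (anyAll_starAll h6 (by simpa using h5.1))
  simpa using h7

variable (B) in
theorem isNucleus_idealOf_meets : IsNucleus (idealOf B ≫ meets B) := by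
  intro Γ F
  rw [lam_app_comp, lam_app_comp, ← Category.assoc, ← Category.assoc]
  congr 1
  refine pow_ext fun f n => forces_ext fun {Δ'} g => ?_
  have e1 : ∀ H : pow (pow (pow (pow B.N))) ⟶ pow (pow B.N),
      g ≫ app (f ≫ (F ≫ H) ≫ idealOf B) n = app (((g ≫ f ≫ F) ≫ H) ≫ idealOf B) (g ≫ n) := by
    simp
  rw [e1, e1]
  generalize g ≫ n = n
  generalize g ≫ f ≫ F = F
  refine ⟨fun e => ?_, fun e => ?_⟩
  · refine idealOf_elim e fun {Δ2} g2 L h1 h2 => ?_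
    rw [comp_app]
    refine ((isRoundedIdeal_idealOf _).comp g2).of_wb_poly h1 fun {Δ3} g3 l m h3 h4 => ?_
    have h5 := forces_comp g3 h2
    rw [comp_allOn] at h5
    have h5 := allOn_elim h5 h3
    refine wb_forces_elim h4 fun {Δ4} g4 k h6 h7 => ?_
    have := idealOf_intro (Φ := (g4 ≫ g3 ≫ g2 ≫ F) ≫
      powMap (point (pow B.N) ≫ powMap (idealOf B ≫ meets B))) (n := g4 ≫ m)
      (cons (cons (A := B.od) k (B.od.nil _)) (B.od.list.nil _)) ?_ ?_
    · simpa using this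
    · exact wb_leq h6 (leq_forces_trans (leq_prod_singleton k) (leq_poly_singleton _))
    · simp only [allOn_cons, allOn_nil, inf_top_eq, app_powMap]
      rw [← Category.assoc g2, ← Category.assoc g3, app_powMap] at h5
      have h5 := forces_comp g4 h5
      rw [comp_app] at h5
      refine app_mono h5 fun g5 Φ h8 => ?_
      simp only [← Category.assoc, app_point] at h8
      rw [← Category.assoc g5, comp_point_powMap, comp_mset, comp_cons, comp_nil]
      exact meets_idealOf_intro (l := g5 ≫ g4 ≫ l) (by simpa using forces_comp g5 h7)
        (by simpa using h8)
  · refine idealOf_elim e fun {Δ2} g2 L h1 h2 => ?_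
    rw [comp_app]
    refine ((isRoundedIdeal_idealOf _).comp g2).of_wb_poly h1 fun g3 l m h3 h4 => ?_
    have h5 := forces_comp g3 h2
    rw [comp_allOn] at h5
    have h5 := allOn_elim h5 h3
    refine wb_forces_elim h4 fun g4 k h6 h7 => ?_
    have := idealOf_of_functional (F := g4 ≫ g3 ≫ g2 ≫ F) h6 ?_
    · rw [lam_app_comp] at this
      simpa using this
    · rw [← Category.assoc g2, ← Category.assoc g3, app_powMap] at h5
      have h5 := forces_comp g4 h5
      rw [comp_app] at h5
      refine app_mono h5 fun g5 Φ h8 => ?_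
      rw [← Category.assoc g4, ← Category.assoc g5, comp_point_powMap, ← Category.assoc] at h8
      rw [← Category.assoc g5, comp_point_powMap]
      refine meets_elim h8 fun g6 n' h9 h10 => ?_
      rw [comp_app, ← Category.assoc]
      have h11 : wb (g6 ≫ g5 ≫ k) n' = ⊤ :=
        wb_leq (by simpa using forces_comp (g6 ≫ g5) h7)
          (prod_leq (l := g6 ≫ g5 ≫ g4 ≫ l) (by simpa using h10))
      simpa using (isRoundedIdeal_idealOf Φ).lower g6 _ _ h11 (by simpa using h9)

/-- The ideal of a functional `Φ` is principal, generated by `p`, if some polynomial above `p`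
is covered by `Φ` and conversely `p` bounds the product of each list at which `Φ` holds. -/
theorem idealOf_eq_wb {Φ : Γ ⟶ pow (pow B.N)} {p : Γ ⟶ B.N} (L : Γ ⟶ B.od.list.list.obj)
    (h : leq p (poly L) = ⊤) (h' : allOn (A := B.od) Φ L = ⊤)
    (k : ∀ {Δ : S} (f : Δ ⟶ Γ) (l : Δ ⟶ B.od.list.obj),
      app (f ≫ Φ) (mset (A := B.od) l) = ⊤ → leq (prod l) (f ≫ p) = ⊤) (n : Γ ⟶ B.N) :
    app (Φ ≫ idealOf B) n = wb n p := by
  refine forces_ext fun f => ⟨fun e => ?_, fun e => ?_⟩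
  · rw [comp_app, ← Category.assoc] at e
    refine idealOf_elim e fun g L' h1 h2 => ?_
    rw [comp_rel, comp_rel]
    refine wb_leq h1 (poly_leq fun g' l h3 => ?_)
    have h4 := forces_comp g' h2
    rw [comp_allOn] at h4
    simpa using k (g' ≫ g ≫ f) l (by simpa using allOn_elim h4 h3)
  · rw [comp_app, ← Category.assoc]
    refine idealOf_intro (f ≫ L) ?_ (by simpa using forces_comp f h')
    exact wb_leq (by simpa using e) (by simpa [leq] using forces_comp f h)

theorem idealOf_point (p n : Γ ⟶ B.N) : app ((p ≫ point B.N) ≫ idealOf B) n = wb n p := by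
  refine idealOf_eq_wb (cons (cons (A := B.od) p (B.od.nil _)) (B.od.list.nil _))
    (leq_forces_trans (leq_prod_singleton p) (leq_poly_singleton _)) ?_ (fun f l e => ?_) n
  · simp [B.discrete.eqv_self]
  · exact prod_leq (by simpa using e)

theorem idealOf_sup (p q n : Γ ⟶ B.N) :
    app (psup (p ≫ point B.N) (q ≫ point B.N) ≫ idealOf B) n = wb n (oplus p q) := by
  refine idealOf_eq_wb (cons (cons (A := B.od) p (B.od.nil _))
    (cons (cons (A := B.od) q (B.od.nil _)) (B.od.list.nil _))) ?_ ?_ (fun f l e => ?_) n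
  · rw [poly_cons]
    exact oplus_leq_oplus (leq_prod_singleton p)
      (leq_forces_trans (leq_prod_singleton q) (leq_poly_singleton _))
  · simp [B.discrete.eqv_self]
  · simp only [comp_psup, app_psup, ← Category.assoc, app_point, app_mset] at e
    refine sup_forces_elim e (fun g h => ?_) (fun g h => ?_)
    · rw [comp_rel, comp_prod, comp_oplus, comp_oplus]
      exact leq_forces_trans (prod_leq (by simpa using h)) (leq_plus _ _).1
    · rw [comp_rel, comp_prod, comp_oplus, comp_oplus]
      exact leq_forces_trans (prod_leq (by simpa using h)) (leq_plus _ _).2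

theorem idealOf_inf (p q n : Γ ⟶ B.N) :
    app (pinf (p ≫ point B.N) (q ≫ point B.N) ≫ idealOf B) n = wb n (ostar p q) := by
  refine idealOf_eq_wb (cons (cons (A := B.od) p (cons (A := B.od) q (B.od.nil _)))
    (B.od.list.nil _)) ?_ ?_ (fun f l e => ?_) n
  · refine leq_forces_trans ?_ (leq_poly_singleton _)
    rw [prod_cons]
    exact ostar_leq_ostar (leq_refl _) (leq_prod_singleton q)
  · simp [B.discrete.eqv_self]
  · simp at e
    rw [comp_ostar]
    exact leq_ostar (prod_leq e.1) (prod_leq e.2)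

theorem idealOf_bot (n : Γ ⟶ B.N) : app (pconst (pow B.N) ⊥ ≫ idealOf B) n = wb n (B.O Γ) := by
  refine idealOf_eq_wb (B.od.list.nil _) (zero_leq _) (by simp) (fun f l e => ?_) n
  rw [comp_pconst, app_pconst, comp_bot] at e
  exact top_le_iff.1 (e.ge.trans bot_le)

theorem idealOf_top (n : Γ ⟶ B.N) : app (pconst (pow B.N) ⊤ ≫ idealOf B) n = wb n (B.I Γ) := by
  refine idealOf_eq_wb (B.od.unit _) ?_ (by simp [unit]) (fun f l e => ?_) n
  · have := leq_poly_singleton (B.od.nil Γ)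
    rwa [prod_nil] at this
  · rw [comp_bone]; exact leq_bone _

/-- Every abstract basis presents an object, namely the subspace of `Σ^N` cut out by the nucleus
that rounded ideals generate. -/
theorem exists_presentation (B : AbstractBasis S) :
    ∃ X : S, Nonempty (Presentation B.toBasisData X) := by
  obtain ⟨X, i, I, h⟩ := Model.subspace _ (isNucleus_idealOf_meets B)
  -- points of `X` are admissible
  have adm : ∀ {Γ : S} (Φ : Γ ⟶ pow (pow B.N)) (x : Γ ⟶ X),
      app Φ (x ≫ i) = app (Φ ≫ idealOf B ≫ meets B) (x ≫ i) := fun Φ x => by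
    rw [← h.nucleus, ← app_powMap i, ← app_powMap i, Category.assoc, Category.assoc, h.split,
      Category.comp_id]
  have adm_some : ∀ {Γ : S} (Φ : Γ ⟶ pow (pow B.N)) (x : Γ ⟶ X), app Φ (x ≫ i) =
      B.overt.some (app (fst _ _ ≫ Φ ≫ idealOf B) (snd _ _) ⊓
        app (fst _ _ ≫ x ≫ i) (snd _ _)) := fun Φ x => by
    rw [adm, ← Category.assoc, app_meets]
  have adm_wb : ∀ {Γ : S} (p : Γ ⟶ B.N) (Φ : Γ ⟶ pow (pow B.N)) (x : Γ ⟶ X),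
      (∀ {Δ : S} (f : Δ ⟶ Γ) (n : Δ ⟶ B.N), app ((f ≫ Φ) ≫ idealOf B) n = wb n (f ≫ p)) →
      app (x ≫ i) p = app Φ (x ≫ i) := fun p Φ x hΦ => by
    rw [adm_some Φ, ← app_point, adm_some]
    congr 2
    have h1 := hΦ (fst _ B.N) (snd _ _)
    have h2 := idealOf_point (fst _ B.N ≫ p) (snd _ _)
    simp only [Category.assoc] at h1 h2 ⊢
    rw [h1, h2]
  have meets_ideal : ∀ {Γ : S} (Φ : Γ ⟶ pow (pow B.N)),
      Φ ≫ idealOf B ≫ meets B ≫ idealOf B = Φ ≫ idealOf B := fun Φ => by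
    have := (isRoundedIdeal_idealOf Φ).meets_idealOf
    simpa using this
  refine ⟨X, ⟨{
    β := point B.N ≫ powMap i
    A := lam (app (snd _ _ ≫ I ≫ idealOf B) (fst _ _))
    β_zero := fun x => ?_
    β_one := fun x => ?_
    β_plus := fun n m x => ?_
    β_star := fun n m x => ?_
    A_zero := fun φ => ?_
    A_plus := fun n m φ => ?_
    expand := fun φ x => ?_
    wb_eq := fun n m => ?_ }⟩⟩
  · rw [← Category.assoc, app_powMap, app_point, adm_wb _ (pconst _ ⊥)]
    · simp
    · intro Δ f n; rw [comp_pconst, comp_bot, idealOf_bot, comp_bzero]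
  · rw [← Category.assoc, app_powMap, app_point, adm_wb _ (pconst _ ⊤)]
    · simp
    · intro Δ f n; rw [comp_pconst, comp_top, idealOf_top, comp_bone]
  · rw [← Category.assoc, app_powMap, app_point,
      adm_wb _ (psup (n ≫ point _) (m ≫ point _))]
    · simp
    · intro Δ f k
      rw [comp_psup, ← Category.assoc, ← Category.assoc, idealOf_sup, comp_oplus]
  · rw [← Category.assoc, app_powMap, app_point,
      adm_wb _ (pinf (n ≫ point _) (m ≫ point _))]
    · simp
    · intro Δ f k
      rw [comp_pinf, ← Category.assoc, ← Category.assoc, idealOf_inf, comp_ostar]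
  · simpa using (isRoundedIdeal_idealOf (φ ≫ I)).zero
  · simp only [app_comp_lam, comp_app, lift_fst, lift_snd_assoc]
    have hJ := isRoundedIdeal_idealOf (φ ≫ I)
    simp only [Category.assoc] at hJ
    refine forces_ext fun f => ⟨fun e => ?_, fun e => ?_⟩
    · have e1 : app ((f ≫ φ ≫ I) ≫ idealOf B) (oplus (f ≫ n) (f ≫ m)) = ⊤ := by simpa using e
      have h1 := leq_idealOf (leq_plus _ _).1 e1
      have h2 := leq_idealOf (leq_plus _ _).2 e1
      simp at h1 h2 ⊢
      exact ⟨h1, h2⟩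
    · simp at e ⊢
      exact hJ.add f _ _ e.1 e.2
  · have e1 : app φ x = app (φ ≫ I) (x ≫ i) := by
      rw [← app_powMap, Category.assoc, h.split, Category.comp_id]
    rw [e1, adm_some]
    simp
  · have e1 : powMap i ≫ I ≫ idealOf B = idealOf B := by
      rw [← Category.assoc, h.nucleus]
      simpa using meets_ideal (𝟙 _)
    rw [← idealOf_point]
    simp only [app_comp_lam, comp_app, lift_fst, lift_snd_assoc, Category.assoc, e1]

end Spectrum

/-! ### Second class maps and their matrices -/

section Matrices

variable {S : Type u} [Category.{v} S] [CartesianMonoidalCategory S] [Model S]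
  {B C D : AbstractBasis S} {Γ Δ X Y Z : S}

namespace Presentation

theorem app_eq_some {B : BasisData S} (p : Presentation B X) (Φ : Γ ⟶ pow (pow X))
    (φ : Γ ⟶ pow X) : app Φ φ =
      B.overt.some (app (snd _ _ ≫ p.A) (fst _ _ ≫ φ) ⊓ app (fst _ _ ≫ Φ) (snd _ _ ≫ p.β)) := by
  refine forces_ext fun f => ⟨fun e => ?_, fun e => ?_⟩
  · rw [comp_app] at e
    refine p.app_elim e fun g n h1 h2 => ?_
    rw [← Category.assoc]
    refine comp_some_forces_intro _ _ n ?_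
    simp at h1 h2 ⊢
    exact ⟨h1, h2⟩
  · rw [comp_some] at e
    refine some_forces_elim e fun g n e => ?_
    simp at e ⊢
    exact p.app_intro n e.1 e.2

variable (p : Presentation B.toBasisData X) (q : Presentation C.toBasisData Y)
  (r : Presentation D.toBasisData Z)

/-- The matrix `A n (H (γ m))` of a second class map `H`. -/
def matrix (H : (pow Y : S) ⟶ pow X) : B.N ⊗ C.N ⟶ (Sig : S) :=
  app (fst _ _ ≫ p.A) (snd _ _ ≫ q.β ≫ H)

@[simp]
theorem rel_matrix (H : (pow Y : S) ⟶ pow X) (n : Γ ⟶ B.N) (m : Γ ⟶ C.N) :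
    rel (p.matrix q H) n m = app (n ≫ p.A) (m ≫ q.β ≫ H) := by
  simp [rel, matrix]

theorem isSecondClassMatrix_matrix (H : (pow Y : S) ⟶ pow X) :
    IsSecondClassMatrix B C (p.matrix q H) where
  zero k := by rw [rel_matrix, p.A_zero]
  plus n m k := by rw [rel_matrix, rel_matrix, rel_matrix, p.A_plus]
  round_left n m := by
    have e := @p.wb_eq
    simp only [wb] at e
    rw [rel_matrix, p.app_eq_some]
    simp only [wb, rel_matrix, e, Category.assoc]
    rw [inf_comm]
  round_right n m := by
    have e := @q.wb_eq
    simp only [wb] at e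
    have := q.app_eq_some (n ≫ p.A ≫ powMap H) (m ≫ q.β)
    simp only [app_powMap_assoc, Category.assoc] at this
    rw [rel_matrix, this]
    simp only [wb, rel_matrix, e, Category.assoc]
    rw [inf_comm]
    simp [← Category.assoc]

theorem matrix_id : p.matrix p (𝟙 _) = B.waybelow := by
  have := p.wb_eq (fst _ _) (snd _ _)
  simp [rel] at this
  simp [matrix, this]

theorem matrix_comp (F : (pow Y : S) ⟶ pow X) (G : (pow Z : S) ⟶ pow Y) :
    p.matrix r (G ≫ F) = relComp C.overt (p.matrix q F) (q.matrix r G) := by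
  have := q.app_eq_some (fst B.N D.N ≫ p.A ≫ powMap F) (snd B.N D.N ≫ r.β ≫ G)
  simp only [app_powMap_assoc, Category.assoc] at this
  rw [matrix, relComp, this]
  simp only [rel_matrix, Category.assoc]
  rw [inf_comm]
  simp [← Category.assoc]

/-- The second class map `φ ↦ λ x. ∃ n m. C m φ ∧ ρ n m ∧ β n x` with a given matrix. -/
def ofMatrix (ρ : B.N ⊗ C.N ⟶ (Sig : S)) : (pow Y : S) ⟶ pow X :=
  lam (B.overt.some (C.overt.some
    (app (snd _ _ ≫ q.A) (fst _ _ ≫ fst _ _ ≫ fst _ _) ⊓ rel ρ (fst _ _ ≫ snd _ _) (snd _ _) ⊓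
      app (fst _ _ ≫ snd _ _ ≫ p.β) (fst _ _ ≫ fst _ _ ≫ snd _ _))))

theorem ofMatrix_intro {ρ : B.N ⊗ C.N ⟶ (Sig : S)} {φ : Γ ⟶ pow Y} {x : Γ ⟶ X}
    (n : Γ ⟶ B.N) (m : Γ ⟶ C.N) (h1 : app (m ≫ q.A) φ = ⊤) (h2 : rel ρ n m = ⊤)
    (h3 : app (n ≫ p.β) x = ⊤) : app (φ ≫ p.ofMatrix q ρ) x = ⊤ := by
  rw [ofMatrix, app_comp_lam, comp_some, comp_some]
  refine some_some_forces_intro _ _ n m ?_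
  simp only [comp_inf, comp_app, comp_rel, inf_forces_iff]
  simp [h1, h2, h3]

theorem ofMatrix_elim {ρ : B.N ⊗ C.N ⟶ (Sig : S)} {φ : Γ ⟶ pow Y} {x : Γ ⟶ X}
    {τ : Γ ⟶ (Sig : S)} (h : app (φ ≫ p.ofMatrix q ρ) x = ⊤)
    (k : ∀ {Δ : S} (f : Δ ⟶ Γ) (n : Δ ⟶ B.N) (m : Δ ⟶ C.N), app (m ≫ q.A) (f ≫ φ) = ⊤ →
      rel ρ n m = ⊤ → app (n ≫ p.β) (f ≫ x) = ⊤ → f ≫ τ = ⊤) : τ = ⊤ := by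
  rw [ofMatrix, app_comp_lam, comp_some, comp_some] at h
  refine some_some_forces_elim h fun f n m e => ?_
  simp at e
  exact k f n m e.1.1 e.1.2 e.2

theorem ofMatrix_matrix (H : (pow Y : S) ⟶ pow X) : p.ofMatrix q (p.matrix q H) = H := by
  refine pow_ext fun {Δ} φ x => forces_ext fun f => ⟨fun e => ?_, fun e => ?_⟩
  · rw [comp_app, ← Category.assoc] at e
    refine ofMatrix_elim p q e fun g n m h1 h2 h3 => ?_
    rw [rel_matrix] at h2
    have h4 := p.expand_intro n h2 h3
    have h5 := q.app_intro (Φ := (g ≫ f ≫ x) ≫ point X ≫ powMap H) m h1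
      (by rw [comp_point_powMap]; simpa using h4)
    rw [comp_point_powMap] at h5
    simpa using h5
  · rw [comp_app, ← Category.assoc] at e ⊢
    have h5 : app ((f ≫ x) ≫ point X ≫ powMap H) (f ≫ φ) = ⊤ := by
      rw [comp_point_powMap]; exact e
    refine q.app_elim h5 fun g m h1 h2 => ?_
    rw [← Category.assoc, comp_point_powMap, Category.assoc] at h2
    refine p.expand_elim h2 fun g' n h3 h4 => ?_
    have := p.ofMatrix_intro q (ρ := p.matrix q H) (φ := g' ≫ g ≫ f ≫ φ) (x := g' ≫ g ≫ f ≫ x) n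
      (g' ≫ m) (by simpa using forces_comp g' h1) (by simpa using h3) (by simpa using h4)
    simpa using this

theorem matrix_ofMatrix {ρ : B.N ⊗ C.N ⟶ (Sig : S)} (hρ : IsSecondClassMatrix B C ρ) :
    p.matrix q (p.ofMatrix q ρ) = ρ := by
  suffices h : ∀ {Γ : S} (n : Γ ⟶ B.N) (m : Γ ⟶ C.N),
      rel (p.matrix q (p.ofMatrix q ρ)) n m = ⊤ ↔ rel ρ n m = ⊤ by
    refine forces_ext fun f => ?_
    simpa [rel, ← comp_lift] using h (f ≫ fst _ _) (f ≫ snd _ _)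
  have intro_right : ∀ {Γ : S} {n : Γ ⟶ B.N} {m m' : Γ ⟶ C.N}, rel ρ n m' = ⊤ →
      wb m' m = ⊤ → rel ρ n m = ⊤ := fun {Γ} {n m m'} h1 h2 => by
    rw [hρ.round_right]
    exact some_forces_intro _ m' (by simp [h1]; exact h2)
  intro Γ n m
  rw [rel_matrix, ← Category.assoc]
  refine ⟨fun e => ?_, fun e => ?_⟩
  · refine p.isJoinHom.app_elim (lam (rel ρ (snd _ _) (fst _ _ ≫ m))) ?_ ?_ ?_ e ?_
    · intro Δ f x e
      rw [← Category.assoc] at e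
      refine p.ofMatrix_elim q e fun g n' m' h1 h2 h3 => ?_
      refine comp_some_forces_intro _ _ n' ?_
      simp
      refine ⟨intro_right h2 ?_, by simpa using h3⟩
      rw [q.wb_eq]
      simpa using h1
    · simpa [O] using hρ.zero m
    · intro Δ f n1 n2 h1 h2
      simp at h1 h2 ⊢
      have := hρ.plus n1 n2 (f ≫ m)
      rw [h1, h2, top_inf_eq] at this
      exact this.symm
    · intro Δ f n' h1 h2
      simp at h1
      rw [comp_rel, hρ.round_left]
      refine some_forces_intro _ n' ?_
      simp [h1]
      have := p.wb_eq (f ≫ n) n'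
      rw [wb] at this
      rw [this]
      simpa using h2
  · rw [hρ.round_left] at e
    refine some_forces_elim e fun f n' e => ?_
    simp at e
    obtain ⟨h1, h2⟩ := e
    rw [hρ.round_right] at h2
    refine some_forces_elim h2 fun g m' h2 => ?_
    simp at h2
    have h1 := forces_comp g h1
    rw [comp_rel] at h1
    have h3 := p.wb_eq (g ≫ f ≫ n) (g ≫ n')
    rw [wb, h1] at h3
    have := app_mono (ψ := (g ≫ f ≫ m ≫ q.β) ≫ p.ofMatrix q ρ) h3.symm fun g' x e => ?_
    · simpa using this
    · rw [← Category.assoc]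
      refine p.ofMatrix_intro q (g' ≫ g ≫ n') (g' ≫ m') ?_ ?_ (by simpa using e)
      · have := q.wb_eq m' (g ≫ f ≫ m)
        rw [wb, h2.2] at this
        simpa using forces_comp g' this.symm
      · simpa using forces_comp g' h2.1

end Presentation

end Matrices

/-! ### Maps and their matrices -/

section Homomorphisms

variable {S : Type u} [Category.{v} S] [CartesianMonoidalCategory S] [Model S]
  {B C D : AbstractBasis S} {Γ Δ X Y Z : S}

open OvertDiscrete

/-- A predicate on the basis that takes its operations to those of the lattice of propositions. -/
structure IsLatticeHom (ξ : Γ ⟶ pow C.N) : Prop where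
  zero : app ξ (C.O Γ) = ⊥
  one : app ξ (C.I Γ) = ⊤
  add : ∀ {Δ : S} (f : Δ ⟶ Γ) (n m : Δ ⟶ C.N),
    app (f ≫ ξ) (oplus n m) = app (f ≫ ξ) n ⊔ app (f ≫ ξ) m
  mul : ∀ {Δ : S} (f : Δ ⟶ Γ) (n m : Δ ⟶ C.N),
    app (f ≫ ξ) (ostar n m) = app (f ≫ ξ) n ⊓ app (f ≫ ξ) m

theorem IsLatticeHom.comp {ξ : Γ ⟶ pow C.N} (h : IsLatticeHom ξ) (f : Δ ⟶ Γ) :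
    IsLatticeHom (f ≫ ξ) where
  zero := by simpa using congrArg (f ≫ ·) h.zero
  one := by simpa using congrArg (f ≫ ·) h.one
  add g n m := by rw [← Category.assoc]; exact h.add _ n m
  mul g n m := by rw [← Category.assoc]; exact h.mul _ n m

theorem IsLatticeHom.prod {ξ : Γ ⟶ pow C.N} (h : IsLatticeHom ξ) (l : Γ ⟶ C.od.list.obj) :
    app ξ (ASD.prod l) = all (A := C.od) ξ l := by
  have := C.od.term_ext (P := Γ) (fun f l => app (f ≫ ξ) (ASD.prod l))
    (fun f l => all (A := C.od) (f ≫ ξ) l) (fun f n _ x => app (f ≫ ξ) n ⊓ x)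
    (by simp) (by simp) (by simp) (fun f => ?_) (fun f n l => ?_) (by simp) (𝟙 Γ) l
  · simpa using this
  · have := congrArg (f ≫ ·) h.one
    simpa using this
  · rw [prod_cons, h.mul]

theorem IsLatticeHom.poly {ξ : Γ ⟶ pow C.N} (h : IsLatticeHom ξ) (L : Γ ⟶ C.od.list.list.obj) :
    app ξ (ASD.poly L) = anyAll (A := C.od) ξ L := by
  have := C.od.list.term_ext (P := Γ) (fun f L => app (f ≫ ξ) (ASD.poly L))
    (fun f L => anyAll (A := C.od) (f ≫ ξ) L) (fun f l _ x => all (A := C.od) (f ≫ ξ) l ⊔ x)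
    (by simp) (by simp) (by simp) (fun f => ?_) (fun f l L => ?_) (by simp) (𝟙 Γ) L
  · simpa using this
  · have := congrArg (f ≫ ·) h.zero
    simpa using this
  · rw [poly_cons, h.add, (h.comp f).prod]

theorem IsSecondClassMatrix.mono {H : B.N ⊗ C.N ⟶ (Sig : S)} (h : IsSecondClassMatrix B C H)
    (n' n : Γ ⟶ B.N) (m m' : Γ ⟶ C.N) : leq n' n ⊓ rel H n m ⊓ leq m m' ≤ rel H n' m' := by
  refine le_iff_forces.2 fun f e => ?_
  simp only [comp_inf, comp_rel, leq, inf_forces_iff] at e ⊢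
  obtain ⟨⟨h1, h2⟩, h3⟩ := e
  have h4 := top_le_iff.1 (h.mono_right h2.ge h3)
  rw [h.round_left] at h4 ⊢
  refine some_forces_elim h4 fun g k e => ?_
  refine comp_some_forces_intro _ _ k ?_
  simp at e ⊢
  exact ⟨leq_wb (by simpa [leq] using forces_comp g h1) e.1, e.2⟩

namespace Presentation

/-- Functionals of two variables are determined by their values on the basis. -/
theorem app_eq_some_some {B : BasisData S} (p : Presentation B X) (Ψ : Γ ⟶ pow (pow X ⊗ pow X))
    (φ ψ : Γ ⟶ pow X) : app Ψ (lift φ ψ) = B.overt.some (B.overt.some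
      (app (fst _ _ ≫ snd _ _ ≫ p.A) (fst _ _ ≫ fst _ _ ≫ φ) ⊓
        app (snd _ _ ≫ p.A) (fst _ _ ≫ fst _ _ ≫ ψ) ⊓
        app (fst _ _ ≫ fst _ _ ≫ Ψ) (lift (fst _ _ ≫ snd _ _ ≫ p.β) (snd _ _ ≫ p.β)))) := by
  have e1 : app Ψ (lift φ ψ) =
      app (lam (app (fst _ _ ≫ Ψ) (lift (snd _ _) (fst _ _ ≫ ψ)))) φ := by simp
  rw [e1, p.app_eq_some]
  congr 1
  have e2 : app (fst Γ B.N ≫ lam (app (fst _ _ ≫ Ψ) (lift (snd _ _) (fst _ _ ≫ ψ))))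
      (snd Γ B.N ≫ p.β) = app (lam (app (fst _ _ ≫ fst _ _ ≫ Ψ)
        (lift (fst _ _ ≫ snd _ _ ≫ p.β) (snd _ _)))) (fst _ _ ≫ ψ) := by simp
  rw [p.app_eq_some _ (fst Γ B.N ≫ ψ)] at e2
  rw [e2]
  refine forces_ext fun f => ⟨fun e => ?_, fun e => ?_⟩
  · rw [comp_inf, inf_forces_iff] at e
    obtain ⟨h1, h2⟩ := e
    rw [comp_some] at h2
    refine some_forces_elim h2 fun g n e => ?_
    rw [← Category.assoc]
    refine comp_some_forces_intro _ _ n ?_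
    have h1 := forces_comp g h1
    simp at e h1 ⊢
    exact ⟨⟨h1, e.1⟩, e.2⟩
  · rw [comp_some] at e
    refine some_forces_elim e fun g n e => ?_
    rw [comp_inf, comp_inf, inf_forces_iff]
    simp at e
    refine ⟨by simpa using e.1.1, ?_⟩
    rw [← Category.assoc]
    refine comp_some_forces_intro _ _ n ?_
    simp
    exact ⟨e.1.2, e.2⟩

variable (p : Presentation B.toBasisData X) (q : Presentation C.toBasisData Y)
  (r : Presentation D.toBasisData Z)

/-- The matrix of a map is an abstract matrix. -/
theorem isAbstractMatrix_matrix (f : X ⟶ Y) : IsAbstractMatrix B C (p.matrix q (powMap f)) where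
  zero := (p.isSecondClassMatrix_matrix q _).zero
  plus := (p.isSecondClassMatrix_matrix q _).plus
  mono := (p.isSecondClassMatrix_matrix q _).mono
  round n' m' := by
    have h := p.isSecondClassMatrix_matrix q (powMap f)
    generalize p.matrix q (powMap f) = ρ at h
    refine forces_ext fun g => ⟨fun e => ?_, fun e => ?_⟩
    · rw [comp_rel, h.round_left] at e
      refine some_forces_elim e fun g' n e => ?_
      simp at e
      have h2 := e.2
      rw [h.round_right] at h2
      refine some_forces_elim h2 fun g'' m h2 => ?_
      simp at h2
      have h1 := forces_comp g'' e.1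
      rw [← Category.assoc, ← Category.assoc, comp_some, comp_some]
      refine some_some_forces_intro _ _ (g'' ≫ n) m ?_
      simp at h1 ⊢
      exact ⟨⟨h1, h2.1⟩, h2.2⟩
    · rw [comp_some, comp_some] at e
      refine some_some_forces_elim e fun g' n m e => ?_
      simp at e ⊢
      rw [h.round_left]
      refine some_forces_intro _ n ?_
      simp
      refine ⟨e.1.1, ?_⟩
      rw [h.round_right]
      refine some_forces_intro _ m ?_
      simp
      exact ⟨e.1.2, e.2⟩
  bot n := by
    rw [p.wb_eq, rel_matrix]
    congr 1
    refine pow_ext fun g x => ?_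
    have h1 := p.β_zero x
    have h2 := q.β_zero (x ≫ f)
    simp [h1, ← Category.assoc]
    simp [h2]
  top n := by
    rw [p.wb_eq, rel_matrix]
    congr 1
    refine pow_ext fun g x => ?_
    have h1 := p.β_one x
    have h2 := q.β_one (x ≫ f)
    simp [h1, ← Category.assoc]
    simp [h2]
  meet {Γ} n s t := by
    have := p.app_eq_some_some (lam (app (fst _ _ ≫ n ≫ p.A)
      (pinf (snd Γ (pow X ⊗ pow X) ≫ fst _ _) (snd _ _ ≫ snd _ _))))
      (s ≫ q.β ≫ powMap f) (t ≫ q.β ≫ powMap f)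
    have e1 : ostar s t ≫ q.β ≫ powMap f = pinf (s ≫ q.β ≫ powMap f) (t ≫ q.β ≫ powMap f) :=
      pow_ext fun g x => by
        simp only [comp_pinf, app_pinf, ← Category.assoc, comp_ostar, app_powMap]
        exact q.β_star (g ≫ s) (g ≫ t) (x ≫ f)
    have e2 : ∀ {Γ : S} (m k : Γ ⟶ B.N), pinf (m ≫ p.β) (k ≫ p.β) = ostar m k ≫ p.β := fun m k =>
      pow_ext fun g x => by simpa using (p.β_star (g ≫ m) (g ≫ k) x).symm
    have e3 := @p.wb_eq
    simp only [wb] at e3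
    simp at this
    simp only [rel_matrix, e1, this, wb, e3, ← e2, Category.assoc]
  join {Γ} n s t := by
    have := p.app_eq_some_some (lam (app (fst _ _ ≫ n ≫ p.A)
      (psup (snd Γ (pow X ⊗ pow X) ≫ fst _ _) (snd _ _ ≫ snd _ _))))
      (s ≫ q.β ≫ powMap f) (t ≫ q.β ≫ powMap f)
    have e1 : oplus s t ≫ q.β ≫ powMap f = psup (s ≫ q.β ≫ powMap f) (t ≫ q.β ≫ powMap f) :=
      pow_ext fun g x => by
        simp only [comp_psup, app_psup, ← Category.assoc, comp_oplus, app_powMap]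
        exact q.β_plus (g ≫ s) (g ≫ t) (x ≫ f)
    have e2 : ∀ {Γ : S} (m k : Γ ⟶ B.N), psup (m ≫ p.β) (k ≫ p.β) = oplus m k ≫ p.β := fun m k =>
      pow_ext fun g x => by simpa using (p.β_plus (g ≫ m) (g ≫ k) x).symm
    have e3 := @p.wb_eq
    simp only [wb] at e3
    simp at this
    simp only [rel_matrix, e1, this, wb, e3, ← e2, Category.assoc]

/-- The term `λ m. H (γ m) x`. -/
def basicValues (H : (pow Y : S) ⟶ pow X) : X ⟶ pow C.N :=
  lam (app (snd _ _ ≫ q.β ≫ H) (fst _ _))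

theorem app_basicValues (H : (pow Y : S) ⟶ pow X) (x : Γ ⟶ X) (m : Γ ⟶ C.N) :
    app (x ≫ q.basicValues H) m = app (m ≫ q.β ≫ H) x := by
  simp [basicValues]

theorem isLatticeHom_basicValues (y : Γ ⟶ Y) : IsLatticeHom (y ≫ q.basicValues (𝟙 _)) where
  zero := by rw [app_basicValues, Category.comp_id, q.β_zero]
  one := by rw [app_basicValues, Category.comp_id, q.β_one]
  add f n m := by
    rw [← Category.assoc, app_basicValues, app_basicValues, app_basicValues, Category.comp_id,
      q.β_plus]
  mul f n m := by
    rw [← Category.assoc, app_basicValues, app_basicValues, app_basicValues, Category.comp_id,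
      q.β_star]

/-- A second class map that preserves the lattice operations on basic predicates is determined,
at every point, by an admissible predicate on the basis. -/
theorem app_basicValues_eq {H : (pow Y : S) ⟶ pow X} {x : Γ ⟶ X}
    (hx : IsLatticeHom (x ≫ q.basicValues H)) (Φ : Γ ⟶ pow (pow C.N)) :
    app Φ (x ≫ q.basicValues H) = app ((Φ ≫ powMap (q.basicValues (𝟙 _))) ≫ H) x := by
  refine forces_ext fun f => ?_
  have hx := hx.comp f
  rw [comp_app, comp_app, ← Category.assoc, ← Category.assoc, ← Category.assoc]
  rw [← Category.assoc] at hx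
  generalize f ≫ x = x at hx
  generalize f ≫ Φ = Φ
  refine ⟨fun e => ?_, fun e => ?_⟩
  · refine scott_elim (A := C.od) e fun g l h1 h2 => ?_
    have h3 := (hx.comp g).prod l
    rw [h2, ← Category.assoc, app_basicValues, ← Category.assoc, ← comp_point_powMap] at h3
    rw [comp_app, ← Category.assoc, ← comp_point_powMap]
    refine app_mono h3 fun g' y h5 => ?_
    have h6 := (q.isLatticeHom_basicValues y).prod (g' ≫ l)
    rw [app_basicValues, ← comp_prod, Category.comp_id, Category.assoc, h5] at h6
    have h7 := scott_intro (Φ := g' ≫ g ≫ Φ) (g' ≫ l) (by simpa using forces_comp g' h1) h6.symm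
    rw [← Category.assoc, ← Category.assoc, app_powMap]
    simpa using h7
  · rw [← comp_point_powMap] at e
    refine q.app_elim e fun g m h1 h2 => ?_
    -- By the Scott principle, `Φ` is the directed join of the polynomials that it covers.
    have hp : ∀ {Γ : S} (L : Γ ⟶ C.od.list.list.obj), L ≫ ASD.poly (𝟙 _) ≫ q.β =
        ASD.poly L ≫ q.β := fun L => by rw [← Category.assoc, comp_poly, Category.comp_id]
    have hq : ∀ {Γ : S} (L : Γ ⟶ C.od.list.list.obj) (y : Γ ⟶ Y),
        app (L ≫ ASD.poly (𝟙 _) ≫ q.β) y = anyAll (A := C.od) (y ≫ q.basicValues (𝟙 _)) L :=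
      fun L y => by
        rw [hp, ← (q.isLatticeHom_basicValues y).poly, app_basicValues, Category.comp_id]
    have hφ : IsJoinHom (A := C.od.list.list) (C.od.list.nil _) (append (fst _ _) (snd _ _))
        (ASD.poly (𝟙 _) ≫ q.β) := by
      constructor
      · intro Γ y
        rw [hq, comp_nil, anyAll_nil]
      · intro Γ L M y
        rw [hq, hq, hq, comp_append, lift_fst, lift_snd, anyAll_append]
    refine hφ.app_elim (lam (allOn (A := C.od) (fst _ _ ≫ g ≫ Φ) (snd _ _))) ?_ ?_ ?_ h1 ?_
    · intro Δ f y h3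
      rw [← Category.assoc, ← Category.assoc, app_powMap] at h3
      refine scott_elim (A := C.od) h3 fun g' l h4 h5 => ?_
      refine comp_some_forces_intro _ _ (cons l (C.od.list.nil _)) ?_
      rw [comp_inf, inf_forces_iff]
      constructor
      · simpa using h4
      · have := hq (cons l (C.od.list.nil _)) (g' ≫ y)
        rw [comp_app, lift_fst_assoc, ← Category.assoc, lift_snd, this]
        simpa using h5
    · simp
    · intro Δ f L M h3 h4
      simp at h3 h4 ⊢
      exact ⟨h3, h4⟩
    · intro Δ f L h3 h4
      have h5 := q.app_intro (Φ := (f ≫ g ≫ x) ≫ point X ≫ powMap H) (f ≫ m)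
        (by simpa using h4) (by simpa using forces_comp f h2)
      have h6 := (hx.comp (f ≫ g)).poly L
      rw [comp_point_powMap, hp, Category.assoc, ← app_basicValues] at h5
      simp only [Category.assoc] at h5 h6
      rw [h6] at h5
      have h7 := allOn_cut (by simpa using h3) h5
      simpa using h7

/-- The functional `λ ψ. ∃ m. C m ψ ∧ ξ m`, as a function of `ξ`. -/
def extend : pow C.N ⟶ (pow (pow Y) : S) :=
  lam (C.overt.some (app (snd _ _ ≫ q.A) (fst _ _ ≫ snd _ _) ⊓ app (fst _ _ ≫ fst _ _) (snd _ _)))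

theorem basicValues_extend (H : (pow Y : S) ⟶ pow X) :
    q.basicValues H ≫ q.extend = point X ≫ powMap H := by
  refine pow_ext fun x ψ => ?_
  have h := q.app_eq_some (x ≫ point X ≫ powMap H) ψ
  have h' : app (fst _ _ ≫ x ≫ point X ≫ powMap H) (snd _ _ ≫ q.β) =
      app ((fst _ _ ≫ x) ≫ q.basicValues H) (snd _ _) := by
    rw [← Category.assoc, comp_point_powMap, app_basicValues, Category.assoc]
  rw [h, h', ← Category.assoc, extend, app_comp_lam, comp_some]
  congr 1
  simp

/-- By sobriety, a second class map that preserves the lattice operations on basic predicates is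
the inverse image map of a morphism. -/
theorem exists_powMap_eq {H : (pow Y : S) ⟶ pow X} (hH : IsLatticeHom (q.basicValues H)) :
    ∃ f : X ⟶ Y, powMap f = H := by
  have hP : IsPrime (point X ≫ powMap H) := by
    intro Δ x F
    have h1 := q.app_basicValues_eq (hH.comp x) (F ≫ powMap q.extend)
    have h2 : q.basicValues (𝟙 _) ≫ q.extend = point Y := by
      rw [basicValues_extend]
      exact pow_ext fun f a => by simp
    rw [app_powMap, Category.assoc x, basicValues_extend, Category.assoc F, ← comp_powMap, h2] at h1
    rw [h1, lam_app_comp, comp_point_powMap]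
  obtain ⟨f, hf, -⟩ := Model.sober _ hP
  refine ⟨f, pow_ext fun φ x => ?_⟩
  rw [app_powMap, ← app_point, Category.assoc, hf, comp_point_powMap]

theorem isLatticeHom_of_isAbstractMatrix {ρ : B.N ⊗ C.N ⟶ (Sig : S)}
    (h : IsAbstractMatrix B C ρ) : IsLatticeHom (q.basicValues (p.ofMatrix q ρ)) := by
  have hκ : ∀ {Γ : S} (x : Γ ⟶ X) (m : Γ ⟶ C.N), app (x ≫ q.basicValues (p.ofMatrix q ρ)) m =
      B.overt.some (rel ρ (snd _ _) (fst _ _ ≫ m) ⊓ app (snd _ _ ≫ p.β) (fst _ _ ≫ x)) := by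
    intro Γ x m
    have e := p.matrix_ofMatrix q h.isSecondClassMatrix
    have := p.rel_matrix q (p.ofMatrix q ρ) (snd Γ B.N) (fst Γ B.N ≫ m)
    rw [e] at this
    rw [app_basicValues, p.expand, this, Category.assoc]
  have elim : ∀ {Γ : S} {x : Γ ⟶ X} {m : Γ ⟶ C.N} {τ : Γ ⟶ (Sig : S)},
      app (x ≫ q.basicValues (p.ofMatrix q ρ)) m = ⊤ →
      (∀ {Δ : S} (f : Δ ⟶ Γ) (n : Δ ⟶ B.N), rel ρ n (f ≫ m) = ⊤ →
        app (n ≫ p.β) (f ≫ x) = ⊤ → f ≫ τ = ⊤) → τ = ⊤ := fun h k => by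
    rw [hκ] at h
    refine some_forces_elim h fun f n e => ?_
    simp at e
    exact k f n e.1 e.2
  have intro' : ∀ {Γ : S} {x : Γ ⟶ X} {m : Γ ⟶ C.N} (n : Γ ⟶ B.N), rel ρ n m = ⊤ →
      app (n ≫ p.β) x = ⊤ → app (x ≫ q.basicValues (p.ofMatrix q ρ)) m = ⊤ := fun n h h' => by
    rw [hκ]
    exact some_forces_intro _ n (by simp [h, h'])
  have hA : ∀ {Γ : S} {n m : Γ ⟶ B.N} {x : Γ ⟶ X}, wb n m = ⊤ → app (n ≫ p.β) x = ⊤ →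
      app (m ≫ p.β) x = ⊤ := fun h1 h2 => p.expand_intro _ (by rw [← p.wb_eq]; exact h1) h2
  have hE : ∀ {Γ : S} {m : Γ ⟶ B.N} {x : Γ ⟶ X} {τ : Γ ⟶ (Sig : S)}, app (m ≫ p.β) x = ⊤ →
      (∀ {Δ : S} (f : Δ ⟶ Γ) (n : Δ ⟶ B.N), wb n (f ≫ m) = ⊤ →
        app (n ≫ p.β) (f ≫ x) = ⊤ → f ≫ τ = ⊤) → τ = ⊤ := fun {_ m _ _} h1 k =>
    p.expand_elim h1 fun f n h2 h3 => k f n (by rw [p.wb_eq, Category.assoc]; exact h2) h3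
  have hzero : ∀ {Γ : S} (x : Γ ⟶ X),
      app (x ≫ q.basicValues (p.ofMatrix q ρ)) (C.O Γ) = app (B.O Γ ≫ p.β) x := fun x => by
    refine forces_ext fun f => ⟨fun e => ?_, fun e => ?_⟩
    · rw [comp_app, ← Category.assoc] at e
      refine elim e fun g n h1 h2 => ?_
      rw [comp_bzero, comp_bzero, ← h.bot] at h1
      simpa using hA h1 h2
    · rw [comp_app, ← Category.assoc, comp_bzero] at e ⊢
      refine hE e fun g n h1 h2 => ?_
      rw [comp_bzero, h.bot] at h1
      simpa using intro' n h1 h2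
  have hone : ∀ {Γ : S} (x : Γ ⟶ X),
      app (x ≫ q.basicValues (p.ofMatrix q ρ)) (C.I Γ) = app (B.I Γ ≫ p.β) x := fun x => by
    refine forces_ext fun f => ⟨fun e => ?_, fun e => ?_⟩
    · rw [comp_app, ← Category.assoc] at e
      refine elim e fun g n h1 h2 => ?_
      rw [comp_bone, comp_bone, ← h.top] at h1
      simpa using hA h1 h2
    · rw [comp_app, ← Category.assoc, comp_bone] at e ⊢
      refine hE e fun g n h1 h2 => ?_
      rw [comp_bone, h.top] at h1
      simpa using intro' n h1 h2
  have hsecond := h.isSecondClassMatrix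
  refine ⟨?_, ?_, fun {Γ} x s t => ?_, fun {Γ} x s t => ?_⟩
  · have := hzero (𝟙 X)
    rw [Category.id_comp, p.β_zero] at this
    exact this
  · have := hone (𝟙 X)
    rw [Category.id_comp, p.β_one] at this
    exact this
  · refine forces_ext fun f => ⟨fun e => ?_, fun e => ?_⟩
    · rw [comp_app, ← Category.assoc] at e
      refine elim e fun g n h1 h2 => ?_
      rw [comp_oplus, comp_oplus, h.join] at h1
      refine some_some_forces_elim h1 fun g' m k h3 => ?_
      simp only [wb, comp_inf, comp_rel, comp_oplus, lift_fst_assoc, lift_snd, inf_forces_iff] at h3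
      obtain ⟨⟨h4, h5⟩, h6⟩ := h3
      have h7 := hA h6 (x := g' ≫ g ≫ f ≫ x) (by simpa using forces_comp g' h2)
      rw [p.β_plus] at h7
      refine sup_forces_elim h7 (fun g'' h8 => ?_) (fun g'' h8 => ?_)
      · rw [comp_sup, comp_sup, comp_sup, comp_sup]
        refine sup_forces_left ?_
        have := intro' (x := g'' ≫ g' ≫ g ≫ f ≫ x) (m := g'' ≫ g' ≫ g ≫ f ≫ s) (g'' ≫ m)
          (by simpa using forces_comp g'' h4) (by simpa using h8)
        simpa using this
      · rw [comp_sup, comp_sup, comp_sup, comp_sup]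
        refine sup_forces_right ?_
        have := intro' (x := g'' ≫ g' ≫ g ≫ f ≫ x) (m := g'' ≫ g' ≫ g ≫ f ≫ t) (g'' ≫ k)
          (by simpa using forces_comp g'' h5) (by simpa using h8)
        simpa using this
    · rw [comp_sup] at e
      have key : ∀ {Δ : S} {g : Δ ⟶ Γ} {m : Δ ⟶ B.N} {s t : Δ ⟶ C.N} (k : Δ ⟶ B.N),
          rel ρ m s = ⊤ → rel ρ k t = ⊤ → app (oplus m k ≫ p.β) (g ≫ x) = ⊤ →
          app ((g ≫ x) ≫ q.basicValues (p.ofMatrix q ρ)) (oplus s t) = ⊤ := by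
        intro Δ g m s t k h1 h2 h3
        refine hE h3 fun g' n h4 h5 => ?_
        rw [comp_app, ← Category.assoc]
        refine intro' n ?_ h5
        rw [comp_oplus, h.join]
        refine some_some_forces_intro _ _ (g' ≫ m) (g' ≫ k) ?_
        simp only [wb, comp_inf, comp_rel, comp_oplus, lift_fst_assoc, lift_snd, inf_forces_iff,
          Category.id_comp]
        exact ⟨⟨by simpa using forces_comp g' h1, by simpa using forces_comp g' h2⟩,
          by simpa using h4⟩
      refine sup_forces_elim e (fun g e => ?_) (fun g e => ?_)
      · rw [comp_app, comp_app, ← Category.assoc, ← Category.assoc] at e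
        refine elim e fun g' m h1 h2 => ?_
        have := key (g := g' ≫ g ≫ f) (m := m) (s := g' ≫ g ≫ f ≫ s) (t := g' ≫ g ≫ f ≫ t)
          (B.O _) (by simpa using h1) (h.zero _) (by
            rw [p.β_plus]; exact sup_forces_left (by simpa using h2))
        simpa using this
      · rw [comp_app, comp_app, ← Category.assoc, ← Category.assoc] at e
        refine elim e fun g' m h1 h2 => ?_
        have := key (g := g' ≫ g ≫ f) (m := B.O _) (s := g' ≫ g ≫ f ≫ s) (t := g' ≫ g ≫ f ≫ t)
          m (h.zero _) (by simpa using h1) (by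
            rw [p.β_plus]; exact sup_forces_right (by simpa using h2))
        simpa using this
  · refine forces_ext fun f => ⟨fun e => ?_, fun e => ?_⟩
    · rw [comp_app, ← Category.assoc] at e
      refine elim e fun g n h1 h2 => ?_
      rw [comp_ostar, comp_ostar, h.meet] at h1
      refine some_some_forces_elim h1 fun g' m k h3 => ?_
      simp only [wb, comp_inf, comp_rel, comp_ostar, lift_fst_assoc, lift_snd, inf_forces_iff] at h3
      obtain ⟨⟨h4, h5⟩, h6⟩ := h3
      have h7 := hA h6 (x := g' ≫ g ≫ f ≫ x) (by simpa using forces_comp g' h2)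
      rw [p.β_star, inf_forces_iff] at h7
      have h8 := intro' (x := g' ≫ g ≫ f ≫ x) (m := g' ≫ g ≫ f ≫ s) m (by simpa using h4) h7.1
      have h9 := intro' (x := g' ≫ g ≫ f ≫ x) (m := g' ≫ g ≫ f ≫ t) k (by simpa using h5) h7.2
      simp at h8 h9 ⊢
      exact ⟨h8, h9⟩
    · rw [comp_inf, inf_forces_iff, comp_app, comp_app, ← Category.assoc] at e
      refine elim e.1 fun g m h1 h2 => ?_
      have e2 := forces_comp g e.2
      rw [comp_app, ← Category.assoc] at e2
      refine elim e2 fun g' k h3 h4 => ?_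
      have h5 : app (ostar (g' ≫ m) k ≫ p.β) (g' ≫ g ≫ f ≫ x) = ⊤ := by
        rw [p.β_star, inf_forces_iff]
        exact ⟨by simpa using forces_comp g' h2, by simpa using h4⟩
      refine hE h5 fun g'' n h6 h7 => ?_
      have := intro' (x := g'' ≫ g' ≫ g ≫ f ≫ x)
        (m := ostar (g'' ≫ g' ≫ g ≫ f ≫ s) (g'' ≫ g' ≫ g ≫ f ≫ t)) n ?_ (by simpa using h7)
      · simpa using this
      · rw [h.meet]
        refine some_some_forces_intro _ _ (g'' ≫ g' ≫ m) (g'' ≫ k) ?_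
        simp only [wb, comp_inf, comp_rel, comp_ostar, lift_fst_assoc, lift_snd, inf_forces_iff,
          Category.id_comp]
        exact ⟨⟨by simpa using forces_comp (g'' ≫ g') h1, by simpa using forces_comp g'' h3⟩,
          by simpa using h6⟩

/-- Every abstract matrix is that of a map. -/
theorem exists_matrix_powMap_eq {ρ : B.N ⊗ C.N ⟶ (Sig : S)} (h : IsAbstractMatrix B C ρ) :
    ∃ f : X ⟶ Y, p.matrix q (powMap f) = ρ := by
  obtain ⟨f, hf⟩ := q.exists_powMap_eq (p.isLatticeHom_of_isAbstractMatrix q h)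
  exact ⟨f, by rw [hf, p.matrix_ofMatrix q h.isSecondClassMatrix]⟩

theorem matrix_injective {F G : (pow Y : S) ⟶ pow X} (h : p.matrix q F = p.matrix q G) :
    F = G := by
  rw [← p.ofMatrix_matrix q F, h, p.ofMatrix_matrix]

end Presentation

end Homomorphisms

/-! ### The equivalences -/

section Equivalences

variable {S : Type u} [Category.{v} S] [CartesianMonoidalCategory S] [Model S] {X Y : S}

@[simp]
theorem powMap_id (X : S) : powMap (𝟙 X) = 𝟙 (pow X : S) :=
  pow_ext fun f a => by simp

variable {b : S → AbstractBasis S} (p : ∀ X, Presentation (b X).toBasisData X)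

/-- The functor that assigns to each object a chosen basis and to each map its matrix. -/
def basisFunctor : S ⥤ AbstractBasis S where
  obj := b
  map {X Y} f := ⟨(p X).matrix (p Y) (powMap f), (p X).isAbstractMatrix_matrix (p Y) f⟩
  map_id X := AbstractMatrix.ext <| by
    change (p X).matrix (p X) (powMap (𝟙 X)) = (b X).waybelow
    rw [powMap_id, Presentation.matrix_id]
  map_comp {X Y Z} f g := AbstractMatrix.ext <| by
    change (p X).matrix (p Z) (powMap (f ≫ g)) = relComp (b Y).overt _ _
    rw [comp_powMap, (p X).matrix_comp (p Y) (p Z)]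

/-- The functor that assigns to each object a chosen basis and to each second class map its
matrix. -/
def secondClassBasisFunctor : Hayo S ⥤ SecondClassBasis S where
  obj X := ⟨b X.obj⟩
  map {X Y} H := ⟨(p X.obj).matrix (p Y.obj) H, (p X.obj).isSecondClassMatrix_matrix (p Y.obj) H⟩
  map_id X := SecondClassMatrix.ext (p X.obj).matrix_id
  map_comp {X Y Z} F G := SecondClassMatrix.ext ((p X.obj).matrix_comp (p Y.obj) (p Z.obj) F G)

theorem basisFunctor_faithful : (basisFunctor p).Faithful where
  map_injective {X Y} f g h := by
    have h1 := (p X).matrix_injective (p Y) (congrArg AbstractMatrix.mat h)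
    refine eq_of_points fun k φ => ?_
    rw [← app_powMap, h1, app_powMap]

theorem basisFunctor_full : (basisFunctor p).Full where
  map_surjective {X Y} ρ := by
    obtain ⟨f, hf⟩ := (p X).exists_matrix_powMap_eq (p Y) ρ.isAbstractMatrix
    exact ⟨f, AbstractMatrix.ext hf⟩

theorem secondClassBasisFunctor_faithful : (secondClassBasisFunctor p).Faithful where
  map_injective {X Y} _ _ h :=
    (p X.obj).matrix_injective (p Y.obj) (congrArg SecondClassMatrix.mat h)

theorem secondClassBasisFunctor_full : (secondClassBasisFunctor p).Full where
  map_surjective {X Y} ρ :=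
    ⟨(p X.obj).ofMatrix (p Y.obj) ρ.mat,
      SecondClassMatrix.ext ((p X.obj).matrix_ofMatrix (p Y.obj) ρ.isSecondClassMatrix)⟩

/-- Two bases of the same object are isomorphic, by the matrix of the identity. -/
def Presentation.basisIso {B C : AbstractBasis S} (q : Presentation B.toBasisData X)
    (r : Presentation C.toBasisData X) : B ≅ C where
  hom := ⟨q.matrix r (powMap (𝟙 X)), q.isAbstractMatrix_matrix r _⟩
  inv := ⟨r.matrix q (powMap (𝟙 X)), r.isAbstractMatrix_matrix q _⟩
  hom_inv_id := AbstractMatrix.ext <| by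
    change relComp C.overt (q.matrix r _) (r.matrix q _) = B.waybelow
    rw [← matrix_comp, powMap_id, Category.comp_id, matrix_id]
  inv_hom_id := AbstractMatrix.ext <| by
    change relComp B.overt (r.matrix q _) (q.matrix r _) = C.waybelow
    rw [← matrix_comp, powMap_id, Category.comp_id, matrix_id]

/-- Isomorphic bases are isomorphic by second class matrices. -/
def secondClassIso {B C : AbstractBasis S} (e : B ≅ C) :
    (⟨B⟩ : SecondClassBasis S) ≅ ⟨C⟩ where
  hom := ⟨e.hom.mat, e.hom.isAbstractMatrix.isSecondClassMatrix⟩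
  inv := ⟨e.inv.mat, e.inv.isAbstractMatrix.isSecondClassMatrix⟩
  hom_inv_id := SecondClassMatrix.ext (congrArg AbstractMatrix.mat e.hom_inv_id)
  inv_hom_id := SecondClassMatrix.ext (congrArg AbstractMatrix.mat e.inv_hom_id)

theorem basisFunctor_essSurj : (basisFunctor p).EssSurj where
  mem_essImage B := by
    obtain ⟨X, ⟨r⟩⟩ := exists_presentation B
    exact ⟨X, ⟨(p X).basisIso r⟩⟩

theorem secondClassBasisFunctor_essSurj : (secondClassBasisFunctor p).EssSurj where
  mem_essImage B := by
    obtain ⟨X, ⟨r⟩⟩ := exists_presentation B.basis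
    exact ⟨⟨X⟩, ⟨secondClassIso ((p X).basisIso r)⟩⟩

end Equivalences

end ASD

theorem mainTheorem2 {S : Type u} [Category.{v} S] [CartesianMonoidalCategory S] [ASD.Model S]
    (hdef : ∀ X : S, ASD.Definable X) :
    Nonempty (S ≌ ASD.AbstractBasis S) ∧ Nonempty (ASD.Hayo S ≌ ASD.SecondClassBasis S) := by
  choose b p using fun X => ASD.exists_presentation_of_definable (hdef X)
  let p' := fun X => (p X).some
  have h1 : (ASD.basisFunctor p').IsEquivalence :=
    { faithful := ASD.basisFunctor_faithful p'
      full := ASD.basisFunctor_full p'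
      essSurj := ASD.basisFunctor_essSurj p' }
  have h2 : (ASD.secondClassBasisFunctor p').IsEquivalence :=
    { faithful := ASD.secondClassBasisFunctor_faithful p'
      full := ASD.secondClassBasisFunctor_full p'
      essSurj := ASD.secondClassBasisFunctor_essSurj p' }
  exact ⟨⟨(ASD.basisFunctor p').asEquivalence⟩, ⟨(ASD.secondClassBasisFunctor p').asEquivalence⟩⟩
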